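/- Let $\mathbb{K}$ be $\mathbb{R}$ or $\mathbb{C}$; "smooth" means $C^\infty$ if $\mathbb{K}=\mathbb{R}$ and holomorphic if $\mathbb{K}=\mathbb{C}$. On a smooth $\mathbb{K}$-manifold $N$ of dimension $n\ge 3$, a metric is a smooth field of nondegenerate symmetric $\mathbb{K}$-bilinear forms on the tangent spaces. A conformal structure $c$ is a smooth line subbundle of $S^2T^*N$ locally spanned by metrics; the metrics that are local sections of it are the local metrics in $c$. For a local metric $g$ with Levi-Civita connection $\nabla$, put $$h=\frac{1}{2n(n-1)}\,\mathrm{Scal}\cdot g+\frac{1}{n-2}\,\mathrm{Ric}_0,\qquad C(X,Y)(Z)=(\nabla_Xh)(Y,Z)-(\nabla_Yh)(X,Z),$$ where $\mathrm{Ric}_0$ is the trace-free Ricci tensor; $C$ is the Cotton–York tensor of $g$ (for $n=3$ it depends only on $c$). Let $(M,c)$ be a conformal $4$-manifold over $\mathbb{K}$ with an orientation, i.e. a smooth choice, for each metric $g$ in $c$, of a volume form $\mathrm{vol}_g$ with $\mathrm{vol}_g(e_1,\dots,e_4)^2=\det(g(e_i,e_j))$ and $\mathrm{vol}_{ag}=a^2\,\mathrm{vol}_g$;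 it defines a Hodge operator $*$ on $2$-forms with $*^2=1$, depending only on $c$ and the orientation. Let $C^+=\frac12(C+{*C})$ be the self-dual part of the $T^*M$-valued $2$-form $C$ of a local metric in $c$, and $W^-=\frac12(W-{*W})$ the anti-self-dual part of the Weyl tensor. Suppose that $M$ is self-dual, i.e. $W^-=0$. Let $Q$ be a $3$-dimensional submanifold of $M$ (more generally, an immersed one) on which the restriction of $c$ is nondegenerate, and suppose that $Q$ is umbilic: for every local metric $g$ in $c$ and every vector $\nu$ normal to $Q$, the second fundamental form $g(\nabla_XY,\nu)$ is a multiple of $g|_{TQ}$. Then, for every local metric $g$ in $c$ and every point of $Q$ in its domain, the restriction to $Q$ of the self-dual Cotton–York tensor $C^+$ of $(M,g)$ is the Cotton–York tensor $C^Q$ of $Q$ with the induced conformal structure, computed with any local metric in it: $$C^+(X,Y)(Z)=C^Q(X,Y)(Z)\qquad\text{for all } X,Y,Z \text{ tangent to } Q .$$ -/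

import Mathlib

open scoped Manifold ContDiff

set_option maxSynthPendingDepth 3

noncomputable section

namespace ConformalGeometry

section Coordinates

/- Classical tensor calculus for a (pseudo- or complex-)Riemannian metric `G` on an open part of a
finite-dimensional vector space `E` over `𝕜 = ℝ` or `ℂ`. -/

variable {𝕜 : Type*} [RCLike 𝕜]
variable {E : Type*} [NormedAddCommGroup E] [NormedSpace 𝕜 E]

/-- The vector `♯ℓ` with `b (♯ℓ, ·) = ℓ`, for a nondegenerate symmetric bilinear form `b`. -/
def sharp (b : E →L[𝕜] E →L[𝕜] 𝕜) : (E →L[𝕜] 𝕜) →L[𝕜] E :=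
  ContinuousLinearMap.inverse b

/-- Christoffel symbols of the first kind:
`(u, v, w) ↦ (∂_u G (v, w) + ∂_v G (u, w) - ∂_w G (u, v)) / 2`. -/
def christoffelLower (G : E → E →L[𝕜] E →L[𝕜] 𝕜) (p : E) : E →L[𝕜] E →L[𝕜] E →L[𝕜] 𝕜 :=
  let D : E →L[𝕜] E →L[𝕜] E →L[𝕜] 𝕜 := fderiv 𝕜 G p
  let flip₂₃ : (E →L[𝕜] E →L[𝕜] 𝕜) →L[𝕜] E →L[𝕜] E →L[𝕜] 𝕜 :=
    (ContinuousLinearMap.flipₗᵢ 𝕜 E E 𝕜).toContinuousLinearEquiv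
  (2⁻¹ : 𝕜) • (D + D.flip - flip₂₃.comp D.flip)

theorem christoffelLower_apply (G : E → E →L[𝕜] E →L[𝕜] 𝕜) (p u v w : E) :
    christoffelLower G p u v w =
      2⁻¹ * (fderiv 𝕜 G p u v w + fderiv 𝕜 G p v u w - fderiv 𝕜 G p w u v) := by
  simp [christoffelLower]

/-- Christoffel symbols of the Levi-Civita connection: `∇_u V = ∂_u V + Γ (u, V)`. -/
def christoffel (G : E → E →L[𝕜] E →L[𝕜] 𝕜) (p : E) : E →L[𝕜] E →L[𝕜] E :=
  (ContinuousLinearMap.compL 𝕜 E (E →L[𝕜] 𝕜) E (sharp (G p))).comp (christoffelLower G p)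

theorem christoffel_apply (G : E → E →L[𝕜] E →L[𝕜] 𝕜) (p u v : E) :
    christoffel G p u v = sharp (G p) (christoffelLower G p u v) := rfl

/-- The Riemannian curvature `R (u, v) w = ∇_u ∇_v w - ∇_v ∇_u w` (`u`, `v`, `w` constant
fields). -/
def curvature (G : E → E →L[𝕜] E →L[𝕜] 𝕜) (p u v w : E) : E :=
  fderiv 𝕜 (christoffel G) p u v w - fderiv 𝕜 (christoffel G) p v u w
    + christoffel G p u (christoffel G p v w) - christoffel G p v (christoffel G p u w)

variable [FiniteDimensional 𝕜 E]

/-- The Ricci tensor `Ric (v, w) = tr (u ↦ R (u, v) w)`. -/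
def ricci (G : E → E →L[𝕜] E →L[𝕜] 𝕜) (p : E) : E →ₗ[𝕜] E →ₗ[𝕜] 𝕜 :=
  LinearMap.mk₂ 𝕜
    (fun v w => LinearMap.trace 𝕜 E
      { toFun := fun u => curvature G p u v w
        map_add' := fun a b => by simp [curvature]; abel
        map_smul' := fun a b => by simp [curvature, smul_sub, smul_add] })
    (fun v v' w => by
      rw [← map_add]; congr 1; ext u; simp [curvature]; abel)
    (fun a v w => by
      rw [← map_smul]; congr 1; ext u; simp [curvature, smul_sub, smul_add])
    (fun v w w' => by
      rw [← map_add]; congr 1; ext u; simp [curvature]; abel)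
    (fun a v w => by
      rw [← map_smul]; congr 1; ext u; simp [curvature, smul_sub, smul_add])

theorem ricci_apply (G : E → E →L[𝕜] E →L[𝕜] 𝕜) (p v w : E) :
    ricci G p v w = ∑ i, (Module.finBasis 𝕜 E).coord i
      (curvature G p (Module.finBasis 𝕜 E i) v w) := by
  simp [ricci, LinearMap.trace_eq_matrix_trace 𝕜 (Module.finBasis 𝕜 E), Matrix.trace,
    LinearMap.toMatrix_apply]

/-- The scalar curvature, the trace of the Ricci tensor with respect to the metric. -/
def scal (G : E → E →L[𝕜] E →L[𝕜] 𝕜) (p : E) : 𝕜 :=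
  LinearMap.trace 𝕜 E ((sharp (G p)).toLinearMap ∘ₗ
    LinearMap.toContinuousLinearMap.toLinearMap ∘ₗ ricci G p)

/-- The normalized Ricci tensor `h = Scal / (2 n (n - 1)) • G + Ric₀ / (n - 2)`, where `n` is the
dimension and `Ric₀ = Ric - (Scal / n) • G` is the trace-free Ricci tensor. -/
def normRicci (G : E → E →L[𝕜] E →L[𝕜] 𝕜) (p v w : E) : 𝕜 :=
  scal G p / (2 * Module.finrank 𝕜 E * (Module.finrank 𝕜 E - 1)) * G p v w
    + (ricci G p v w - scal G p / Module.finrank 𝕜 E * G p v w) / (Module.finrank 𝕜 E - 2)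

/-- The covariant derivative `(∇_u h) (v, w)` of the normalized Ricci tensor. -/
def covDerivNormRicci (G : E → E →L[𝕜] E →L[𝕜] 𝕜) (p u v w : E) : 𝕜 :=
  fderiv 𝕜 (fun q => normRicci G q v w) p u
    - normRicci G p (christoffel G p u v) w - normRicci G p v (christoffel G p u w)

/-- The Cotton-York tensor `C (u, v) (w) = (∇_u h) (v, w) - (∇_v h) (u, w)`. -/
def cotton (G : E → E →L[𝕜] E →L[𝕜] 𝕜) (p u v w : E) : 𝕜 :=
  covDerivNormRicci G p u v w - covDerivNormRicci G p v u w

/-- The Weyl tensor `W (u, v, w, z)`, that is `G (R (u, v) w, z)` minus its Ricci part. -/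
def weyl (G : E → E →L[𝕜] E →L[𝕜] 𝕜) (p u v w z : E) : 𝕜 :=
  G p (curvature G p u v w) z
    - (normRicci G p v w * G p u z - normRicci G p u w * G p v z
      + G p v w * normRicci G p u z - G p u w * normRicci G p v z)

/-- The Hodge operator on `2`-forms of a `4`-dimensional space with metric `b` and volume form
`vol`: `(*α) (u, v) = ½ ∑ i j, vol (u, v, e_i, e_j) α (e^i, e^j)`, where `e_i` is a basis and `e^i`
the `b`-dual basis. -/
def hodge (b : E →L[𝕜] E →L[𝕜] 𝕜) (vol : E [⋀^Fin 4]→L[𝕜] 𝕜) (α : E → E → 𝕜) (u v : E) : 𝕜 :=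
  2⁻¹ * ∑ i, ∑ j, vol ![u, v, Module.finBasis 𝕜 E i, Module.finBasis 𝕜 E j] *
    α (sharp b (LinearMap.toContinuousLinearMap ((Module.finBasis 𝕜 E).coord i)))
      (sharp b (LinearMap.toContinuousLinearMap ((Module.finBasis 𝕜 E).coord j)))

/-- The pull-back of a bilinear form by a linear map. -/
def pullbackForm {F : Type*} [NormedAddCommGroup F] [NormedSpace 𝕜 F]
    (A : F →L[𝕜] E) (b : E →L[𝕜] E →L[𝕜] 𝕜) : F →L[𝕜] F →L[𝕜] 𝕜 :=
  b.bilinearComp A A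

end Coordinates

section Manifolds

/- A manifold `M` over `𝕜` without boundary, modelled on `E`. The tangent space
`TangentSpace 𝓘(𝕜, E) x` is by definition a copy of `E`, the identification being given by the
preferred chart `chartAt E x`; thus a field of bilinear forms on the tangent spaces of `M` is a
function `M → E →L[𝕜] E →L[𝕜] 𝕜`. -/

variable {𝕜 : Type*} [RCLike 𝕜]
variable {E : Type*} [NormedAddCommGroup E] [NormedSpace 𝕜 E]
variable {M : Type*} [TopologicalSpace M] [ChartedSpace E M]

/-- The differential at `p` of the inverse of the preferred chart at `x₀`. -/
def dChartSymm (𝕜 : Type*) [RCLike 𝕜] {E : Type*} [NormedAddCommGroup E] [NormedSpace 𝕜 E]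
    {M : Type*} [TopologicalSpace M] [ChartedSpace E M] (x₀ : M) (p : E) : E →L[𝕜] E :=
  mfderiv 𝓘(𝕜, E) 𝓘(𝕜, E) (chartAt E x₀).symm p

/-- The expression of a field of bilinear forms in the preferred chart at `x₀`. -/
def coordForm (g : M → E →L[𝕜] E →L[𝕜] 𝕜) (x₀ : M) (p : E) : E →L[𝕜] E →L[𝕜] 𝕜 :=
  pullbackForm (dChartSymm 𝕜 x₀ p) (g ((chartAt E x₀).symm p))

/-- `g` is a metric on the open set `U`: a smooth (for `𝕜 = ℂ`: holomorphic) field of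
nondegenerate symmetric `𝕜`-bilinear forms. The values of `g` outside of `U` are irrelevant. -/
structure IsMetricOn (g : M → E →L[𝕜] E →L[𝕜] 𝕜) (U : Set M) : Prop where
  isOpen : IsOpen U
  symm : ∀ x ∈ U, ∀ u v, g x u v = g x v u
  nondegenerate : ∀ x ∈ U, ∀ u, (∀ v, g x u v = 0) → u = 0
  smooth : ∀ x₀ : M, ContDiffOn 𝕜 ∞ (coordForm g x₀)
    ((chartAt E x₀).target ∩ (chartAt E x₀).symm ⁻¹' U)

/-- The Cotton-York tensor at `x` of a metric defined near `x`. -/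
def cottonAt [FiniteDimensional 𝕜 E] (g : M → E →L[𝕜] E →L[𝕜] 𝕜) (x : M)
    (u v w : TangentSpace 𝓘(𝕜, E) x) : 𝕜 :=
  cotton (coordForm g x) (chartAt E x x) u v w

/-- The Weyl tensor at `x` of a metric defined near `x`. -/
def weylAt [FiniteDimensional 𝕜 E] (g : M → E →L[𝕜] E →L[𝕜] 𝕜) (x : M)
    (u v w z : TangentSpace 𝓘(𝕜, E) x) : 𝕜 :=
  weyl (coordForm g x) (chartAt E x x) u v w z

/-- A conformal structure: a line subbundle of the bundle of symmetric bilinear forms on the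
tangent bundle that is locally spanned by metrics. -/
structure ConformalStructure (𝕜 : Type*) [RCLike 𝕜] (E : Type*) [NormedAddCommGroup E]
    [NormedSpace 𝕜 E] (M : Type*) [TopologicalSpace M] [ChartedSpace E M] where
  line : M → Submodule 𝕜 (E →L[𝕜] E →L[𝕜] 𝕜)
  exists_metric : ∀ x, ∃ (U : Set M) (g : M → E →L[𝕜] E →L[𝕜] 𝕜),
    x ∈ U ∧ IsMetricOn g U ∧ ∀ y ∈ U, line y = Submodule.span 𝕜 {g y}

/-- `g` is, on the open set `U`, a local metric in the conformal structure `c`. -/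
structure ConformalStructure.IsLocalMetric (c : ConformalStructure 𝕜 E M)
    (g : M → E →L[𝕜] E →L[𝕜] 𝕜) (U : Set M) : Prop where
  isMetricOn : IsMetricOn g U
  mem_line : ∀ x ∈ U, g x ∈ c.line x

/-- An orientation of a conformal structure on a `4`-manifold: a choice, for each metric `b` of
the conformal structure at `x`, of one of the two volume forms `vol x b` of norm `1`, such that
`vol x (a • b) = a ^ 2 • vol x b` (so that the Hodge operator on `2`-forms does not depend on `b`),
and depending smoothly (holomorphically) on the point. The values of `vol x` on forms outside of
the conformal structure are irrelevant. -/
structure Orientation (c : ConformalStructure 𝕜 E M) where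
  vol : M → (E →L[𝕜] E →L[𝕜] 𝕜) → E [⋀^Fin 4]→L[𝕜] 𝕜
  vol_smul : ∀ x, ∀ b ∈ c.line x, ∀ a : 𝕜, vol x (a • b) = a ^ 2 • vol x b
  vol_sq : ∀ x, ∀ b ∈ c.line x, ∀ e : Fin 4 → E,
    vol x b e ^ 2 = (Matrix.of fun i j => b (e i) (e j)).det
  smooth : ∀ g U, c.IsLocalMetric g U → ∀ x₀ : M, ContDiffOn 𝕜 ∞
    (fun p => (vol ((chartAt E x₀).symm p) (g ((chartAt E x₀).symm p))).compContinuousLinearMap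
      (dChartSymm 𝕜 x₀ p))
    ((chartAt E x₀).target ∩ (chartAt E x₀).symm ⁻¹' U)

namespace Orientation

variable [FiniteDimensional 𝕜 E] {c : ConformalStructure 𝕜 E M}

/-- The anti-self-dual Weyl tensor `W⁻`: the anti-self-dual part of `W` in its first two
arguments, computed with the local metric `g`. -/
def weylMinusAt (o : Orientation c) (g : M → E →L[𝕜] E →L[𝕜] 𝕜) (x : M)
    (u v w z : TangentSpace 𝓘(𝕜, E) x) : 𝕜 :=
  2⁻¹ * (weylAt g x u v w z
    - hodge (g x) (o.vol x (g x)) (fun u' v' => weylAt g x u' v' w z) u v)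

/-- The self-dual Cotton-York tensor `C⁺` of the local metric `g`: the self-dual part of the
`T*M`-valued `2`-form `C`. -/
def cottonPlusAt (o : Orientation c) (g : M → E →L[𝕜] E →L[𝕜] 𝕜) (x : M)
    (u v w : TangentSpace 𝓘(𝕜, E) x) : 𝕜 :=
  2⁻¹ * (cottonAt g x u v w
    + hodge (g x) (o.vol x (g x)) (fun u' v' => cottonAt g x u' v' w) u v)

/-- The oriented conformal structure is self-dual: `W⁻ = 0`. -/
def IsSelfDual (o : Orientation c) : Prop :=
  ∀ g U, c.IsLocalMetric g U → ∀ x ∈ U, ∀ u v w z : TangentSpace 𝓘(𝕜, E) x,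
    o.weylMinusAt g x u v w z = 0

end Orientation

variable {F : Type*} [NormedAddCommGroup F] [NormedSpace 𝕜 F]
variable {Q : Type*} [TopologicalSpace Q] [ChartedSpace F Q]

/-- The restriction to `Q` at `y` of a bilinear form `b` on the tangent space of `M` at `ι y`. -/
def restrictForm (ι : Q → M) (y : Q) (b : E →L[𝕜] E →L[𝕜] 𝕜) : F →L[𝕜] F →L[𝕜] 𝕜 :=
  pullbackForm (E := E) (F := F) (mfderiv 𝓘(𝕜, F) 𝓘(𝕜, E) ι y) b

/-- `ι : Q → M` is an immersion (for instance the inclusion of a submanifold) such that the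
restriction of the conformal structure of `M` to `Q` is nondegenerate. -/
structure ConformalStructure.IsNondegenerateImmersion (c : ConformalStructure 𝕜 E M)
    (ι : Q → M) : Prop where
  contMDiff : ContMDiff 𝓘(𝕜, F) 𝓘(𝕜, E) ∞ ι
  injective_mfderiv : ∀ y, Function.Injective (mfderiv 𝓘(𝕜, F) 𝓘(𝕜, E) ι y)
  nondegenerate : ∀ y, ∀ b ∈ c.line (ι y), b ≠ 0 →
    ∀ u : F, (∀ v : F, restrictForm ι y b u v = 0) → u = 0

/-- `k` is, on the open set `V` of `Q`, a local metric in the conformal structure induced on `Q`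
by the one of `M`. -/
structure ConformalStructure.IsInducedLocalMetric (c : ConformalStructure 𝕜 E M) (ι : Q → M)
    (k : Q → F →L[𝕜] F →L[𝕜] 𝕜) (V : Set Q) : Prop where
  isMetricOn : IsMetricOn k V
  mem_restrict : ∀ y ∈ V, ∃ b ∈ c.line (ι y), k y = restrictForm ι y b

/-- The immersion `ι` in the preferred charts at `y` and `ι y`. -/
def inCharts (E : Type*) [NormedAddCommGroup E] {M : Type*} [TopologicalSpace M]
    [ChartedSpace E M] {F : Type*} [NormedAddCommGroup F] {Q : Type*} [TopologicalSpace Q]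
    [ChartedSpace F Q] (ι : Q → M) (y : Q) : F → E :=
  chartAt E (ι y) ∘ ι ∘ (chartAt F y).symm

/-- The covariant derivative `∇_X (dι Y)` at `y`, with respect to the Levi-Civita connection of the
local metric `g` of `M`, for the fields `X`, `Y` on `Q` that are constant in the chart at `y`:
`∂_X ∂_Y f + Γ (∂_X f, ∂_Y f)`, where `f` is `ι` in charts. Modulo the tangent space of `Q` this is
the second fundamental form. -/
def covDerivAlong (g : M → E →L[𝕜] E →L[𝕜] 𝕜) (ι : Q → M) (y : Q)
    (X Y : TangentSpace 𝓘(𝕜, F) y) : TangentSpace 𝓘(𝕜, E) (ι y) :=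
  let f : F → E := inCharts E ι y
  let p : F := chartAt F y y
  (fderiv 𝕜 (fderiv 𝕜 f) p X Y
    + christoffel (coordForm g (ι y)) (f p) (fderiv 𝕜 f p X) (fderiv 𝕜 f p Y) : E)

/-- `Q` is umbilic in `M`: for each local metric `g` in the conformal structure and each normal
vector `ν`, the second fundamental form `(X, Y) ↦ g (∇_X Y, ν)` is a multiple of the restriction
of `g` to `Q`. -/
def ConformalStructure.IsUmbilic (c : ConformalStructure 𝕜 E M) (ι : Q → M) : Prop :=
  ∀ g U, c.IsLocalMetric g U → ∀ y, ι y ∈ U → ∀ ν : TangentSpace 𝓘(𝕜, E) (ι y),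
    (∀ Z : TangentSpace 𝓘(𝕜, F) y, g (ι y) (mfderiv 𝓘(𝕜, F) 𝓘(𝕜, E) ι y Z) ν = 0) →
    ∃ μ : 𝕜, ∀ X Y : TangentSpace 𝓘(𝕜, F) y,
      g (ι y) (covDerivAlong g ι y X Y) ν = μ * restrictForm (F := F) ι y (g (ι y)) X Y

end Manifolds

end ConformalGeometry

end

set_option linter.unusedSectionVars false

/-! Two facts combine: on a self-dual `M` the tensor `C` is itself self-dual, so `C⁺ = C`; and `W`
vanishes on vectors tangent to an umbilic hypersurface, which makes `C` restrict to `C^Q`.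

Self-duality of `C`. The contracted second Bianchi identity reads `(n - 3) C = div W`
(`divergence_weylL`), hence `C = div W` in dimension 4. The metric and the volume form are parallel,
so the Hodge operator commutes with the covariant derivative, and `*W = W` gives `*∇W = ∇W`
(`covDeriv_weylL_selfDual`). Contraction yields `*C = C` (`cotton_selfDual`).

Vanishing of `W` on `TQ`. For an umbilic hypersurface the normal component of the Gauss-Codazzi
equation writes `W(x, y, z, ν)` as `K(y,z) θ(x) - K(x,z) θ(y)` for a 1-form `θ`; since `W` is
trace-free, `θ = 0` (`codazzi`). In `W = *W` evaluated on tangent vectors, a summand whose two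
contracted indices are both tangent has `vol` of four vectors of a 3-space, and every other summand
vanishes by Codazzi or by antisymmetry (`weyl_tangent`).

Restriction of `C`. Let `K` be any local metric of the induced class, `f` the immersion, `f^*G = φ
K` and `α = dφ / 2φ`. Then `∇df(x, y) = α(x) df(y) + α(y) df(x) + K(x, y) N`. With `W = 0` on `TQ`,
the Gauss equation shows that the curvature of `K` is purely of Ricci type and that `h^K = f^*h +
(∇α - α ⊗ α) + |N|² / (2φ) K` (`IsConformalUmbilic.normRicci_eq`). This identity holds near the
point; it is differentiated and antisymmetrized. The third-order terms in `α` combine to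
`α(R(x,y)z)`, which the same curvature formula cancels, and `C^K = f^*C` remains (`cotton_eq`).
Keeping `φ` arbitrary makes a separate proof of the conformal invariance of `C^Q` unnecessary.

All this is done in open sets of vector spaces. The passage to manifolds uses that chart transitions
are isometries (`isIsometric_transition`); naturality of the curvature under isometries is the Gauss
equation with `α = N = 0`. -/

noncomputable section

namespace ConformalGeometry

/-! ### Nondegenerate symmetric forms, dual frames, and the Hodge operator in any frame. -/

section LinearAlgebra

variable {𝕜 : Type*} [RCLike 𝕜]
variable {E : Type*} [NormedAddCommGroup E] [NormedSpace 𝕜 E]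

/-- A nondegenerate symmetric bilinear form. -/
structure IsScalarProduct (b : E →L[𝕜] E →L[𝕜] 𝕜) : Prop where
  symm : ∀ u v, b u v = b v u
  nondegenerate : ∀ u, (∀ v, b u v = 0) → u = 0

variable [FiniteDimensional 𝕜 E] {b : E →L[𝕜] E →L[𝕜] 𝕜}

namespace IsScalarProduct

theorem exists_equiv (hb : IsScalarProduct b) :
    ∃ e : E ≃L[𝕜] (E →L[𝕜] 𝕜), (e : E →L[𝕜] E →L[𝕜] 𝕜) = b := by
  have hinj : Function.Injective (b : E →ₗ[𝕜] E →L[𝕜] 𝕜) := by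
    refine (injective_iff_map_eq_zero _).2 fun u hu => hb.nondegenerate u fun v => ?_
    have : b u = 0 := hu
    simp [this]
  have hdim : Module.finrank 𝕜 E = Module.finrank 𝕜 (E →L[𝕜] 𝕜) := by
    rw [← LinearEquiv.finrank_eq
      (LinearMap.toContinuousLinearMap : (E →ₗ[𝕜] 𝕜) ≃ₗ[𝕜] (E →L[𝕜] 𝕜))]
    exact (Subspace.dual_finrank_eq (K := 𝕜) (V := E)).symm
  refine ⟨(LinearMap.linearEquivOfInjective _ hinj hdim).toContinuousLinearEquiv, ?_⟩
  ext u v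
  rfl

theorem sharp_apply (hb : IsScalarProduct b) (l : E →L[𝕜] 𝕜) (v : E) : b (sharp b l) v = l v := by
  obtain ⟨e, rfl⟩ := hb.exists_equiv
  simp [sharp]

theorem ext (hb : IsScalarProduct b) {u u' : E} (h : ∀ v, b u v = b u' v) : u = u' := by
  rw [← sub_eq_zero]
  exact hb.nondegenerate _ fun v => by simp [h v]

theorem contDiffAt_sharp (hb : IsScalarProduct b) {n : WithTop ℕ∞} :
    ContDiffAt 𝕜 n (sharp : (E →L[𝕜] E →L[𝕜] 𝕜) → _) b := by
  have := FiniteDimensional.complete 𝕜 E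
  obtain ⟨e, rfl⟩ := hb.exists_equiv
  exact contDiffAt_map_inverse e

/-- The pull-back of a scalar product by a linear automorphism. -/
theorem pullback {F : Type*} [NormedAddCommGroup F] [NormedSpace 𝕜 F]
    (hb : IsScalarProduct b) (A : F →L[𝕜] E) (hA : Function.Bijective A) :
    IsScalarProduct (pullbackForm A b) where
  symm u v := by simp [pullbackForm, hb.symm (A u)]
  nondegenerate u hu := by
    refine hA.1 ?_
    rw [map_zero]
    refine hb.nondegenerate _ fun v => ?_
    obtain ⟨v, rfl⟩ := hA.2 v
    simpa [pullbackForm] using hu v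

end IsScalarProduct

variable {κ : Type*} [Fintype κ] [DecidableEq κ]

/-- `s` is the basis dual to `e` with respect to `b`. -/
def IsDualFrame (b : E →L[𝕜] E →L[𝕜] 𝕜) (e : Module.Basis κ 𝕜 E) (s : κ → E) : Prop :=
  ∀ i j, b (s i) (e j) = if i = j then 1 else 0

/-- The basis dual to `e` with respect to `b`. -/
def dualFrame (b : E →L[𝕜] E →L[𝕜] 𝕜) (e : Module.Basis κ 𝕜 E) (i : κ) : E :=
  sharp b (LinearMap.toContinuousLinearMap (e.coord i))

theorem IsScalarProduct.isDualFrame_dualFrame (hb : IsScalarProduct b) (e : Module.Basis κ 𝕜 E) :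
    IsDualFrame b e (dualFrame b e) := by
  intro i j
  simp [dualFrame, hb.sharp_apply, Finsupp.single_apply, eq_comm]

namespace IsDualFrame

variable {e : Module.Basis κ 𝕜 E} {s : κ → E}

theorem repr_apply (hs : IsDualFrame b e s) (x : E) (i : κ) : e.repr x i = b (s i) x := by
  have h := congrArg (b (s i)) (e.sum_repr x)
  rw [← h, map_sum]
  simp only [map_smul, hs i _]
  simp

theorem sum_left (hs : IsDualFrame b e s) (x : E) : ∑ i, b (s i) x • e i = x := by
  conv_rhs => rw [← e.sum_repr x]
  simp [hs.repr_apply]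

theorem sum_right (hb : IsScalarProduct b) (hs : IsDualFrame b e s) (x : E) :
    ∑ i, b x (e i) • s i = x := by
  refine hb.ext fun v => ?_
  rw [← hs.sum_left v]
  simp only [map_sum, map_smul, FunLike.coe_sum, Finset.sum_apply, FunLike.coe_smul, Pi.smul_apply, smul_eq_mul]
  refine Finset.sum_congr rfl fun j _ => ?_
  simp [hs _ _, mul_comm]

theorem trace_eq (hs : IsDualFrame b e s) (A : E →ₗ[𝕜] E) :
    LinearMap.trace 𝕜 E A = ∑ i, b (s i) (A (e i)) := by
  simp [LinearMap.trace_eq_matrix_trace 𝕜 e, Matrix.trace, LinearMap.toMatrix_apply,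
    hs.repr_apply]

theorem sum_self (hs : IsDualFrame b e s) : ∑ i, b (s i) (e i) = Fintype.card κ := by
  simp [hs _ _]

/-- The contraction of a bilinear map does not depend on the frame. -/
theorem contraction_eq {κ' : Type*} [Fintype κ'] [DecidableEq κ'] (hb : IsScalarProduct b)
    (hs : IsDualFrame b e s) {e' : Module.Basis κ' 𝕜 E} {s' : κ' → E} (hs' : IsDualFrame b e' s')
    {V : Type*} [AddCommGroup V] [Module 𝕜 V] (B : E →ₗ[𝕜] E →ₗ[𝕜] V) :
    ∑ i, B (e i) (s i) = ∑ i, B (e' i) (s' i) := by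
  have h1 : ∀ i, B (e' i) (s' i) = ∑ k, b (s k) (e' i) • B (e k) (s' i) := by
    intro i
    conv_lhs => rw [← hs.sum_left (e' i)]
    simp
  have h2 : ∀ k, B (e k) (s k) = ∑ i, b (s k) (e' i) • B (e k) (s' i) := by
    intro k
    conv_lhs => rw [← hs'.sum_right hb (s k)]
    simp
  simp_rw [h1, h2]
  exact Finset.sum_comm

/-- The contraction of a bilinear map is symmetric. -/
theorem contraction_symm (hb : IsScalarProduct b) (hs : IsDualFrame b e s)
    {V : Type*} [AddCommGroup V] [Module 𝕜 V] (B : E →ₗ[𝕜] E →ₗ[𝕜] V) :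
    ∑ i, B (s i) (e i) = ∑ i, B (e i) (s i) := by
  have h1 : ∀ i, B (s i) (e i) = ∑ k, b (s i) (s k) • B (e k) (e i) := by
    intro i
    conv_lhs => rw [← hs.sum_left (s i)]
    simp [hb.symm (s i)]
  have h2 : ∀ k, B (e k) (s k) = ∑ i, b (s i) (s k) • B (e k) (e i) := by
    intro k
    conv_lhs => rw [← hs.sum_left (s k)]
    simp
  simp_rw [h1, h2]
  exact Finset.sum_comm

/-- The image of a dual frame by an isometry. -/
theorem map {F : Type*} [NormedAddCommGroup F] [NormedSpace 𝕜 F] (L : E ≃L[𝕜] F)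
    {b' : F →L[𝕜] F →L[𝕜] 𝕜} [FiniteDimensional 𝕜 F] (hL : ∀ u v, b' (L u) (L v) = b u v)
    (hs : IsDualFrame b e s) :
    IsDualFrame b' (e.map L.toLinearEquiv) (fun i => L (s i)) := by
  intro i j
  simpa [hL] using hs i j

end IsDualFrame

/-- The bilinear form `(x, y) ↦ vol (u, v, x, y)`. -/
def volForm (vol : E [⋀^Fin 4]→L[𝕜] 𝕜) (u v : E) : E →ₗ[𝕜] E →ₗ[𝕜] 𝕜 :=
  have hup3 : ∀ x c z : E, Function.update ![u, v, x, c] 2 z = ![u, v, z, c] := by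
    intro x c z; ext i; fin_cases i <;> rfl
  have hup4 : ∀ x c z : E, Function.update ![u, v, c, x] 3 z = ![u, v, c, z] := by
    intro x c z; ext i; fin_cases i <;> rfl
  LinearMap.mk₂ 𝕜 (fun x y => vol ![u, v, x, y])
    (fun x y c => by simpa [hup3] using vol.toAlternatingMap.map_update_add ![u, v, 0, c] 2 x y)
    (fun a x c => by simpa [hup3] using vol.toAlternatingMap.map_update_smul ![u, v, 0, c] 2 a x)
    (fun c x y => by simpa [hup4] using vol.toAlternatingMap.map_update_add ![u, v, c, 0] 3 x y)
    (fun a c x => by simpa [hup4] using vol.toAlternatingMap.map_update_smul ![u, v, c, 0] 3 a x)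

/-- The frame is exchanged in one index at a time, by `contraction_eq`. This frees `hodge` from the
fixed basis of its definition. -/
theorem IsDualFrame.double_contraction_eq {e : Module.Basis κ 𝕜 E} {s : κ → E}
    {κ' : Type*} [Fintype κ'] [DecidableEq κ'] (hb : IsScalarProduct b)
    (hs : IsDualFrame b e s) {e' : Module.Basis κ' 𝕜 E} {s' : κ' → E} (hs' : IsDualFrame b e' s')
    (A B : E →ₗ[𝕜] E →ₗ[𝕜] 𝕜) :
    ∑ i, ∑ j, A (e i) (e j) * B (s i) (s j) = ∑ i, ∑ j, A (e' i) (e' j) * B (s' i) (s' j) := by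
  calc ∑ i, ∑ j, A (e i) (e j) * B (s i) (s j)
      = ∑ i, ∑ j, A (e i) (e' j) * B (s i) (s' j) := Finset.sum_congr rfl fun i _ =>
        hs.contraction_eq hb hs' ((LinearMap.mul 𝕜 𝕜).compl₁₂ (A (e i)) (B (s i)))
    _ = ∑ j, ∑ i, A (e i) (e' j) * B (s i) (s' j) := Finset.sum_comm
    _ = ∑ j, ∑ i, A (e' i) (e' j) * B (s' i) (s' j) := Finset.sum_congr rfl fun j _ =>
        hs.contraction_eq hb hs'
          ((LinearMap.mul 𝕜 𝕜).compl₁₂ (A.flip (e' j)) (B.flip (s' j)))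
    _ = _ := Finset.sum_comm

/-- The Hodge operator in an arbitrary frame. -/
theorem hodge_eq (hb : IsScalarProduct b) {e : Module.Basis κ 𝕜 E} {s : κ → E}
    (hs : IsDualFrame b e s) (vol : E [⋀^Fin 4]→L[𝕜] 𝕜) {α : E → E → 𝕜} (A : E →ₗ[𝕜] E →ₗ[𝕜] 𝕜)
    (hα : ∀ u v, α u v = A u v) (u v : E) :
    hodge b vol α u v = 2⁻¹ * ∑ i, ∑ j, vol ![u, v, e i, e j] * α (s i) (s j) := by
  simp only [hodge, hα]
  congr 1
  exact (hb.isDualFrame_dualFrame (Module.finBasis 𝕜 E)).double_contraction_eq hb hs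
    (volForm vol u v) A

/-- Naturality of the Hodge operator. -/
theorem hodge_map {F : Type*} [NormedAddCommGroup F] [NormedSpace 𝕜 F] [FiniteDimensional 𝕜 F]
    (L : E ≃L[𝕜] F) {b' : F →L[𝕜] F →L[𝕜] 𝕜} (hb : IsScalarProduct b) (hb' : IsScalarProduct b')
    (hL : ∀ u v, b' (L u) (L v) = b u v) {vol : E [⋀^Fin 4]→L[𝕜] 𝕜} {vol' : F [⋀^Fin 4]→L[𝕜] 𝕜}
    (hvol : ∀ x, vol' (fun i => L (x i)) = vol x) {α : F → F → 𝕜} (A : F →ₗ[𝕜] F →ₗ[𝕜] 𝕜)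
    (hα : ∀ u v, α u v = A u v) (u v : E) :
    hodge b' vol' α (L u) (L v) = hodge b vol (fun x y => α (L x) (L y)) u v := by
  have hs := hb.isDualFrame_dualFrame (Module.finBasis 𝕜 E)
  rw [hodge_eq hb' (hs.map L hL) vol' A hα, hodge_eq hb hs vol (A.compl₁₂ L L) (by simp [hα])]
  congr 1
  refine Finset.sum_congr rfl fun i _ => Finset.sum_congr rfl fun j _ => ?_
  rw [← hvol]
  congr 2
  ext k
  fin_cases k <;> rfl

end LinearAlgebra

/-! ### Levi-Civita connection and curvature identities of a metric in coordinates. -/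

section Metrics

variable {𝕜 : Type*} [RCLike 𝕜]
variable {E : Type*} [NormedAddCommGroup E] [NormedSpace 𝕜 E]

/-- The Leibniz rule behind most derivative computations below. With constant `V` and `W` it moves
evaluation in and out of the derivative. -/
theorem fderiv_clm_apply₂ {F E₁ E₂ H : Type*} [NormedAddCommGroup F] [NormedSpace 𝕜 F]
    [NormedAddCommGroup E₁] [NormedSpace 𝕜 E₁] [NormedAddCommGroup E₂] [NormedSpace 𝕜 E₂]
    [NormedAddCommGroup H] [NormedSpace 𝕜 H]
    {B : F → E₁ →L[𝕜] E₂ →L[𝕜] H} {V : F → E₁} {W : F → E₂} {q : F}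
    (hB : DifferentiableAt 𝕜 B q) (hV : DifferentiableAt 𝕜 V q) (hW : DifferentiableAt 𝕜 W q)
    (x : F) :
    fderiv 𝕜 (fun q => B q (V q) (W q)) q x =
      fderiv 𝕜 B q x (V q) (W q) + B q (fderiv 𝕜 V q x) (W q) + B q (V q) (fderiv 𝕜 W q x) := by
  rw [fderiv_clm_apply (hB.clm_apply hV) hW, fderiv_clm_apply hB hV]
  simp
  abel

theorem fderiv_clm_apply₁ {F E₁ H : Type*} [NormedAddCommGroup F] [NormedSpace 𝕜 F]
    [NormedAddCommGroup E₁] [NormedSpace 𝕜 E₁]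
    [NormedAddCommGroup H] [NormedSpace 𝕜 H]
    {B : F → E₁ →L[𝕜] H} {V : F → E₁} {q : F}
    (hB : DifferentiableAt 𝕜 B q) (hV : DifferentiableAt 𝕜 V q) (x : F) :
    fderiv 𝕜 (fun q => B q (V q)) q x = fderiv 𝕜 B q x (V q) + B q (fderiv 𝕜 V q x) := by
  rw [fderiv_clm_apply hB hV]
  simp
  abel

variable [FiniteDimensional 𝕜 E]

/-- A metric on an open subset of a vector space. -/
structure IsCoordMetric (G : E → E →L[𝕜] E →L[𝕜] 𝕜) (Ω : Set E) : Prop where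
  isOpen : IsOpen Ω
  scalar : ∀ p ∈ Ω, IsScalarProduct (G p)
  smooth : ContDiffOn 𝕜 ∞ G Ω

/-- The Riemannian curvature as a trilinear map. -/
def curvatureL (G : E → E →L[𝕜] E →L[𝕜] 𝕜) (p : E) : E →L[𝕜] E →L[𝕜] E →L[𝕜] E :=
  let D : E →L[𝕜] E →L[𝕜] E →L[𝕜] E := fderiv 𝕜 (christoffel G) p
  let B : E →L[𝕜] E →L[𝕜] E →L[𝕜] E :=
    (ContinuousLinearMap.mul 𝕜 (E →L[𝕜] E)).bilinearComp (christoffel G p) (christoffel G p)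
  D - D.flip + B - B.flip

theorem curvatureL_apply (G : E → E →L[𝕜] E →L[𝕜] 𝕜) (p u v w : E) :
    curvatureL G p u v w = curvature G p u v w := by
  simp [curvatureL, curvature]

/-- The normalized Ricci tensor as a bilinear form. -/
def normRicciL (G : E → E →L[𝕜] E →L[𝕜] 𝕜) (p : E) : E →L[𝕜] E →L[𝕜] 𝕜 :=
  LinearMap.toContinuousLinearMap (LinearMap.toContinuousLinearMap.toLinearMap ∘ₗ
    (LinearMap.mk₂ 𝕜 (normRicci G p)
      (fun u v w => by simp [normRicci]; ring)
      (fun a v w => by simp [normRicci]; ring)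
      (fun u v w => by simp [normRicci]; ring)
      (fun a v w => by simp [normRicci]; ring)))

theorem normRicciL_apply (G : E → E →L[𝕜] E →L[𝕜] 𝕜) (p u v : E) :
    normRicciL G p u v = normRicci G p u v := rfl

namespace IsCoordMetric

variable {G : E → E →L[𝕜] E →L[𝕜] 𝕜} {Ω : Set E} {p : E}

theorem contDiffOn_sharp (hG : IsCoordMetric G Ω) : ContDiffOn 𝕜 ∞ (fun p => sharp (G p)) Ω :=
  fun p hp => ((hG.scalar p hp).contDiffAt_sharp (n := ∞)).comp_contDiffWithinAt p (hG.smooth p hp)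

theorem contDiffOn_fderiv (hG : IsCoordMetric G Ω) : ContDiffOn 𝕜 ∞ (fderiv 𝕜 G) Ω :=
  hG.smooth.fderiv_of_isOpen hG.isOpen (by simp)

theorem contDiffOn_christoffel (hG : IsCoordMetric G Ω) : ContDiffOn 𝕜 ∞ (christoffel G) Ω := by
  have hD := hG.contDiffOn_fderiv
  have hS := hG.contDiffOn_sharp
  refine contDiffOn_clm_apply.2 fun u => contDiffOn_clm_apply.2 fun v => ?_
  simp only [christoffel_apply]
  refine hS.clm_apply (contDiffOn_clm_apply.2 fun w => ?_)
  simp only [christoffelLower_apply]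
  fun_prop

theorem contDiffOn_fderiv_christoffel (hG : IsCoordMetric G Ω) :
    ContDiffOn 𝕜 ∞ (fderiv 𝕜 (christoffel G)) Ω :=
  hG.contDiffOn_christoffel.fderiv_of_isOpen hG.isOpen (by simp)

theorem contDiffOn_curvatureL (hG : IsCoordMetric G Ω) : ContDiffOn 𝕜 ∞ (curvatureL G) Ω := by
  have hD := hG.contDiffOn_fderiv_christoffel
  have hS := hG.contDiffOn_christoffel
  refine contDiffOn_clm_apply.2 fun u => contDiffOn_clm_apply.2 fun v =>
    contDiffOn_clm_apply.2 fun w => ?_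
  simp only [curvatureL_apply, curvature]
  fun_prop

theorem differentiableAt (hG : IsCoordMetric G Ω) (hp : p ∈ Ω) : DifferentiableAt 𝕜 G p :=
  (hG.smooth.contDiffAt (hG.isOpen.mem_nhds hp)).differentiableAt (by simp)

theorem differentiableAt_christoffel (hG : IsCoordMetric G Ω) (hp : p ∈ Ω) :
    DifferentiableAt 𝕜 (christoffel G) p :=
  (hG.contDiffOn_christoffel.contDiffAt (hG.isOpen.mem_nhds hp)).differentiableAt (by simp)

theorem differentiableAt_curvatureL (hG : IsCoordMetric G Ω) (hp : p ∈ Ω) :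
    DifferentiableAt 𝕜 (curvatureL G) p :=
  (hG.contDiffOn_curvatureL.contDiffAt (hG.isOpen.mem_nhds hp)).differentiableAt (by simp)

theorem eventually_mem (hG : IsCoordMetric G Ω) (hp : p ∈ Ω) : ∀ᶠ q in nhds p, q ∈ Ω :=
  hG.isOpen.mem_nhds hp

theorem fderiv_symm (hG : IsCoordMetric G Ω) (hp : p ∈ Ω) (u v w : E) :
    fderiv 𝕜 G p u v w = fderiv 𝕜 G p u w v := by
  have hd := hG.differentiableAt hp
  have h1 := fderiv_clm_apply₂ hd (differentiableAt_const v) (differentiableAt_const w) u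
  have h2 := fderiv_clm_apply₂ hd (differentiableAt_const w) (differentiableAt_const v) u
  have h : (fun q => G q v w) =ᶠ[nhds p] fun q => G q w v :=
    (hG.eventually_mem hp).mono fun q hq => (hG.scalar q hq).symm v w
  rw [h.fderiv_eq, h2] at h1
  simpa using h1.symm

theorem christoffel_symm (hG : IsCoordMetric G Ω) (hp : p ∈ Ω) (u v : E) :
    christoffel G p u v = christoffel G p v u := by
  refine (hG.scalar p hp).ext fun w => ?_
  simp only [christoffel_apply, (hG.scalar p hp).sharp_apply, christoffelLower_apply]
  rw [hG.fderiv_symm hp w u v]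
  ring

/-- The Levi-Civita connection is metric. -/
theorem fderiv_eq (hG : IsCoordMetric G Ω) (hp : p ∈ Ω) (u v w : E) :
    fderiv 𝕜 G p u v w = G p (christoffel G p u v) w + G p v (christoffel G p u w) := by
  rw [(hG.scalar p hp).symm v]
  simp only [christoffel_apply, (hG.scalar p hp).sharp_apply, christoffelLower_apply]
  rw [hG.fderiv_symm hp w u v, hG.fderiv_symm hp v u w, hG.fderiv_symm hp w v u,
    hG.fderiv_symm hp u w v]
  ring

theorem fderiv_christoffel_symm (hG : IsCoordMetric G Ω) (hp : p ∈ Ω) (u v w : E) :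
    fderiv 𝕜 (christoffel G) p u v w = fderiv 𝕜 (christoffel G) p u w v := by
  have hd := hG.differentiableAt_christoffel hp
  have h1 := fderiv_clm_apply₂ hd (differentiableAt_const v) (differentiableAt_const w) u
  have h2 := fderiv_clm_apply₂ hd (differentiableAt_const w) (differentiableAt_const v) u
  have h : (fun q => christoffel G q v w) =ᶠ[nhds p] fun q => christoffel G q w v :=
    (hG.eventually_mem hp).mono fun q hq => hG.christoffel_symm hq v w
  rw [h.fderiv_eq, h2] at h1
  simpa using h1.symm

theorem fderiv_fderiv_symm (hG : IsCoordMetric G Ω) (hp : p ∈ Ω) (u v : E) :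
    fderiv 𝕜 (fderiv 𝕜 G) p u v = fderiv 𝕜 (fderiv 𝕜 G) p v u :=
  ((hG.smooth.contDiffAt (hG.isOpen.mem_nhds hp)).isSymmSndFDerivAt
    (by rw [minSmoothness_of_isRCLikeNormedField]; exact WithTop.coe_le_coe.2 le_top)).eq u v

end IsCoordMetric

theorem curvature_antisymm (G : E → E →L[𝕜] E →L[𝕜] 𝕜) (p u v w : E) :
    curvature G p u v w = - curvature G p v u w := by
  simp [curvature]; abel

namespace IsCoordMetric

variable {G : E → E →L[𝕜] E →L[𝕜] 𝕜} {Ω : Set E} {p : E}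

/-- The first Bianchi identity. -/
theorem curvature_cyclic (hG : IsCoordMetric G Ω) (hp : p ∈ Ω) (u v w : E) :
    curvature G p u v w + curvature G p v w u + curvature G p w u v = 0 := by
  simp only [curvature]
  rw [hG.fderiv_christoffel_symm hp u v w, hG.fderiv_christoffel_symm hp v u w,
    hG.fderiv_christoffel_symm hp w v u, hG.christoffel_symm hp v w, hG.christoffel_symm hp u w,
    hG.christoffel_symm hp u v]
  abel

/-- The second derivatives of `G` commute; expressed through a metric connection, their commutator
is the action of the curvature on `G`, which therefore vanishes. -/
theorem curvature_skew (hG : IsCoordMetric G Ω) (hp : p ∈ Ω) (u v w z : E) :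
    G p (curvature G p u v w) z = - G p (curvature G p u v z) w := by
  -- Obtained by differentiating `fderiv_eq`. The two terms with one Christoffel symbol in each slot
  -- of `G` are exchanged by `u ↔ v`, so they drop out of the commutator.
  have key : ∀ u v, fderiv 𝕜 (fderiv 𝕜 G) p u v w z =
      G p (christoffel G p u (christoffel G p v w)) z
      + G p (christoffel G p v w) (christoffel G p u z)
      + G p (fderiv 𝕜 (christoffel G) p u v w) z
      + (G p (christoffel G p u w) (christoffel G p v z)
      + G p w (christoffel G p u (christoffel G p v z))
      + G p w (fderiv 𝕜 (christoffel G) p u v z)) := by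
    intro u v
    have hd := hG.differentiableAt hp
    have hc := hG.differentiableAt_christoffel hp
    have hdd : DifferentiableAt 𝕜 (fderiv 𝕜 G) p :=
      (hG.contDiffOn_fderiv.contDiffAt (hG.isOpen.mem_nhds hp)).differentiableAt (by simp)
    have hcw : ∀ w, DifferentiableAt 𝕜 (fun q => christoffel G q v w) p := fun w => by fun_prop
    have h : (fun q => fderiv 𝕜 G q v w z) =ᶠ[nhds p]
        fun q => G q (christoffel G q v w) z + G q w (christoffel G q v z) :=
      (hG.eventually_mem hp).mono fun q hq => hG.fderiv_eq hq v w z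
    have h1 := congrArg (fun L => L u) (h.fderiv_eq (𝕜 := 𝕜))
    have hcd : ∀ w, fderiv 𝕜 (fun q => christoffel G q v w) p u
        = fderiv 𝕜 (christoffel G) p u v w := fun w => by
      rw [fderiv_clm_apply₂ hc (differentiableAt_const v) (differentiableAt_const w) u]
      simp
    have hl : fderiv 𝕜 (fun q => fderiv 𝕜 G q v w z) p u
        = fderiv 𝕜 (fderiv 𝕜 G) p u v w z := by
      rw [fderiv_clm_apply₂ (B := fun q => fderiv 𝕜 G q v) (hdd.clm_apply (differentiableAt_const v)) (differentiableAt_const w) (differentiableAt_const z) u,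
        fderiv_clm_apply₁ hdd (differentiableAt_const v)]
      simp
    rw [hl, fderiv_fun_add (by fun_prop) (by fun_prop), add_apply,
      fderiv_clm_apply₂ hd (hcw w) (differentiableAt_const z),
      fderiv_clm_apply₂ hd (differentiableAt_const w) (hcw z), hcd, hcd,
      hG.fderiv_eq hp, hG.fderiv_eq hp] at h1
    rw [h1]
    simp
  have h1 := key u v
  rw [hG.fderiv_fderiv_symm hp, key v u] at h1
  rw [(hG.scalar p hp).symm _ w]
  simp only [curvature, map_add, map_sub, add_apply, sub_apply]
  linear_combination -h1

/-- The octahedron argument: four instances of the first Bianchi identity, brought to a common form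
by the two skew symmetries, are added with suitable signs. -/
theorem curvature_pair_symm (hG : IsCoordMetric G Ω) (hp : p ∈ Ω) (u v w z : E) :
    G p (curvature G p u v w) z = G p (curvature G p w z u) v := by
  have a : ∀ u v w z, G p (curvature G p u v w) z = - G p (curvature G p v u w) z := by
    intro u v w z
    rw [curvature_antisymm]; simp
  have s := hG.curvature_skew hp
  have c : ∀ u v w z, G p (curvature G p u v w) z + G p (curvature G p v w u) z
      + G p (curvature G p w u v) z = 0 := by
    intro u v w z
    simpa using congrArg (fun x => G p x z) (hG.curvature_cyclic hp u v w)
  have h1 := c u v w z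
  have h2 := c v w z u
  rw [s v w z u, s w z v u, a z v w u] at h2
  have h3 := c w z u v
  rw [a z u w v, s u z w v, a u w z v, s w u z v] at h3
  have h4 := c z u v w
  rw [a z u v w, s u v z w, s v z u w] at h4
  linear_combination (h1 + h2 - h3 - h4) / 2

end IsCoordMetric

/-! ### Ricci decomposition of the curvature and traces. -/

section Contractions

variable {G : E → E →L[𝕜] E →L[𝕜] 𝕜} {p : E} {κ : Type*} [Fintype κ] [DecidableEq κ]
  {e : Module.Basis κ 𝕜 E} {s : κ → E}

namespace IsDualFrame

theorem ricci_eq (hs : IsDualFrame (G p) e s) (v w : E) :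
    ricci G p v w = ∑ i, G p (s i) (curvature G p (e i) v w) := by
  rw [ricci, LinearMap.mk₂_apply, hs.trace_eq]
  rfl

theorem scal_eq (hb : IsScalarProduct (G p)) (hs : IsDualFrame (G p) e s) :
    scal G p = ∑ i, ricci G p (e i) (s i) := by
  rw [scal, hs.trace_eq]
  refine Finset.sum_congr rfl fun i _ => ?_
  rw [hb.symm]
  exact hb.sharp_apply _ _

theorem contraction_left (hb : IsScalarProduct (G p)) (hs : IsDualFrame (G p) e s)
    {V : Type*} [AddCommGroup V] [Module 𝕜 V] (l : E →ₗ[𝕜] V) (x : E) :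
    ∑ i, G p x (e i) • l (s i) = l x := by
  conv_rhs => rw [← hs.sum_right hb x]
  simp

theorem contraction_right (hs : IsDualFrame (G p) e s)
    {V : Type*} [AddCommGroup V] [Module 𝕜 V] (l : E →ₗ[𝕜] V) (x : E) :
    ∑ i, G p (s i) x • l (e i) = l x := by
  conv_rhs => rw [← hs.sum_left x]
  simp

end IsDualFrame

/-- The Ricci part of the curvature tensor, determined by a bilinear form `P` and the metric. -/
def ricciPart (b P : E → E → 𝕜) (u v w z : E) : 𝕜 :=
  P v w * b u z - P u w * b v z + b v w * P u z - b u w * P v z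

theorem weyl_eq (u v w z : E) : weyl G p u v w z =
    G p (curvature G p u v w) z - ricciPart (fun u v => G p u v) (normRicci G p) u v w z := rfl

namespace IsDualFrame

theorem card_eq (e : Module.Basis κ 𝕜 E) : (Fintype.card κ : 𝕜) = Module.finrank 𝕜 E := by
  rw [Module.finrank_eq_card_basis e]

theorem contraction_ricciPart (hb : IsScalarProduct (G p)) (hs : IsDualFrame (G p) e s)
    (P : E →ₗ[𝕜] E →ₗ[𝕜] 𝕜) (v w : E) :
    ∑ i, ricciPart (fun u v => G p u v) (fun u v => P u v) (e i) v w (s i) =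
      (Module.finrank 𝕜 E - 2) * P v w + (∑ i, P (e i) (s i)) * G p v w := by
  have h1 := hs.sum_self
  have h2 := hs.contraction_right (P.flip w) v
  have h3 := hs.contraction_left hb (P v) w
  rw [card_eq e] at h1
  simp only [LinearMap.flip_apply, smul_eq_mul] at h2 h3
  simp only [ricciPart, Finset.sum_add_distrib, Finset.sum_sub_distrib, ← Finset.mul_sum]
  simp_rw [hb.symm (e _) (s _), hb.symm v (s _), hb.symm (e _) w, mul_comm (P (e _) w)]
  rw [h1, h2, h3]
  ring

/-- Uniqueness of the Ricci decomposition: `T` drops out of the trace, so `Ric = (n - 2) P + (tr P)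
G` and `Scal = 2 (n - 1) tr P`, which can be solved for `P`. This identifies `h` without computing
Ricci traces, both for isometries and for the umbilic hypersurface. -/
theorem normRicci_eq (hn : 3 ≤ Module.finrank 𝕜 E) (hb : IsScalarProduct (G p))
    (hs : IsDualFrame (G p) e s) (P : E →ₗ[𝕜] E →ₗ[𝕜] 𝕜) {T : E → E → E → E → 𝕜}
    (hR : ∀ u v w z, G p (curvature G p u v w) z =
      T u v w z + ricciPart (fun u v => G p u v) (fun u v => P u v) u v w z)
    (hT : ∀ v w, ∑ i, T (e i) v w (s i) = 0) (v w : E) : normRicci G p v w = P v w := by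
  have hric : ∀ v w, ricci G p v w =
      (Module.finrank 𝕜 E - 2) * P v w + (∑ i, P (e i) (s i)) * G p v w := by
    intro v w
    rw [hs.ricci_eq, ← hs.contraction_ricciPart hb]
    simp_rw [hb.symm (s _), hR]
    rw [Finset.sum_add_distrib, hT, zero_add]
  have h1 := hs.sum_self
  rw [card_eq e] at h1
  have hscal : scal G p = 2 * (Module.finrank 𝕜 E - 1) * ∑ i, P (e i) (s i) := by
    rw [hs.scal_eq hb]
    simp_rw [hric, Finset.sum_add_distrib, ← Finset.mul_sum, hb.symm (e _), h1]
    ring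
  -- With `n = m + 3`, the denominators `n - 2`, `n - 1`, `n` become `m + 1`, `m + 2`, `m + 3`,
  -- visibly nonzero in characteristic zero.
  obtain ⟨m, hm⟩ := Nat.exists_eq_add_of_le hn
  rw [normRicci, hric, hscal, hm]
  have h0 : (m : 𝕜) + 1 ≠ 0 := by exact_mod_cast Nat.succ_ne_zero m
  have h2 : (m : 𝕜) + 2 ≠ 0 := by exact_mod_cast Nat.succ_ne_zero (m + 1)
  have h3 : (m : 𝕜) + 3 ≠ 0 := by exact_mod_cast Nat.succ_ne_zero (m + 2)
  push_cast
  rw [show (3 : 𝕜) + m = m + 3 by ring, show (m : 𝕜) + 3 - 1 = m + 2 by ring,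
    show (m : 𝕜) + 3 - 2 = m + 1 by ring]
  field_simp
  ring

theorem ricci_eq_normRicci (hn : 3 ≤ Module.finrank 𝕜 E) (hb : IsScalarProduct (G p))
    (hs : IsDualFrame (G p) e s) (v w : E) : ricci G p v w =
      (Module.finrank 𝕜 E - 2) * normRicci G p v w
        + (∑ i, normRicci G p (e i) (s i)) * G p v w := by
  have h1 := hs.sum_self
  rw [card_eq e] at h1
  simp_rw [normRicci, Finset.sum_add_distrib, ← Finset.sum_div, Finset.sum_sub_distrib,
    ← Finset.mul_sum, hb.symm (e _), h1, ← hs.scal_eq hb]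
  obtain ⟨m, hm⟩ := Nat.exists_eq_add_of_le hn
  rw [hm]
  have h0 : (m : 𝕜) + 1 ≠ 0 := by exact_mod_cast Nat.succ_ne_zero m
  have h2 : (m : 𝕜) + 2 ≠ 0 := by exact_mod_cast Nat.succ_ne_zero (m + 1)
  have h3 : (m : 𝕜) + 3 ≠ 0 := by exact_mod_cast Nat.succ_ne_zero (m + 2)
  push_cast
  rw [show (3 : 𝕜) + m = m + 3 by ring, show (m : 𝕜) + 3 - 1 = m + 2 by ring,
    show (m : 𝕜) + 3 - 2 = m + 1 by ring]
  field_simp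
  ring

/-- The Weyl tensor is trace-free. -/
theorem contraction_weyl (hn : 3 ≤ Module.finrank 𝕜 E) (hb : IsScalarProduct (G p))
    (hs : IsDualFrame (G p) e s) (v w : E) : ∑ i, weyl G p (e i) v w (s i) = 0 := by
  let P : E →ₗ[𝕜] E →ₗ[𝕜] 𝕜 := (normRicciL G p).toLinearMap₁₂
  have h := hs.contraction_ricciPart hb P v w
  simp_rw [weyl_eq, Finset.sum_sub_distrib, hb.symm _ (s _), ← hs.ricci_eq]
  rw [hs.ricci_eq_normRicci hn hb, sub_eq_zero]
  exact h.symm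

end IsDualFrame

namespace IsCoordMetric

variable {Ω : Set E}

/-- Pair symmetry exchanges `v` and `w` at the price of exchanging the two contracted slots, which
`contraction_symm` undoes. -/
theorem ricci_symm (hG : IsCoordMetric G Ω) (hp : p ∈ Ω) (v w : E) :
    ricci G p v w = ricci G p w v := by
  have hb := hG.scalar p hp
  have hs := hb.isDualFrame_dualFrame (Module.finBasis 𝕜 E)
  let B : E →ₗ[𝕜] E →ₗ[𝕜] 𝕜 := LinearMap.mk₂ 𝕜 (fun x y => G p x (curvature G p y v w))
    (fun x y z => by simp) (fun a x y => by simp)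
    (fun x y z => by simp [← curvatureL_apply]) (fun a x y => by simp [← curvatureL_apply])
  have h := hs.contraction_symm hb B
  rw [hs.ricci_eq, hs.ricci_eq]
  refine h.trans (Finset.sum_congr rfl fun i _ => ?_)
  simp only [B, LinearMap.mk₂_apply]
  rw [hb.symm, hG.curvature_pair_symm hp, curvature_antisymm, hb.symm, map_neg,
    hb.symm, ← hG.curvature_skew hp, hb.symm]

theorem normRicci_symm (hG : IsCoordMetric G Ω) (hp : p ∈ Ω) (v w : E) :
    normRicci G p v w = normRicci G p w v := by
  rw [normRicci, normRicci, hG.ricci_symm hp, (hG.scalar p hp).symm]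

theorem contDiffOn_normRicciL (hG : IsCoordMetric G Ω) : ContDiffOn 𝕜 ∞ (normRicciL G) Ω := by
  have hS := hG.contDiffOn_sharp
  have hR := hG.contDiffOn_curvatureL
  have hg := hG.smooth
  have hric : ∀ v w, ContDiffOn 𝕜 ∞ (fun p => ricci G p v w) Ω := by
    intro v w
    simp only [ricci_apply, ← curvatureL_apply]
    have : ∀ i, ContDiffOn 𝕜 ∞ (fun p => LinearMap.toContinuousLinearMap
        ((Module.finBasis 𝕜 E).coord i)
        (curvatureL G p (Module.finBasis 𝕜 E i) v w)) Ω := fun i => by fun_prop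
    exact ContDiffOn.sum fun i _ => this i
  have hscal : ContDiffOn 𝕜 ∞ (scal G) Ω := by
    have : ∀ i j, ContDiffOn 𝕜 ∞ (fun p => LinearMap.toContinuousLinearMap
        ((Module.finBasis 𝕜 E).coord j)
        (curvatureL G p (Module.finBasis 𝕜 E j) (Module.finBasis 𝕜 E i)
          (dualFrame (G p) (Module.finBasis 𝕜 E) i))) Ω := fun i j => by
      unfold dualFrame
      fun_prop
    -- On `Ω` the scalar curvature is a double sum over a fixed basis and its metric dual; the
    -- latter varies smoothly because `sharp` does.
    refine (ContDiffOn.sum (s := Finset.univ) fun i _ =>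
      ContDiffOn.sum (s := Finset.univ) fun j _ => this i j).congr fun p hp => ?_
    rw [((hG.scalar p hp).isDualFrame_dualFrame (Module.finBasis 𝕜 E)).scal_eq (hG.scalar p hp)]
    simp only [ricci_apply, curvatureL_apply]
    rfl
  refine contDiffOn_clm_apply.2 fun u => contDiffOn_clm_apply.2 fun v => ?_
  have := hric u v
  simp only [normRicciL_apply, normRicci, div_eq_mul_inv]
  fun_prop

theorem differentiableAt_normRicciL (hG : IsCoordMetric G Ω) (hp : p ∈ Ω) :
    DifferentiableAt 𝕜 (normRicciL G) p :=
  (hG.contDiffOn_normRicciL.contDiffAt (hG.isOpen.mem_nhds hp)).differentiableAt (by simp)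

theorem weyl_skew (hG : IsCoordMetric G Ω) (hp : p ∈ Ω) (u v w z : E) :
    weyl G p u v w z = - weyl G p u v z w := by
  have hb := hG.scalar p hp
  rw [weyl, weyl, hG.curvature_skew hp]
  ring

theorem weyl_pair_symm (hG : IsCoordMetric G Ω) (hp : p ∈ Ω) (u v w z : E) :
    weyl G p u v w z = weyl G p w z u v := by
  have hb := hG.scalar p hp
  rw [weyl, weyl, hG.curvature_pair_symm hp, hb.symm v w, hb.symm u w, hb.symm u z, hb.symm v z,
    hG.normRicci_symm hp v w, hG.normRicci_symm hp u w, hG.normRicci_symm hp u z,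
    hG.normRicci_symm hp v z]
  ring

end IsCoordMetric

theorem weyl_antisymm (u v w z : E) : weyl G p u v w z = - weyl G p v u w z := by
  rw [weyl, weyl, curvature_antisymm]
  simp
  ring

end Contractions

end Metrics

/-! ### Covariant differentiation along a map, and the Gauss-Codazzi equations. -/

section Maps

variable {𝕜 : Type*} [RCLike 𝕜]
variable {E : Type*} [NormedAddCommGroup E] [NormedSpace 𝕜 E]
variable {F : Type*} [NormedAddCommGroup F] [NormedSpace 𝕜 F]

/-- The covariant derivative along `f` of a field `V` of vectors along `f`. -/
def covAlong (G : E → E →L[𝕜] E →L[𝕜] 𝕜) (f V : F → E) (q x : F) : E :=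
  fderiv 𝕜 V q x + christoffel G (f q) (fderiv 𝕜 f q x) (V q)

section Rules

variable {G : E → E →L[𝕜] E →L[𝕜] 𝕜} {f V W : F → E} {a : F → 𝕜} {q : F}

theorem covAlong_congr (h : V =ᶠ[nhds q] W) (x : F) : covAlong G f V q x = covAlong G f W q x := by
  rw [covAlong, covAlong, h.fderiv_eq, h.eq_of_nhds]

theorem covAlong_add (hV : DifferentiableAt 𝕜 V q) (hW : DifferentiableAt 𝕜 W q) (x : F) :
    covAlong G f (fun q => V q + W q) q x = covAlong G f V q x + covAlong G f W q x := by
  simp only [covAlong, fderiv_fun_add hV hW, map_add, add_apply]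
  abel

theorem covAlong_smul (ha : DifferentiableAt 𝕜 a q) (hV : DifferentiableAt 𝕜 V q) (x : F) :
    covAlong G f (fun q => a q • V q) q x =
      fderiv 𝕜 a q x • V q + a q • covAlong G f V q x := by
  simp only [covAlong, fderiv_fun_smul ha hV, map_smul, add_apply]
  simp only [smul_add, FunLike.coe_smul, Pi.smul_apply, ContinuousLinearMap.smulRight_apply]
  abel

end Rules

theorem _root_.ContDiffOn.differentiableAt_of_isOpen {f : F → E} {Ω : Set F} (hf : ContDiffOn 𝕜 ∞ f Ω)
    (hΩ : IsOpen Ω) {q : F} (hq : q ∈ Ω) : DifferentiableAt 𝕜 f q :=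
  (hf.contDiffAt (hΩ.mem_nhds hq)).differentiableAt (by simp)

theorem _root_.ContDiffOn.fderiv_fderiv_symm {f : F → E} {Ω : Set F} (hf : ContDiffOn 𝕜 ∞ f Ω)
    (hΩ : IsOpen Ω) {q : F} (hq : q ∈ Ω) (x y : F) :
    fderiv 𝕜 (fderiv 𝕜 f) q x y = fderiv 𝕜 (fderiv 𝕜 f) q y x :=
  ((hf.contDiffAt (hΩ.mem_nhds hq)).isSymmSndFDerivAt
    (by rw [minSmoothness_of_isRCLikeNormedField]; exact WithTop.coe_le_coe.2 le_top)).eq x y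

variable [FiniteDimensional 𝕜 E]

/-- A smooth map from an open subset of a vector space to a metric. -/
structure IsSmoothInto (G : E → E →L[𝕜] E →L[𝕜] 𝕜) (Ω : Set E) (f : F → E) (Ω' : Set F) :
    Prop where
  metric : IsCoordMetric G Ω
  isOpen : IsOpen Ω'
  mapsTo : Set.MapsTo f Ω' Ω
  smooth : ContDiffOn 𝕜 ∞ f Ω'

namespace IsSmoothInto

variable {G : E → E →L[𝕜] E →L[𝕜] 𝕜} {Ω : Set E} {f V W : F → E} {Ω' : Set F} {q : F}

theorem contDiffOn_fderiv (hf : IsSmoothInto G Ω f Ω') : ContDiffOn 𝕜 ∞ (fderiv 𝕜 f) Ω' :=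
  hf.smooth.fderiv_of_isOpen hf.isOpen (by simp)

theorem differentiableAt (hf : IsSmoothInto G Ω f Ω') (hq : q ∈ Ω') : DifferentiableAt 𝕜 f q :=
  hf.smooth.differentiableAt_of_isOpen hf.isOpen hq

theorem differentiableAt_fderiv (hf : IsSmoothInto G Ω f Ω') (hq : q ∈ Ω') :
    DifferentiableAt 𝕜 (fderiv 𝕜 f) q :=
  hf.contDiffOn_fderiv.differentiableAt_of_isOpen hf.isOpen hq

/-- The Levi-Civita connection along a map is metric. -/
theorem fderiv_metric (hf : IsSmoothInto G Ω f Ω') (hq : q ∈ Ω') (hV : DifferentiableAt 𝕜 V q)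
    (hW : DifferentiableAt 𝕜 W q) (x : F) :
    fderiv 𝕜 (fun q => G (f q) (V q) (W q)) q x =
      G (f q) (covAlong G f V q x) (W q) + G (f q) (V q) (covAlong G f W q x) := by
  have hG := hf.metric.differentiableAt (hf.mapsTo hq)
  rw [fderiv_clm_apply₂ (B := fun q => G (f q)) (hG.comp q (hf.differentiableAt hq)) hV hW,
    fderiv_fun_comp q hG (hf.differentiableAt hq)]
  simp only [ContinuousLinearMap.comp_apply, hf.metric.fderiv_eq (hf.mapsTo hq), covAlong, map_add,
    add_apply]
  abel

theorem contDiffOn_covAlong (hf : IsSmoothInto G Ω f Ω') (hV : ContDiffOn 𝕜 ∞ V Ω') (x : F) :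
    ContDiffOn 𝕜 ∞ (fun q => covAlong G f V q x) Ω' := by
  have h1 := hf.contDiffOn_fderiv
  have h2 : ContDiffOn 𝕜 ∞ (fderiv 𝕜 V) Ω' := hV.fderiv_of_isOpen hf.isOpen (by simp)
  have h3 : ContDiffOn 𝕜 ∞ (fun q => christoffel G (f q)) Ω' :=
    hf.metric.contDiffOn_christoffel.comp hf.smooth hf.mapsTo
  unfold covAlong
  fun_prop

/-- The curvature of the Levi-Civita connection along a map. -/
theorem covAlong_covAlong (hf : IsSmoothInto G Ω f Ω') (hq : q ∈ Ω') (hV : ContDiffOn 𝕜 ∞ V Ω')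
    (x y : F) :
    covAlong G f (fun q => covAlong G f V q y) q x - covAlong G f (fun q => covAlong G f V q x) q y =
      curvature G (f q) (fderiv 𝕜 f q x) (fderiv 𝕜 f q y) (V q) := by
  have hV1 : DifferentiableAt 𝕜 V q := hV.differentiableAt_of_isOpen hf.isOpen hq
  have hV2 : DifferentiableAt 𝕜 (fderiv 𝕜 V) q :=
    ContDiffOn.differentiableAt_of_isOpen (hV.fderiv_of_isOpen hf.isOpen (by simp)) hf.isOpen hq
  have hc := hf.metric.differentiableAt_christoffel (hf.mapsTo hq)
  have hf1 := hf.differentiableAt hq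
  have hf2 := hf.differentiableAt_fderiv hq
  -- Under antisymmetrization in `x`, `y` the second derivatives of `V` and `f` cancel by symmetry
  -- and the two mixed terms cancel each other; the derivative and the square of the Christoffel
  -- symbols remain.
  have key : ∀ x y, covAlong G f (fun q => covAlong G f V q y) q x =
      fderiv 𝕜 (fderiv 𝕜 V) q x y
      + fderiv 𝕜 (christoffel G) (f q) (fderiv 𝕜 f q x) (fderiv 𝕜 f q y) (V q)
      + christoffel G (f q) (fderiv 𝕜 (fderiv 𝕜 f) q x y) (V q)
      + christoffel G (f q) (fderiv 𝕜 f q y) (fderiv 𝕜 V q x)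
      + christoffel G (f q) (fderiv 𝕜 f q x) (fderiv 𝕜 V q y)
      + christoffel G (f q) (fderiv 𝕜 f q x) (christoffel G (f q) (fderiv 𝕜 f q y) (V q)) := by
    intro x y
    have hcf : DifferentiableAt 𝕜 (fun q => christoffel G (f q)) q := hc.comp q hf1
    have hfy : DifferentiableAt 𝕜 (fun q => fderiv 𝕜 f q y) q := by fun_prop
    conv_lhs => rw [covAlong]
    simp only [covAlong]
    rw [fderiv_fun_add (by fun_prop) (by fun_prop), add_apply,
      fderiv_clm_apply₁ hV2 (differentiableAt_const y),
      fderiv_clm_apply₂ hcf hfy hV1, fderiv_clm_apply₁ hf2 (differentiableAt_const y),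
      fderiv_fun_comp q hc hf1]
    simp
    abel
  rw [key, key, hV.fderiv_fderiv_symm hf.isOpen hq x y,
    hf.smooth.fderiv_fderiv_symm hf.isOpen hq x y, curvature]
  abel

theorem covAlong_fderiv (hf : IsSmoothInto G Ω f Ω') (hq : q ∈ Ω') (x y : F) :
    covAlong G f (fun q => fderiv 𝕜 f q y) q x = fderiv 𝕜 (fderiv 𝕜 f) q x y
      + christoffel G (f q) (fderiv 𝕜 f q x) (fderiv 𝕜 f q y) := by
  rw [covAlong, fderiv_clm_apply₁ (hf.differentiableAt_fderiv hq) (differentiableAt_const y)]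
  simp

/-- Torsion-freeness, for the coordinate fields of the source. -/
theorem covAlong_fderiv_symm (hf : IsSmoothInto G Ω f Ω') (hq : q ∈ Ω') (x y : F) :
    covAlong G f (fun q => fderiv 𝕜 f q y) q x = covAlong G f (fun q => fderiv 𝕜 f q x) q y := by
  rw [hf.covAlong_fderiv hq, hf.covAlong_fderiv hq, hf.smooth.fderiv_fderiv_symm hf.isOpen hq,
    hf.metric.christoffel_symm (hf.mapsTo hq)]

theorem covAlong_fderiv_apply (hf : IsSmoothInto G Ω f Ω') (hq : q ∈ Ω') {Y : F → F}
    (hY : DifferentiableAt 𝕜 Y q) (x : F) :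
    covAlong G f (fun q => fderiv 𝕜 f q (Y q)) q x =
      covAlong G f (fun q' => fderiv 𝕜 f q' (Y q)) q x + fderiv 𝕜 f q (fderiv 𝕜 Y q x) := by
  rw [hf.covAlong_fderiv hq, covAlong, fderiv_clm_apply₁ (hf.differentiableAt_fderiv hq) hY]
  abel

end IsSmoothInto

variable [FiniteDimensional 𝕜 F]

/-- A smooth map `f` that is conformal and umbilic: the second fundamental form is
`α (x) df (y) + α (y) df (x) + K (x, y) N`, where `K` is the metric of the source. -/
structure IsUmbilicMap (G : E → E →L[𝕜] E →L[𝕜] 𝕜) (Ω : Set E) (K : F → F →L[𝕜] F →L[𝕜] 𝕜)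
    (Ω' : Set F) (f : F → E) (α : F → F →L[𝕜] 𝕜) (N : F → E) : Prop
    extends IsSmoothInto G Ω f Ω' where
  source : IsCoordMetric K Ω'
  smooth_form : ContDiffOn 𝕜 ∞ α Ω'
  smooth_normal : ContDiffOn 𝕜 ∞ N Ω'
  covAlong_eq : ∀ q ∈ Ω', ∀ x y, covAlong G f (fun q => fderiv 𝕜 f q y) q x =
    fderiv 𝕜 f q (christoffel K q x y) + α q x • fderiv 𝕜 f q y + α q y • fderiv 𝕜 f q x
      + K q x y • N q

/-- The Schouten-type tensor `(∇_x α) (y) - α (x) α (y)` of a `1`-form `α`. -/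
def formHessian (K : F → F →L[𝕜] F →L[𝕜] 𝕜) (α : F → F →L[𝕜] 𝕜) (q x y : F) : 𝕜 :=
  fderiv 𝕜 α q x y - α q (christoffel K q x y) - α q x * α q y

/-- The Gauss and Codazzi equations of a conformal umbilic map. -/
theorem IsUmbilicMap.gauss {G : E → E →L[𝕜] E →L[𝕜] 𝕜} {Ω : Set E}
    {K : F → F →L[𝕜] F →L[𝕜] 𝕜} {Ω' : Set F} {f : F → E} {α : F → F →L[𝕜] 𝕜} {N : F → E}
    (h : IsUmbilicMap G Ω K Ω' f α N) {q : F} (hq : q ∈ Ω') (x y z : F) :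
    curvature G (f q) (fderiv 𝕜 f q x) (fderiv 𝕜 f q y) (fderiv 𝕜 f q z) =
      fderiv 𝕜 f q (curvature K q x y z)
      + (fderiv 𝕜 α q x y - fderiv 𝕜 α q y x) • fderiv 𝕜 f q z
      - formHessian K α q y z • fderiv 𝕜 f q x + formHessian K α q x z • fderiv 𝕜 f q y
      + K q y z • (covAlong G f N q x - α q x • N q)
      - K q x z • (covAlong G f N q y - α q y • N q) := by
  have hfd := h.differentiableAt_fderiv hq
  have hα : DifferentiableAt 𝕜 α q := h.smooth_form.differentiableAt_of_isOpen h.isOpen hq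
  have hN : DifferentiableAt 𝕜 N q := h.smooth_normal.differentiableAt_of_isOpen h.isOpen hq
  have hK := h.source.differentiableAt hq
  have hc := h.source.differentiableAt_christoffel hq
  -- The umbilicity relation `covAlong_eq` holds on an open set and is differentiated once more. Its
  -- antisymmetric part in `x`, `y` is the curvature, by `covAlong_covAlong`.
  have key : ∀ x y, covAlong G f (fun q => covAlong G f (fun q => fderiv 𝕜 f q z) q y) q x =
      covAlong G f (fun q' => fderiv 𝕜 f q' (christoffel K q y z)) q x
      + fderiv 𝕜 f q (fderiv 𝕜 (christoffel K) q x y z)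
      + (fderiv 𝕜 α q x y • fderiv 𝕜 f q z + α q y • covAlong G f (fun q => fderiv 𝕜 f q z) q x)
      + (fderiv 𝕜 α q x z • fderiv 𝕜 f q y + α q z • covAlong G f (fun q => fderiv 𝕜 f q y) q x)
      + (fderiv 𝕜 K q x y z • N q + K q y z • covAlong G f N q x) := by
    intro x y
    have e1 : (fun q => covAlong G f (fun q => fderiv 𝕜 f q z) q y) =ᶠ[nhds q]
        fun q => fderiv 𝕜 f q (christoffel K q y z) + α q y • fderiv 𝕜 f q z
          + α q z • fderiv 𝕜 f q y + K q y z • N q :=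
      (h.source.eventually_mem hq).mono fun q' hq' => h.covAlong_eq q' hq' y z
    have hcyz : DifferentiableAt 𝕜 (fun q => christoffel K q y z) q := by fun_prop
    rw [covAlong_congr e1, covAlong_add (by fun_prop) (by fun_prop),
      covAlong_add (by fun_prop) (by fun_prop), covAlong_add (by fun_prop) (by fun_prop),
      covAlong_smul (by fun_prop) (by fun_prop), covAlong_smul (by fun_prop) (by fun_prop),
      covAlong_smul (by fun_prop) (by fun_prop), h.covAlong_fderiv_apply hq hcyz,
      fderiv_clm_apply₂ hc (differentiableAt_const y) (differentiableAt_const z),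
      fderiv_clm_apply₂ hK (differentiableAt_const y) (differentiableAt_const z),
      fderiv_clm_apply₁ hα (differentiableAt_const y),
      fderiv_clm_apply₁ hα (differentiableAt_const z)]
    simp
  have hV : ContDiffOn 𝕜 ∞ (fun q => fderiv 𝕜 f q z) Ω' := by
    have := h.contDiffOn_fderiv
    fun_prop
  rw [← h.covAlong_covAlong hq hV, key, key]
  simp only [h.covAlong_eq q hq, curvature, formHessian, h.source.fderiv_eq hq, map_add, map_sub]
  rw [h.source.christoffel_symm hq y x, (h.source.scalar q hq).symm y x,
    (h.source.scalar q hq).symm y (christoffel K q x z)]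
  have e2 := (h.source.scalar q hq).symm x (christoffel K q y z)
  rw [e2]
  module

end Maps

/-! ### Koszul formula and invariance of curvature under isometries. -/

section Naturality

variable {𝕜 : Type*} [RCLike 𝕜]
variable {E : Type*} [NormedAddCommGroup E] [NormedSpace 𝕜 E] [FiniteDimensional 𝕜 E]
variable {F : Type*} [NormedAddCommGroup F] [NormedSpace 𝕜 F] [FiniteDimensional 𝕜 F]
variable {G : E → E →L[𝕜] E →L[𝕜] 𝕜} {Ω : Set E} {K : F → F →L[𝕜] F →L[𝕜] 𝕜} {Ω' : Set F}
  {f : F → E} {q : F}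

/-- The Koszul formula for the second fundamental form of a conformal map. -/
theorem IsSmoothInto.koszul (hf : IsSmoothInto G Ω f Ω') (hK : IsCoordMetric K Ω') {φ : F → 𝕜}
    (hφ : ContDiffOn 𝕜 ∞ φ Ω')
    (hconf : ∀ q ∈ Ω', ∀ x y, G (f q) (fderiv 𝕜 f q x) (fderiv 𝕜 f q y) = φ q * K q x y)
    (hq : q ∈ Ω') (x y z : F) :
    2 * G (f q) (covAlong G f (fun q => fderiv 𝕜 f q y) q x - fderiv 𝕜 f q (christoffel K q x y))
        (fderiv 𝕜 f q z) =
      fderiv 𝕜 φ q x * K q y z + fderiv 𝕜 φ q y * K q x z - fderiv 𝕜 φ q z * K q x y := by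
  have hfd := hf.differentiableAt_fderiv hq
  have hφd : DifferentiableAt 𝕜 φ q := hφ.differentiableAt_of_isOpen hf.isOpen hq
  have hKd := hK.differentiableAt hq
  -- The derivative of the conformality relation; the alternating sum over permutations of `x`, `y`,
  -- `z` isolates the second fundamental form, since it is symmetric.
  have key : ∀ x y z, G (f q) (covAlong G f (fun q => fderiv 𝕜 f q y) q x) (fderiv 𝕜 f q z)
      + G (f q) (fderiv 𝕜 f q y) (covAlong G f (fun q => fderiv 𝕜 f q z) q x)
      = fderiv 𝕜 φ q x * K q y z
        + G (f q) (fderiv 𝕜 f q (christoffel K q x y)) (fderiv 𝕜 f q z)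
        + G (f q) (fderiv 𝕜 f q y) (fderiv 𝕜 f q (christoffel K q x z)) := by
    intro x y z
    have hKyz : DifferentiableAt 𝕜 (fun q => K q y z) q := by fun_prop
    have e1 : (fun q => G (f q) (fderiv 𝕜 f q y) (fderiv 𝕜 f q z)) =ᶠ[nhds q]
        fun q => φ q * K q y z :=
      (hK.eventually_mem hq).mono fun q' hq' => hconf q' hq' y z
    rw [← hf.fderiv_metric hq (V := fun q => fderiv 𝕜 f q y) (W := fun q => fderiv 𝕜 f q z)
      (by fun_prop) (by fun_prop), e1.fderiv_eq,
      fderiv_fun_mul hφd hKyz, hconf q hq, hconf q hq]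
    simp only [add_apply, FunLike.coe_smul, Pi.smul_apply, smul_eq_mul]
    rw [fderiv_clm_apply₂ hKd (differentiableAt_const y) (differentiableAt_const z),
      hK.fderiv_eq hq]
    simp
    ring
  have h1 := key x y z
  have h2 := key y x z
  have h3 := key z x y
  have s := (hf.metric.scalar _ (hf.mapsTo hq)).symm
  rw [hf.covAlong_fderiv_symm hq y x, hK.christoffel_symm hq y x] at h2
  rw [hf.covAlong_fderiv_symm hq z x, hf.covAlong_fderiv_symm hq z y,
    hK.christoffel_symm hq z x, hK.christoffel_symm hq z y] at h3
  rw [s (fderiv 𝕜 f q x)] at h2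
  rw [s (fderiv 𝕜 f q x), s (fderiv 𝕜 f q x) (fderiv 𝕜 f q (christoffel K q y z))] at h3
  rw [s (fderiv 𝕜 f q y), s (fderiv 𝕜 f q y) (fderiv 𝕜 f q (christoffel K q x z))] at h1
  rw [s (fderiv 𝕜 f q x) (fderiv 𝕜 f q (christoffel K q y z))] at h2
  simp only [map_sub, sub_apply]
  linear_combination h1 + h2 - h3

/-- A local isometry between open subsets of vector spaces. -/
structure IsIsometric (G : E → E →L[𝕜] E →L[𝕜] 𝕜) (Ω : Set E) (K : F → F →L[𝕜] F →L[𝕜] 𝕜)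
    (Ω' : Set F) (f : F → E) : Prop
    extends IsSmoothInto G Ω f Ω' where
  source : IsCoordMetric K Ω'
  invertible : ∀ q ∈ Ω', (fderiv 𝕜 f q).IsInvertible
  isometric : ∀ q ∈ Ω', ∀ x y, G (f q) (fderiv 𝕜 f q x) (fderiv 𝕜 f q y) = K q x y

namespace IsIsometric

/-- For the constant factor `1` the right side of the Koszul formula vanishes, and `df` is onto, so
the difference is orthogonal to every vector. -/
theorem covAlong_eq (h : IsIsometric G Ω K Ω' f) (hq : q ∈ Ω') (x y : F) :
    covAlong G f (fun q => fderiv 𝕜 f q y) q x = fderiv 𝕜 f q (christoffel K q x y) := by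
  rw [← sub_eq_zero]
  refine (h.metric.scalar _ (h.mapsTo hq)).nondegenerate _ fun v => ?_
  obtain ⟨L, hL⟩ := h.invertible q hq
  obtain ⟨z, rfl⟩ := L.surjective v
  have hk := h.koszul (φ := fun _ => 1) h.source contDiffOn_const
    (fun q hq x y => by rw [h.isometric q hq, one_mul]) hq x y z
  rw [← hL] at hk ⊢
  simpa using hk

/-- Lets `IsUmbilicMap.gauss` serve as the proof that curvature is natural. -/
theorem isUmbilicMap (h : IsIsometric G Ω K Ω' f) : IsUmbilicMap G Ω K Ω' f 0 0 where
  toIsSmoothInto := h.toIsSmoothInto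
  source := h.source
  smooth_form := contDiffOn_const
  smooth_normal := contDiffOn_const
  covAlong_eq q hq x y := by simp [h.covAlong_eq hq]

theorem curvature_eq (h : IsIsometric G Ω K Ω' f) (hq : q ∈ Ω') (x y z : F) :
    curvature G (f q) (fderiv 𝕜 f q x) (fderiv 𝕜 f q y) (fderiv 𝕜 f q z) =
      fderiv 𝕜 f q (curvature K q x y z) := by
  rw [h.isUmbilicMap.gauss hq]
  have : ∀ x, covAlong G f 0 q x = 0 := fun x => by
    simp only [covAlong, fderiv_zero]; simp
  have h0 : fderiv 𝕜 (0 : F → F →L[𝕜] 𝕜) q = 0 := by simp only [fderiv_zero]; rfl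
  simp [formHessian, this, h0]

/-- The pulled-back Weyl tensor is trace-free and the rest of the pulled-back curvature is the Ricci
part of the pulled-back `h`; uniqueness of the decomposition concludes. -/
theorem normRicci_eq (hn : 3 ≤ Module.finrank 𝕜 F) (h : IsIsometric G Ω K Ω' f) (hq : q ∈ Ω')
    (x y : F) : normRicci G (f q) (fderiv 𝕜 f q x) (fderiv 𝕜 f q y) = normRicci K q x y := by
  obtain ⟨L, hL⟩ := h.invertible q hq
  have hb := h.source.scalar q hq
  have hs := hb.isDualFrame_dualFrame (Module.finBasis 𝕜 F)
  have hn' : 3 ≤ Module.finrank 𝕜 E := by rwa [← LinearEquiv.finrank_eq L.toLinearEquiv]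
  have hR := h.curvature_eq hq
  have hi := h.isometric q hq
  rw [← hL] at hR hi ⊢
  have hs' := hs.map L (b' := G (f q)) (fun u v => hi u v)
  refine (hs.normRicci_eq hn hb ((normRicciL G (f q)).toLinearMap₁₂.compl₁₂
    L.toLinearEquiv.toLinearMap L.toLinearEquiv.toLinearMap)
    (T := fun u v w z => weyl G (f q) (L u) (L v) (L w) (L z)) ?_ ?_ x y).symm
  · intro u v w z
    rw [weyl_eq, ← hi]
    have : ∀ u v w, curvature G (f q) (L u) (L v) (L w) = L (curvature K q u v w) := hR
    rw [this]
    simp only [ricciPart, ← hi]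
    simp [normRicciL_apply]
  · intro v w
    exact hs'.contraction_weyl hn' (h.metric.scalar _ (h.mapsTo hq)) (L v) (L w)

theorem weyl_eq (hn : 3 ≤ Module.finrank 𝕜 F) (h : IsIsometric G Ω K Ω' f) (hq : q ∈ Ω')
    (x y z w : F) : weyl G (f q) (fderiv 𝕜 f q x) (fderiv 𝕜 f q y) (fderiv 𝕜 f q z)
      (fderiv 𝕜 f q w) = weyl K q x y z w := by
  simp only [weyl, h.normRicci_eq hn hq, h.curvature_eq hq, h.isometric q hq]

/-- The covariant derivative along a map, composed with a local isometry. -/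
theorem covAlong_comp {E' : Type*} [NormedAddCommGroup E'] [NormedSpace 𝕜 E']
    (h : IsIsometric G Ω K Ω' f) {g V : E' → F} {r : E'} (hr : g r ∈ Ω')
    (hg : DifferentiableAt 𝕜 g r) (hV : DifferentiableAt 𝕜 V r) (x : E') :
    covAlong G (f ∘ g) (fun r => fderiv 𝕜 f (g r) (V r)) r x =
      fderiv 𝕜 f (g r) (covAlong K g V r x) := by
  have hf1 := h.differentiableAt hr
  have hf2 := h.differentiableAt_fderiv hr
  have hc := h.covAlong_eq hr (fderiv 𝕜 g r x) (V r)
  rw [h.covAlong_fderiv hr] at hc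
  rw [covAlong, fderiv_clm_apply₁ (B := fun r => fderiv 𝕜 f (g r)) (hf2.comp r hg) hV,
    fderiv_fun_comp r hf2 hg, fderiv_comp r hf1 hg, covAlong, map_add, ← hc]
  simp
  abel

end IsIsometric

end Naturality

/-! ### Frames that are parallel to first order at a point. -/

section Parallel

variable {𝕜 : Type*} [RCLike 𝕜]
variable {E : Type*} [NormedAddCommGroup E] [NormedSpace 𝕜 E] [FiniteDimensional 𝕜 E]
variable {G : E → E →L[𝕜] E →L[𝕜] 𝕜} {Ω : Set E} {p : E}

/-- The vector field `V` has vanishing covariant derivative at the point `p`. -/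
structure IsParallelAt (G : E → E →L[𝕜] E →L[𝕜] 𝕜) (p : E) (V : E → E) : Prop where
  differentiableAt : DifferentiableAt 𝕜 V p
  fderiv_eq : ∀ x, fderiv 𝕜 V p x = - christoffel G p x (V p)

/-- The linear maps that extend constant vectors to fields that are parallel at `p`. -/
def parallelExtension (G : E → E →L[𝕜] E →L[𝕜] 𝕜) (p q : E) : E →L[𝕜] E :=
  ContinuousLinearMap.id 𝕜 E - christoffel G p (q - p)

theorem parallelExtension_self (G : E → E →L[𝕜] E →L[𝕜] 𝕜) (p : E) :
    parallelExtension G p p = ContinuousLinearMap.id 𝕜 E := by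
  simp [parallelExtension]

theorem contDiff_parallelExtension (G : E → E →L[𝕜] E →L[𝕜] 𝕜) (p : E) :
    ContDiff 𝕜 ∞ (parallelExtension G p) := by
  unfold parallelExtension
  fun_prop

theorem fderiv_parallelExtension (G : E → E →L[𝕜] E →L[𝕜] 𝕜) (p q : E) :
    fderiv 𝕜 (parallelExtension G p) q = - christoffel G p := by
  unfold parallelExtension
  have h : DifferentiableAt 𝕜 (fun q => christoffel G p (q - p)) q := by fun_prop
  rw [fderiv_const_sub]
  congr 1
  have := (christoffel G p).hasFDerivAt.comp q ((hasFDerivAt_id q).sub_const p)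
  exact this.fderiv.trans (by ext; simp)

theorem isParallelAt_parallelExtension (G : E → E →L[𝕜] E →L[𝕜] 𝕜) (p : E) {σ : E → E}
    (hσ : DifferentiableAt 𝕜 σ p) (hσ0 : fderiv 𝕜 σ p = 0) :
    IsParallelAt G p (fun q => parallelExtension G p q (σ q)) := by
  have h := ((contDiff_parallelExtension G p).differentiable (by simp)) p
  refine ⟨h.clm_apply hσ, fun x => ?_⟩
  rw [fderiv_clm_apply₁ h hσ, hσ0, fderiv_parallelExtension, parallelExtension_self]
  simp

theorem isParallelAt_const (G : E → E →L[𝕜] E →L[𝕜] 𝕜) (p v : E) :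
    IsParallelAt G p (fun q => parallelExtension G p q v) :=
  isParallelAt_parallelExtension G p (differentiableAt_const v) (by simp)

theorem eventually_invertible_parallelExtension (G : E → E →L[𝕜] E →L[𝕜] 𝕜) (p : E) :
    ∀ᶠ q in nhds p, (parallelExtension G p q).IsInvertible := by
  have := FiniteDimensional.complete 𝕜 E
  have hc := (contDiff_parallelExtension G p).continuous.continuousAt (x := p)
  have hn := (ContinuousLinearEquiv.refl 𝕜 E).nhds
  rw [ContinuousAt, parallelExtension_self] at hc
  exact hc hn

theorem IsCoordMetric.fderiv_parallel (hG : IsCoordMetric G Ω) (hp : p ∈ Ω) {V W : E → E}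
    (hV : IsParallelAt G p V) (hW : IsParallelAt G p W) :
    fderiv 𝕜 (fun q => G q (V q) (W q)) p = 0 := by
  ext x
  rw [fderiv_clm_apply₂ (hG.differentiableAt hp) hV.differentiableAt hW.differentiableAt,
    hV.fderiv_eq, hW.fderiv_eq, hG.fderiv_eq hp]
  simp

section Frame

variable {κ : Type*} [Fintype κ] [DecidableEq κ]

/-- The components, with respect to the basis extending `e`, of the dual frame near `p`. -/
def dualComponents (G : E → E →L[𝕜] E →L[𝕜] 𝕜) (p : E) (e : Module.Basis κ 𝕜 E) (i : κ) (q : E) :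
    E :=
  dualFrame (pullbackForm (parallelExtension G p q) (G q)) e i

theorem IsCoordMetric.contDiffOn_pullback_parallelExtension (hG : IsCoordMetric G Ω) :
    ContDiffOn 𝕜 ∞ (fun q => pullbackForm (parallelExtension G p q) (G q)) Ω := by
  have h1 := hG.smooth
  have h2 := (contDiff_parallelExtension G p).contDiffOn (s := Ω)
  refine contDiffOn_clm_apply.2 fun u => contDiffOn_clm_apply.2 fun v => ?_
  exact (h1.clm_apply (h2.clm_apply contDiffOn_const)).clm_apply (h2.clm_apply contDiffOn_const)

/-- In a frame parallel at `p` the metric has constant components to first order, hence so has its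
inverse, which gives the dual frame. -/
theorem IsCoordMetric.dualComponents_spec (hG : IsCoordMetric G Ω) (hp : p ∈ Ω)
    (e : Module.Basis κ 𝕜 E) (i : κ) :
    DifferentiableAt 𝕜 (dualComponents G p e i) p ∧ fderiv 𝕜 (dualComponents G p e i) p = 0 := by
  have hP : DifferentiableAt 𝕜 (fun q => pullbackForm (parallelExtension G p q) (G q)) p :=
    hG.contDiffOn_pullback_parallelExtension.differentiableAt_of_isOpen hG.isOpen hp
  have hp0 : pullbackForm (parallelExtension G p p) (G p) = G p := by
    rw [parallelExtension_self]; ext; rfl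
  have hsp : DifferentiableAt 𝕜
      (sharp : (E →L[𝕜] E →L[𝕜] 𝕜) → (E →L[𝕜] 𝕜) →L[𝕜] E)
      (pullbackForm (parallelExtension G p p) (G p)) := by
    rw [hp0]
    exact ((hG.scalar p hp).contDiffAt_sharp (n := 1)).differentiableAt (by simp)
  have hs := hsp.comp p hP
  have hd : DifferentiableAt 𝕜 (dualComponents G p e i) p :=
    hs.clm_apply (differentiableAt_const _)
  refine ⟨hd, ?_⟩
  ext x
  refine (hG.scalar p hp).nondegenerate _ fun v => ?_
  -- The defining property of the dual frame makes this pairing locally constant. Its derivative has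
  -- two parts, and the one falling on the form vanishes.
  have hev : (fun q => pullbackForm (parallelExtension G p q) (G q) (dualComponents G p e i q) v)
      =ᶠ[nhds p] fun _ => e.coord i v := by
    filter_upwards [hG.eventually_mem hp, eventually_invertible_parallelExtension G p] with q hq hi
    obtain ⟨L, hL⟩ := hi
    have hb := (hG.scalar q hq).pullback (parallelExtension G p q) (by rw [← hL]; exact L.bijective)
    exact hb.sharp_apply _ v
  have h1 := congrArg (fun l => l x) (hev.fderiv_eq (𝕜 := 𝕜))
  rw [fderiv_clm_apply₂ hP hd (differentiableAt_const v)] at h1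
  have h2 : fderiv 𝕜 (fun q => pullbackForm (parallelExtension G p q) (G q)) p x
      (dualComponents G p e i p) v = 0 := by
    have h3 : fderiv 𝕜 (fun q => pullbackForm (parallelExtension G p q) (G q)
        (dualComponents G p e i p) v) p = 0 :=
      hG.fderiv_parallel hp (isParallelAt_const G p (dualComponents G p e i p))
        (isParallelAt_const G p v)
    have h4 := fderiv_clm_apply₂ hP (differentiableAt_const (dualComponents G p e i p))
      (differentiableAt_const v) x
    rw [h3] at h4
    simpa using h4.symm
  rw [h2, hp0] at h1
  simpa using h1

/-- The frame dual to the extension of `e` to a frame that is parallel at `p`. -/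
def parallelDual (G : E → E →L[𝕜] E →L[𝕜] 𝕜) (p : E) (e : Module.Basis κ 𝕜 E) (i : κ) (q : E) : E :=
  parallelExtension G p q (dualComponents G p e i q)

theorem IsCoordMetric.isParallelAt_parallelDual (hG : IsCoordMetric G Ω) (hp : p ∈ Ω)
    (e : Module.Basis κ 𝕜 E) (i : κ) : IsParallelAt G p (parallelDual G p e i) :=
  isParallelAt_parallelExtension G p (hG.dualComponents_spec hp e i).1
    (hG.dualComponents_spec hp e i).2

theorem parallelDual_self (e : Module.Basis κ 𝕜 E) (i : κ) :
    parallelDual G p e i p = dualFrame (G p) e i := by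
  have hp0 : pullbackForm (parallelExtension G p p) (G p) = G p := by
    rw [parallelExtension_self]; ext; rfl
  rw [parallelDual, dualComponents, hp0, parallelExtension_self]
  rfl

theorem IsCoordMetric.eventually_isDualFrame (hG : IsCoordMetric G Ω) (hp : p ∈ Ω)
    (e : Module.Basis κ 𝕜 E) : ∀ᶠ q in nhds p, ∃ e' : Module.Basis κ 𝕜 E,
      (∀ i, e' i = parallelExtension G p q (e i)) ∧
        IsDualFrame (G q) e' (fun i => parallelDual G p e i q) := by
  filter_upwards [hG.eventually_mem hp, eventually_invertible_parallelExtension G p] with q hq hi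
  obtain ⟨L, hL⟩ := hi
  have hb := (hG.scalar q hq).pullback (parallelExtension G p q) (by rw [← hL]; exact L.bijective)
  refine ⟨e.map L.toLinearEquiv, fun i => by rw [← hL]; rfl, ?_⟩
  have := (hb.isDualFrame_dualFrame e).map L (b' := G q) (fun u v => by
    simp [pullbackForm, ← hL])
  simp only [parallelDual, dualComponents, ← hL] at this ⊢
  exact this

end Frame

/-- A `4`-linear form `T` applied to vector fields. -/
theorem fderiv_clm_apply₄ {T : E → E →L[𝕜] E →L[𝕜] E →L[𝕜] E →L[𝕜] 𝕜} {A B C D : E → E}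
    (hT : DifferentiableAt 𝕜 T p) (hA : DifferentiableAt 𝕜 A p) (hB : DifferentiableAt 𝕜 B p)
    (hC : DifferentiableAt 𝕜 C p) (hD : DifferentiableAt 𝕜 D p) (x : E) :
    fderiv 𝕜 (fun q => T q (A q) (B q) (C q) (D q)) p x =
      fderiv 𝕜 T p x (A p) (B p) (C p) (D p) + T p (fderiv 𝕜 A p x) (B p) (C p) (D p)
      + T p (A p) (fderiv 𝕜 B p x) (C p) (D p) + T p (A p) (B p) (fderiv 𝕜 C p x) (D p)
      + T p (A p) (B p) (C p) (fderiv 𝕜 D p x) := by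
  rw [fderiv_clm_apply₂ (B := fun q => T q (A q) (B q)) ((hT.clm_apply hA).clm_apply hB) hC hD,
    fderiv_clm_apply₂ hT hA hB]
  simp

/-- The covariant derivative of a `4`-linear form. -/
def covDeriv₄ (G : E → E →L[𝕜] E →L[𝕜] 𝕜) (T : E → E →L[𝕜] E →L[𝕜] E →L[𝕜] E →L[𝕜] 𝕜)
    (p x a b c d : E) : 𝕜 :=
  fderiv 𝕜 T p x a b c d - T p (christoffel G p x a) b c d - T p a (christoffel G p x b) c d
    - T p a b (christoffel G p x c) d - T p a b c (christoffel G p x d)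

/-- Turns covariant derivatives into ordinary derivatives of scalar functions, so that an algebraic
identity valid near `p` (trace-freeness, self-duality) can simply be differentiated. -/
theorem fderiv_parallel₄ {T : E → E →L[𝕜] E →L[𝕜] E →L[𝕜] E →L[𝕜] 𝕜} {A B C D : E → E}
    (hT : DifferentiableAt 𝕜 T p) (hA : IsParallelAt G p A) (hB : IsParallelAt G p B)
    (hC : IsParallelAt G p C) (hD : IsParallelAt G p D) (x : E) :
    fderiv 𝕜 (fun q => T q (A q) (B q) (C q) (D q)) p x =
      covDeriv₄ G T p x (A p) (B p) (C p) (D p) := by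
  rw [fderiv_clm_apply₄ hT hA.differentiableAt hB.differentiableAt hC.differentiableAt
    hD.differentiableAt, hA.fderiv_eq, hB.fderiv_eq, hC.fderiv_eq, hD.fderiv_eq, covDeriv₄]
  simp
  ring

end Parallel

/-! ### Curvature and Weyl tensors as multilinear forms; the second Bianchi identity. -/

section Multilinear

variable {𝕜 : Type*} [RCLike 𝕜]
variable {E : Type*} [NormedAddCommGroup E] [NormedSpace 𝕜 E] [FiniteDimensional 𝕜 E]

/-- A `4`-linear form from its values. -/
def mk₄ (T : E → E → E → E → 𝕜) (h₁ : ∀ b c d, IsLinearMap 𝕜 fun a => T a b c d)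
    (h₂ : ∀ a c d, IsLinearMap 𝕜 fun b => T a b c d)
    (h₃ : ∀ a b d, IsLinearMap 𝕜 fun c => T a b c d)
    (h₄ : ∀ a b c, IsLinearMap 𝕜 fun d => T a b c d) : E →L[𝕜] E →L[𝕜] E →L[𝕜] E →L[𝕜] 𝕜 :=
  LinearMap.toContinuousLinearMap
    { toFun := fun a => LinearMap.toContinuousLinearMap
        { toFun := fun b => LinearMap.toContinuousLinearMap
            { toFun := fun c => LinearMap.toContinuousLinearMap ((h₄ a b c).mk' _)
              map_add' := fun x y => by ext d; exact (h₃ a b d).map_add x y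
              map_smul' := fun k x => by ext d; exact (h₃ a b d).map_smul k x }
          map_add' := fun x y => by ext c d; exact (h₂ a c d).map_add x y
          map_smul' := fun k x => by ext c d; exact (h₂ a c d).map_smul k x }
      map_add' := fun x y => by ext b c d; exact (h₁ b c d).map_add x y
      map_smul' := fun k x => by ext b c d; exact (h₁ b c d).map_smul k x }

/-- The Weyl tensor as a `4`-linear form. -/
def weylL (G : E → E →L[𝕜] E →L[𝕜] 𝕜) (p : E) : E →L[𝕜] E →L[𝕜] E →L[𝕜] E →L[𝕜] 𝕜 :=
  mk₄ (weyl G p)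
    (fun b c d => ⟨fun x y => by simp [weyl, ← curvatureL_apply, ← normRicciL_apply]; ring,
      fun k x => by simp [weyl, ← curvatureL_apply, ← normRicciL_apply]; ring⟩)
    (fun b c d => ⟨fun x y => by simp [weyl, ← curvatureL_apply, ← normRicciL_apply]; ring,
      fun k x => by simp [weyl, ← curvatureL_apply, ← normRicciL_apply]; ring⟩)
    (fun b c d => ⟨fun x y => by simp [weyl, ← curvatureL_apply, ← normRicciL_apply]; ring,
      fun k x => by simp [weyl, ← curvatureL_apply, ← normRicciL_apply]; ring⟩)
    (fun b c d => ⟨fun x y => by simp [weyl, ← curvatureL_apply, ← normRicciL_apply]; ring,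
      fun k x => by simp [weyl, ← curvatureL_apply, ← normRicciL_apply]; ring⟩)

theorem weylL_apply (G : E → E →L[𝕜] E →L[𝕜] 𝕜) (p u v w z : E) :
    weylL G p u v w z = weyl G p u v w z := rfl

/-- The curvature tensor as a `4`-linear form. -/
def loweredCurvature (G : E → E →L[𝕜] E →L[𝕜] 𝕜) (p : E) :
    E →L[𝕜] E →L[𝕜] E →L[𝕜] E →L[𝕜] 𝕜 :=
  (ContinuousLinearMap.compL 𝕜 E (E →L[𝕜] E) (E →L[𝕜] E →L[𝕜] 𝕜)
    (ContinuousLinearMap.compL 𝕜 E E (E →L[𝕜] 𝕜) (G p))).comp (curvatureL G p)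

theorem loweredCurvature_apply (G : E → E →L[𝕜] E →L[𝕜] 𝕜) (p u v w z : E) :
    loweredCurvature G p u v w z = G p (curvatureL G p u v w) z := rfl

namespace IsCoordMetric

variable {G : E → E →L[𝕜] E →L[𝕜] 𝕜} {Ω : Set E} {p : E}

theorem differentiableAt_loweredCurvature (hG : IsCoordMetric G Ω) (hp : p ∈ Ω) :
    DifferentiableAt 𝕜 (loweredCurvature G) p := by
  have h1 := hG.smooth
  have h2 := hG.contDiffOn_curvatureL
  have h : ContDiffOn 𝕜 ∞ (loweredCurvature G) Ω := by
    refine contDiffOn_clm_apply.2 fun u => contDiffOn_clm_apply.2 fun v =>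
      contDiffOn_clm_apply.2 fun w => contDiffOn_clm_apply.2 fun z => ?_
    simp only [loweredCurvature_apply]
    exact (h1.clm_apply (by fun_prop)).clm_apply contDiffOn_const
  exact h.differentiableAt_of_isOpen hG.isOpen hp

theorem differentiableAt_weylL (hG : IsCoordMetric G Ω) (hp : p ∈ Ω) :
    DifferentiableAt 𝕜 (weylL G) p := by
  have h1 := hG.smooth
  have h2 := hG.contDiffOn_curvatureL
  have h3 := hG.contDiffOn_normRicciL
  have h : ContDiffOn 𝕜 ∞ (weylL G) Ω := by
    refine contDiffOn_clm_apply.2 fun u => contDiffOn_clm_apply.2 fun v =>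
      contDiffOn_clm_apply.2 fun w => contDiffOn_clm_apply.2 fun z => ?_
    have h4 : ContDiffOn 𝕜 ∞ (fun q => G q (curvatureL G q u v w) z) Ω :=
      (h1.clm_apply (by fun_prop)).clm_apply contDiffOn_const
    simp only [weylL_apply, weyl, ← curvatureL_apply, ← normRicciL_apply]
    exact h4.sub (by fun_prop)
  exact h.differentiableAt_of_isOpen hG.isOpen hp

theorem fderiv_curvatureL (hG : IsCoordMetric G Ω) (hp : p ∈ Ω) (x u v w : E) :
    fderiv 𝕜 (curvatureL G) p x u v w =
      fderiv 𝕜 (fderiv 𝕜 (christoffel G)) p x u v w - fderiv 𝕜 (fderiv 𝕜 (christoffel G)) p x v u w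
      + (fderiv 𝕜 (christoffel G) p x u (christoffel G p v w)
        + christoffel G p u (fderiv 𝕜 (christoffel G) p x v w))
      - (fderiv 𝕜 (christoffel G) p x v (christoffel G p u w)
        + christoffel G p v (fderiv 𝕜 (christoffel G) p x u w)) := by
  have hc := hG.differentiableAt_christoffel hp
  have hcd : DifferentiableAt 𝕜 (fderiv 𝕜 (christoffel G)) p :=
    hG.contDiffOn_fderiv_christoffel.differentiableAt_of_isOpen hG.isOpen hp
  have h1 : ∀ u v w, fderiv 𝕜 (fun q => fderiv 𝕜 (christoffel G) q u v w) p x =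
      fderiv 𝕜 (fderiv 𝕜 (christoffel G)) p x u v w := by
    intro u v w
    rw [fderiv_clm_apply₂ (B := fun q => fderiv 𝕜 (christoffel G) q u) (by fun_prop)
      (differentiableAt_const v) (differentiableAt_const w),
      fderiv_clm_apply₁ hcd (differentiableAt_const u)]
    simp
  have h2 : ∀ u v w, fderiv 𝕜 (fun q => christoffel G q u (christoffel G q v w)) p x =
      fderiv 𝕜 (christoffel G) p x u (christoffel G p v w)
        + christoffel G p u (fderiv 𝕜 (christoffel G) p x v w) := by
    intro u v w
    rw [fderiv_clm_apply₂ hc (differentiableAt_const u) (by fun_prop),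
      fderiv_clm_apply₂ hc (differentiableAt_const v) (differentiableAt_const w)]
    simp
  have h3 : fderiv 𝕜 (fun q => curvatureL G q u v w) p x =
      fderiv 𝕜 (curvatureL G) p x u v w := by
    have hR := hG.differentiableAt_curvatureL hp
    rw [fderiv_clm_apply₂ (B := fun q => curvatureL G q u) (by fun_prop)
      (differentiableAt_const v) (differentiableAt_const w),
      fderiv_clm_apply₁ hR (differentiableAt_const u)]
    simp
  rw [← h3]
  simp only [curvatureL_apply, curvature]
  rw [fderiv_fun_sub (by fun_prop) (by fun_prop), fderiv_fun_add (by fun_prop) (by fun_prop),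
    fderiv_fun_sub (by fun_prop) (by fun_prop)]
  simp only [sub_apply, add_apply, h1, h2]

/-- The covariant derivative of the curvature. -/
theorem covDeriv_loweredCurvature (hG : IsCoordMetric G Ω) (hp : p ∈ Ω) (x u v w z : E) :
    covDeriv₄ G (loweredCurvature G) p x u v w z =
      G p (fderiv 𝕜 (curvatureL G) p x u v w + christoffel G p x (curvature G p u v w)
        - curvature G p (christoffel G p x u) v w - curvature G p u (christoffel G p x v) w
        - curvature G p u v (christoffel G p x w)) z := by
  have hL := hG.differentiableAt_loweredCurvature hp
  have hR := hG.differentiableAt_curvatureL hp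
  have h1 : fderiv 𝕜 (loweredCurvature G) p x u v w z =
      fderiv 𝕜 (fun q => G q (curvatureL G q u v w) z) p x := by
    have : fderiv 𝕜 (fun q => G q (curvatureL G q u v w) z) p x = _ :=
      fderiv_clm_apply₄ hL (differentiableAt_const u) (differentiableAt_const v)
        (differentiableAt_const w) (differentiableAt_const z) x
    rw [this]
    simp
  have h2 : fderiv 𝕜 (fun q => curvatureL G q u v w) p x =
      fderiv 𝕜 (curvatureL G) p x u v w := by
    rw [fderiv_clm_apply₂ (B := fun q => curvatureL G q u) (by fun_prop)
      (differentiableAt_const v) (differentiableAt_const w),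
      fderiv_clm_apply₁ hR (differentiableAt_const u)]
    simp
  rw [fderiv_clm_apply₂ (hG.differentiableAt hp) (by fun_prop) (differentiableAt_const z),
    hG.fderiv_eq hp, h2] at h1
  simp only [covDeriv₄, h1, loweredCurvature_apply, curvatureL_apply, map_add, map_sub, add_apply,
    sub_apply]
  simp
  ring

/-- The second Bianchi identity. -/
theorem covDeriv_loweredCurvature_cyclic (hG : IsCoordMetric G Ω) (hp : p ∈ Ω) (u v w a b : E) :
    covDeriv₄ G (loweredCurvature G) p u v w a b + covDeriv₄ G (loweredCurvature G) p v w u a b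
      + covDeriv₄ G (loweredCurvature G) p w u v a b = 0 := by
  simp only [hG.covDeriv_loweredCurvature hp]
  rw [← add_apply, ← add_apply, ← map_add, ← map_add]
  have hs := hG.contDiffOn_christoffel.fderiv_fderiv_symm hG.isOpen hp
  have : ∀ x : E, x = 0 → G p x b = 0 := fun x hx => by simp [hx]
  apply this
  -- In the cyclic sum the second derivatives of the Christoffel symbols cancel by symmetry of
  -- second derivatives, everything else by torsion-freeness and skewness.
  simp only [hG.fderiv_curvatureL hp, curvature, map_add, map_sub]
  rw [hG.christoffel_symm hp v u, hG.christoffel_symm hp w u, hG.christoffel_symm hp w v,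
    hs v u, hs w u, hs w v]
  abel

end IsCoordMetric

end Multilinear

/-! ### Self-duality of `W` implies self-duality of `C`. -/

section SelfDual

variable {𝕜 : Type*} [RCLike 𝕜]
variable {E : Type*} [NormedAddCommGroup E] [NormedSpace 𝕜 E] [FiniteDimensional 𝕜 E]
variable {G : E → E →L[𝕜] E →L[𝕜] 𝕜} {Ω : Set E} {p : E}

/-- The Gram matrix of the dual frame is an inverse. -/
theorem IsScalarProduct.det_gram_ne_zero {b : E →L[𝕜] E →L[𝕜] 𝕜} (hb : IsScalarProduct b)
    {κ : Type*} [Fintype κ] [DecidableEq κ] (e : Module.Basis κ 𝕜 E) :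
    (Matrix.of fun i j => b (e i) (e j)).det ≠ 0 := by
  have hs := hb.isDualFrame_dualFrame e
  have h : (Matrix.of fun i j => b (e i) (e j)) *
      (Matrix.of fun i j => b (dualFrame b e i) (dualFrame b e j)) = 1 := by
    ext i k
    have h1 := congrArg (b (dualFrame b e k)) (hs.sum_right hb (e i))
    simp only [map_sum, map_smul, smul_eq_mul] at h1
    simp only [Matrix.mul_apply, Matrix.of_apply, hb.symm _ (dualFrame b e k), h1, hs k i,
      Matrix.one_apply, eq_comm]
  intro h0
  have := congrArg Matrix.det h
  rw [Matrix.det_mul, h0] at this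
  simp at this

/-- The Weyl tensor as a bilinear form in the first two arguments. -/
def weylForm (G : E → E →L[𝕜] E →L[𝕜] 𝕜) (p w z : E) : E →ₗ[𝕜] E →ₗ[𝕜] 𝕜 :=
  LinearMap.mk₂ 𝕜 (fun u v => weylL G p u v w z) (fun u u' v => by simp) (fun a u v => by simp)
    (fun u u' v => by simp) (fun a u v => by simp)

/-- The Cotton-York tensor as a trilinear map. -/
def cottonL (G : E → E →L[𝕜] E →L[𝕜] 𝕜) (p : E) : E →L[𝕜] E →L[𝕜] E →L[𝕜] 𝕜 :=
  let D : E →L[𝕜] E →L[𝕜] E →L[𝕜] 𝕜 := fderiv 𝕜 (normRicciL G) p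
  let h : E →L[𝕜] E →L[𝕜] 𝕜 := normRicciL G p
  let B₁ : E →L[𝕜] E →L[𝕜] E →L[𝕜] 𝕜 :=
    (ContinuousLinearMap.compL 𝕜 E E (E →L[𝕜] 𝕜) h).comp (christoffel G p)
  let B₂ : E →L[𝕜] E →L[𝕜] E →L[𝕜] 𝕜 :=
    (ContinuousLinearMap.compL 𝕜 E E 𝕜).bilinearComp h (christoffel G p)
  D - D.flip - (B₁ - B₁.flip) - (B₂.flip - B₂)

namespace IsCoordMetric

theorem fderiv_normRicci (hG : IsCoordMetric G Ω) (hp : p ∈ Ω) (x u v : E) :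
    fderiv 𝕜 (fun q => normRicci G q u v) p x = fderiv 𝕜 (normRicciL G) p x u v := by
  simp only [← normRicciL_apply]
  rw [fderiv_clm_apply₂ (hG.differentiableAt_normRicciL hp) (differentiableAt_const u)
    (differentiableAt_const v)]
  simp

theorem cottonL_apply (hG : IsCoordMetric G Ω) (hp : p ∈ Ω) (u v w : E) :
    cottonL G p u v w = cotton G p u v w := by
  simp only [cottonL, cotton, covDerivNormRicci, hG.fderiv_normRicci hp]
  simp [normRicciL_apply]
  ring

/-- The volume form is parallel. -/
theorem hasFDerivAt_vol_parallel (hG : IsCoordMetric G Ω) (hp : p ∈ Ω)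
    (hE : Module.finrank 𝕜 E = 4) {vol : E → E [⋀^Fin 4]→L[𝕜] 𝕜} (hvol : DifferentiableAt 𝕜 vol p)
    (hsq : ∀ q ∈ Ω, ∀ e : Fin 4 → E, vol q e ^ 2 = (Matrix.of fun i j => G q (e i) (e j)).det)
    (v : Fin 4 → E) :
    HasFDerivAt (fun q => vol q (fun i => parallelExtension G p q (v i))) (0 : E →L[𝕜] 𝕜) p := by
  let e := Module.finBasisOfFinrankEq 𝕜 E hE
  let f : E → 𝕜 := fun q => vol q (fun i => parallelExtension G p q (e i))
  have hf : DifferentiableAt 𝕜 f p :=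
    hvol.continuousAlternatingMap_apply fun i => (isParallelAt_const G p (e i)).differentiableAt
  have hM : HasFDerivAt (fun q => fun i j : Fin 4 =>
      G q (parallelExtension G p q (e i)) (parallelExtension G p q (e j)))
      (0 : E →L[𝕜] Fin 4 → Fin 4 → 𝕜) p := by
    refine hasFDerivAt_pi'.2 fun i => ?_
    rw [ContinuousLinearMap.comp_zero]
    refine hasFDerivAt_pi'.2 fun j => ?_
    rw [ContinuousLinearMap.comp_zero]
    have hi := isParallelAt_const G p (e i)
    have hj := isParallelAt_const G p (e j)
    have hd := ((hG.differentiableAt hp).clm_apply hi.differentiableAt).clm_apply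
      hj.differentiableAt
    have := hd.hasFDerivAt
    rw [hG.fderiv_parallel hp hi hj] at this
    exact this
  have hdet : Differentiable 𝕜 (fun M : Fin 4 → Fin 4 → 𝕜 => (Matrix.of M).det) := by
    simp only [Matrix.det_apply, Matrix.of_apply]
    fun_prop
  have h1 := (hdet _).hasFDerivAt.comp p hM
  -- Only the square of the volume form is prescribed. In a parallel frame it is a Gram determinant,
  -- stationary at `p`; as `f p ≠ 0`, `f` is stationary too.
  have h2 : (fun q => f q ^ 2) =ᶠ[nhds p] ((fun M : Fin 4 → Fin 4 → 𝕜 => (Matrix.of M).det) ∘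
      fun q => fun i j : Fin 4 =>
      G q (parallelExtension G p q (e i)) (parallelExtension G p q (e j))) :=
    (hG.eventually_mem hp).mono fun q hq => hsq q hq _
  have h3 : fderiv 𝕜 (fun q => f q ^ 2) p = 0 := by
    rw [h2.fderiv_eq, h1.fderiv]
    simp
  have hf0 : f p ≠ 0 := by
    intro h0
    have := hsq p hp e
    have h4 : vol p e = 0 := by
      simpa [f, parallelExtension_self] using h0
    rw [h4] at this
    exact (hG.scalar p hp).det_gram_ne_zero e (by simpa using this.symm)
  have h4 : fderiv 𝕜 f p = 0 := by
    rw [fderiv_fun_pow 2 hf] at h3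
    simpa [hf0] using h3
  -- A top-degree form is determined by its value on a basis; the factor `e.det v` does not depend
  -- on `q`.
  have h5 : (fun q => vol q (fun i => parallelExtension G p q (v i))) =
      fun q => f q * e.det v := by
    ext q
    have := congrArg (fun l => l v) (AlternatingMap.eq_smul_basis_det e
      ((vol q).toAlternatingMap.compLinearMap (parallelExtension G p q).toLinearMap))
    simpa [f] using this
  rw [h5]
  have := hf.hasFDerivAt.mul_const (e.det v)
  rw [h4, smul_zero] at this
  exact this

theorem fderiv_normRicci_parallel (hG : IsCoordMetric G Ω) (hp : p ∈ Ω) (x u v : E) :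
    fderiv 𝕜 (fun q => normRicciL G q (parallelExtension G p q u) (parallelExtension G p q v)) p x =
      covDerivNormRicci G p x u v := by
  have hu := isParallelAt_const G p u
  have hv := isParallelAt_const G p v
  have hd := hG.differentiableAt_normRicciL hp
  rw [fderiv_clm_apply₂ hd hu.differentiableAt hv.differentiableAt, hu.fderiv_eq, hv.fderiv_eq,
    covDerivNormRicci, hG.fderiv_normRicci hp]
  simp [parallelExtension_self]
  simp only [normRicciL_apply]
  ring

/-- The definition of `W` is differentiated in fields parallel at `p`: the metric factors are
stationary there, so the derivative falls on `h` alone. -/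
theorem covDeriv_weylL (hG : IsCoordMetric G Ω) (hp : p ∈ Ω) (x u v w z : E) :
    covDeriv₄ G (weylL G) p x u v w z = covDeriv₄ G (loweredCurvature G) p x u v w z
      - ricciPart (fun u v => G p u v) (covDerivNormRicci G p x) u v w z := by
  have hP := isParallelAt_const G p
  have h1 := fderiv_parallel₄ (hG.differentiableAt_weylL hp) (hP u) (hP v) (hP w) (hP z) x
  have h2 := fderiv_parallel₄ (hG.differentiableAt_loweredCurvature hp) (hP u) (hP v) (hP w)
    (hP z) x
  have hR := (((((hG.differentiableAt_loweredCurvature hp).clm_apply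
    (hP u).differentiableAt).clm_apply (hP v).differentiableAt).clm_apply
    (hP w).differentiableAt).clm_apply (hP z).differentiableAt).hasFDerivAt
  have hg : ∀ a b, HasFDerivAt
      (fun q => G q (parallelExtension G p q a) (parallelExtension G p q b)) (0 : E →L[𝕜] 𝕜) p := by
    intro a b
    have := (((hG.differentiableAt hp).clm_apply (hP a).differentiableAt).clm_apply
      (hP b).differentiableAt).hasFDerivAt
    rw [hG.fderiv_parallel hp (hP a) (hP b)] at this
    exact this
  have hh : ∀ a b, HasFDerivAt
      (fun q => normRicciL G q (parallelExtension G p q a) (parallelExtension G p q b)) _ p :=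
    fun a b => (((hG.differentiableAt_normRicciL hp).clm_apply (hP a).differentiableAt).clm_apply
      (hP b).differentiableAt).hasFDerivAt
  have h3 := hR.sub (((((hh v w).mul (hg u z)).sub ((hh u w).mul (hg v z))).add
    ((hg v w).mul (hh u z))).sub ((hg u w).mul (hh v z)))
  have h4 := congrArg (fun l => l x) h3.fderiv
  have h5 : (fun q => weylL G q (parallelExtension G p q u) (parallelExtension G p q v)
      (parallelExtension G p q w) (parallelExtension G p q z)) =
    ((fun q => loweredCurvature G q (parallelExtension G p q u) (parallelExtension G p q v)
      (parallelExtension G p q w) (parallelExtension G p q z)) - 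
      ((((fun q => normRicciL G q (parallelExtension G p q v) (parallelExtension G p q w))
        * (fun q => G q (parallelExtension G p q u) (parallelExtension G p q z))
        - (fun q => normRicciL G q (parallelExtension G p q u) (parallelExtension G p q w))
        * (fun q => G q (parallelExtension G p q v) (parallelExtension G p q z)))
        + (fun q => G q (parallelExtension G p q v) (parallelExtension G p q w))
        * (fun q => normRicciL G q (parallelExtension G p q u) (parallelExtension G p q z)))
        - (fun q => G q (parallelExtension G p q u) (parallelExtension G p q w))
        * (fun q => normRicciL G q (parallelExtension G p q v) (parallelExtension G p q z)))) := by
    ext q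
    simp [weylL_apply, weyl, loweredCurvature_apply, curvatureL_apply, normRicciL_apply]
  rw [h5, h4] at h1
  simp only [sub_apply, add_apply, FunLike.coe_smul, Pi.smul_apply, h2,
    hG.fderiv_normRicci_parallel hp, parallelExtension_self] at h1
  simp at h1
  rw [← h1, ricciPart]
  ring

/-- The second Bianchi identity in terms of the Weyl and the Cotton-York tensor. -/
theorem covDeriv_weylL_cyclic (hG : IsCoordMetric G Ω) (hp : p ∈ Ω) (u v w a b : E) :
    covDeriv₄ G (weylL G) p u v w a b + covDeriv₄ G (weylL G) p v w u a b
      + covDeriv₄ G (weylL G) p w u v a b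
      + (cotton G p u w a * G p v b - cotton G p u w b * G p v a)
      + (cotton G p v u a * G p w b - cotton G p v u b * G p w a)
      + (cotton G p w v a * G p u b - cotton G p w v b * G p u a) = 0 := by
  have h := hG.covDeriv_loweredCurvature_cyclic hp u v w a b
  simp only [hG.covDeriv_weylL hp, ricciPart, cotton]
  linear_combination h

section Contraction

variable {κ : Type*} [Fintype κ] [DecidableEq κ]

/-- The covariant derivative of the Weyl tensor is trace-free. -/
theorem contraction_covDeriv_weylL (hG : IsCoordMetric G Ω) (hn : 3 ≤ Module.finrank 𝕜 E)
    (hp : p ∈ Ω) (e : Module.Basis κ 𝕜 E) (x v w : E) :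
    ∑ i, covDeriv₄ G (weylL G) p x (e i) v w (dualFrame (G p) e i) = 0 := by
  have hP := isParallelAt_const G p
  have hS := hG.isParallelAt_parallelDual hp e
  have hW := hG.differentiableAt_weylL hp
  have h1 := fun i => fderiv_parallel₄ hW (hP (e i)) (hP v) (hP w) (hS i) x
  simp only [parallelExtension_self, parallelDual_self, ContinuousLinearMap.id_apply] at h1
  simp only [← h1]
  have hd : ∀ i, DifferentiableAt 𝕜 (fun q => weylL G q (parallelExtension G p q (e i))
      (parallelExtension G p q v) (parallelExtension G p q w) (parallelDual G p e i q)) p :=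
    fun i => (((hW.clm_apply (hP (e i)).differentiableAt).clm_apply
      (hP v).differentiableAt).clm_apply (hP w).differentiableAt).clm_apply (hS i).differentiableAt
  rw [← sum_apply, ← fderiv_fun_sum fun i _ => hd i]
  -- At each nearby point the sum is the trace of `W` in a frame and its dual, hence zero.
  have hev : (fun q => ∑ i, weylL G q (parallelExtension G p q (e i))
      (parallelExtension G p q v) (parallelExtension G p q w) (parallelDual G p e i q))
      =ᶠ[nhds p] fun _ => 0 := by
    filter_upwards [hG.eventually_mem hp, hG.eventually_isDualFrame hp e] with q hq ⟨e', he', hs⟩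
    simp only [weylL_apply, ← he']
    exact hs.contraction_weyl hn (hG.scalar q hq) _ _
  rw [hev.fderiv_eq]
  simp

/-- Self-duality of the Weyl tensor passes to its covariant derivative. -/
theorem covDeriv_weylL_selfDual (hG : IsCoordMetric G Ω)
    (hE : Module.finrank 𝕜 E = 4) (hp : p ∈ Ω) {vol : E → E [⋀^Fin 4]→L[𝕜] 𝕜}
    (hvol : DifferentiableAt 𝕜 vol p)
    (hsq : ∀ q ∈ Ω, ∀ e : Fin 4 → E, vol q e ^ 2 = (Matrix.of fun i j => G q (e i) (e j)).det)
    (hsd : ∀ q ∈ Ω, ∀ u v w z,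
      hodge (G q) (vol q) (fun u v => weyl G q u v w z) u v = weyl G q u v w z)
    (e : Module.Basis κ 𝕜 E) (x u v w z : E) :
    covDeriv₄ G (weylL G) p x u v w z = 2⁻¹ * ∑ i, ∑ j, vol p ![u, v, e i, e j] *
      covDeriv₄ G (weylL G) p x (dualFrame (G p) e i) (dualFrame (G p) e j) w z := by
  have hP := isParallelAt_const G p
  have hS := hG.isParallelAt_parallelDual hp e
  have hW := hG.differentiableAt_weylL hp
  have h1 := fderiv_parallel₄ hW (hP u) (hP v) (hP w) (hP z) x
  have h2 := fun i j => fderiv_parallel₄ hW (hS i) (hS j) (hP w) (hP z) x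
  simp only [parallelExtension_self, parallelDual_self, ContinuousLinearMap.id_apply] at h1 h2
  simp only [← h1, ← h2]
  have hd : ∀ i j, DifferentiableAt 𝕜 (fun q => weylL G q (parallelDual G p e i q)
      (parallelDual G p e j q) (parallelExtension G p q w) (parallelExtension G p q z)) p :=
    fun i j => (((hW.clm_apply (hS i).differentiableAt).clm_apply
      (hS j).differentiableAt).clm_apply (hP w).differentiableAt).clm_apply (hP z).differentiableAt
  have hv := fun i j => hG.hasFDerivAt_vol_parallel hp hE hvol hsq ![u, v, e i, e j]
  -- Near `p`, `W = *W` written in the frame parallel at `p`. By `hv` the coefficients `vol` are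
  -- stationary at `p`, so only `W` is differentiated.
  have hev : (fun q => weylL G q (parallelExtension G p q u)
      (parallelExtension G p q v) (parallelExtension G p q w) (parallelExtension G p q z))
      =ᶠ[nhds p] fun q => 2⁻¹ * ∑ i, ∑ j,
        vol q (fun k => parallelExtension G p q (![u, v, e i, e j] k)) *
          weylL G q (parallelDual G p e i q) (parallelDual G p e j q)
            (parallelExtension G p q w) (parallelExtension G p q z) := by
    filter_upwards [hG.eventually_mem hp, hG.eventually_isDualFrame hp e] with q hq ⟨e', he', hs⟩
    rw [weylL_apply, ← hsd q hq, hodge_eq (hG.scalar q hq) hs (vol q)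
      (α := fun u v => weyl G q u v (parallelExtension G p q w) (parallelExtension G p q z))
      (weylForm G q (parallelExtension G p q w) (parallelExtension G p q z)) (fun u v => rfl)]
    refine congrArg _ (Finset.sum_congr rfl fun i _ => Finset.sum_congr rfl fun j _ => ?_)
    rw [weylL_apply]
    congr 2
    ext k
    fin_cases k <;> simp [he']
  have h3 : HasFDerivAt (fun q => 2⁻¹ * ∑ i, ∑ j,
        vol q (fun k => parallelExtension G p q (![u, v, e i, e j] k)) *
          weylL G q (parallelDual G p e i q) (parallelDual G p e j q)
            (parallelExtension G p q w) (parallelExtension G p q z)) _ p :=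
    (HasFDerivAt.fun_sum fun i _ => HasFDerivAt.fun_sum fun j _ =>
      (hv i j).mul (hd i j).hasFDerivAt).const_mul (2⁻¹ : 𝕜)
  rw [hev.fderiv_eq, h3.fderiv]
  simp [parallelExtension_self]

theorem cotton_antisymm (u v w : E) : cotton G p u v w = - cotton G p v u w := by
  simp [cotton]

theorem covDeriv_weylL_antisymm (hG : IsCoordMetric G Ω) (hp : p ∈ Ω) (x u v w z : E) :
    covDeriv₄ G (weylL G) p x u v w z = - covDeriv₄ G (weylL G) p x v u w z := by
  have hW := hG.differentiableAt_weylL hp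
  have h1 := fun u v => fderiv_clm_apply₄ hW (differentiableAt_const u) (differentiableAt_const v)
    (differentiableAt_const w) (differentiableAt_const z) x
  have h2 : ∀ u v, fderiv 𝕜 (weylL G) p x u v w z = fderiv 𝕜 (fun q => weylL G q u v w z) p x :=
    fun u v => by rw [h1]; simp
  have h3 : (fun q => weylL G q u v w z) = fun q => - weylL G q v u w z := by
    ext q
    exact weyl_antisymm u v w z
  have h4 : ∀ u v w z, weylL G p u v w z = - weylL G p v u w z := weyl_antisymm
  rw [covDeriv₄, h2, h3, fderiv_fun_neg, neg_apply, ← h2, covDeriv₄]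
  rw [h4 _ v, h4 u, h4 u v, h4 u v]
  ring

theorem covDeriv_weylL_skew (hG : IsCoordMetric G Ω) (hp : p ∈ Ω) (x u v w z : E) :
    covDeriv₄ G (weylL G) p x u v w z = - covDeriv₄ G (weylL G) p x u v z w := by
  have hW := hG.differentiableAt_weylL hp
  have h2 : ∀ w z, fderiv 𝕜 (weylL G) p x u v w z = fderiv 𝕜 (fun q => weylL G q u v w z) p x := by
    intro w z
    rw [fderiv_clm_apply₄ hW (differentiableAt_const u) (differentiableAt_const v)
      (differentiableAt_const w) (differentiableAt_const z) x]
    simp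
  have h3 : (fun q => weylL G q u v w z) =ᶠ[nhds p] fun q => - weylL G q u v z w :=
    (hG.eventually_mem hp).mono fun q hq => hG.weyl_skew hq u v w z
  have h4 : ∀ u v w z, weylL G p u v w z = - weylL G p u v z w := hG.weyl_skew hp
  rw [covDeriv₄, h2, h3.fderiv_eq, fderiv_fun_neg, neg_apply, ← h2, covDeriv₄]
  rw [h4 _ _ w z, h4 _ _ w z, h4 _ _ _ z, h4 _ _ w]
  ring

/-- The divergence of the Weyl tensor, up to the trace of the Cotton-York tensor. -/
theorem divergence_weylL_aux (hG : IsCoordMetric G Ω) (hn : 3 ≤ Module.finrank 𝕜 E) (hp : p ∈ Ω)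
    (e : Module.Basis κ 𝕜 E) (u w a : E) :
    ∑ i, covDeriv₄ G (weylL G) p (e i) w u a (dualFrame (G p) e i)
      + (Module.finrank 𝕜 E - 3) * cotton G p u w a
      - (∑ i, cotton G p (e i) u (dualFrame (G p) e i)) * G p w a
      + (∑ i, cotton G p (e i) w (dualFrame (G p) e i)) * G p u a = 0 := by
  have hb := hG.scalar p hp
  have hs := hb.isDualFrame_dualFrame e
  -- Bianchi is contracted over its second and last arguments: two of the three derivatives of `W`
  -- become traces of `W` and vanish, and the third is a divergence.
  have h0 : ∑ i, (_ : 𝕜) = ∑ i : κ, 0 := Finset.sum_congr rfl fun i _ =>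
    hG.covDeriv_weylL_cyclic hp u (e i) w a (dualFrame (G p) e i)
  have t1 := hG.contraction_covDeriv_weylL hn hp e u w a
  have t2 : ∑ i, covDeriv₄ G (weylL G) p w u (e i) a (dualFrame (G p) e i) = 0 := by
    rw [← neg_eq_zero, ← Finset.sum_neg_distrib, ← hG.contraction_covDeriv_weylL hn hp e w u a]
    exact Finset.sum_congr rfl fun i _ => (hG.covDeriv_weylL_antisymm hp _ _ _ _ _).symm
  have s0 : ∑ i, G p (e i) (dualFrame (G p) e i) = Module.finrank 𝕜 E := by
    rw [← IsDualFrame.card_eq e, ← hs.sum_self]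
    exact Finset.sum_congr rfl fun i _ => hb.symm _ _
  have s1 : ∑ i, cotton G p u w (dualFrame (G p) e i) * G p (e i) a = cotton G p u w a := by
    rw [← hG.cottonL_apply hp u w a]
    refine (Finset.sum_congr rfl fun i _ => ?_).trans
      (hs.contraction_left hb (cottonL G p u w).toLinearMap a)
    rw [hb.symm (e i), mul_comm, ← hG.cottonL_apply hp]
    rfl
  have s2 : ∑ i, cotton G p (e i) u a * G p w (dualFrame (G p) e i) = cotton G p w u a := by
    rw [← hG.cottonL_apply hp w u a]
    refine (Finset.sum_congr rfl fun i _ => ?_).trans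
      (hs.contraction_right (((cottonL G p).flip u).flip a).toLinearMap w)
    rw [hb.symm w, mul_comm, ← hG.cottonL_apply hp]
    rfl
  have s3 : ∑ i, cotton G p w (e i) a * G p u (dualFrame (G p) e i) = cotton G p w u a := by
    rw [← hG.cottonL_apply hp w u a]
    refine (Finset.sum_congr rfl fun i _ => ?_).trans
      (hs.contraction_right ((cottonL G p w).flip a).toLinearMap u)
    rw [hb.symm u, mul_comm, ← hG.cottonL_apply hp]
    rfl
  have s4 : ∑ i, cotton G p w (e i) (dualFrame (G p) e i) =
      - ∑ i, cotton G p (e i) w (dualFrame (G p) e i) := by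
    rw [← Finset.sum_neg_distrib]
    exact Finset.sum_congr rfl fun i _ => cotton_antisymm _ _ _
  simp only [Finset.sum_add_distrib, Finset.sum_sub_distrib, ← Finset.mul_sum, ← Finset.sum_mul,
    Finset.sum_const_zero, t1, t2, s0, s1, s2, s3, s4] at h0
  rw [cotton_antisymm w u] at h0
  linear_combination h0

/-- The Cotton-York tensor is trace-free. -/
theorem contraction_cotton (hG : IsCoordMetric G Ω) (hn : 3 ≤ Module.finrank 𝕜 E) (hp : p ∈ Ω)
    (e : Module.Basis κ 𝕜 E) (u : E) : ∑ i, cotton G p (e i) u (dualFrame (G p) e i) = 0 := by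
  have hb := hG.scalar p hp
  have hs := hb.isDualFrame_dualFrame e
  -- A second contraction, over `w` and `a`. The divergence term vanishes as well, and `2 (n - 2)`
  -- times the trace of `C` is left.
  have h0 : ∑ j, (_ : 𝕜) = ∑ j : κ, 0 := Finset.sum_congr rfl fun j _ =>
    hG.divergence_weylL_aux hn hp e u (e j) (dualFrame (G p) e j)
  have t1 : ∑ j, ∑ i, covDeriv₄ G (weylL G) p (e i) (e j) u (dualFrame (G p) e j)
      (dualFrame (G p) e i) = 0 := by
    rw [Finset.sum_comm]
    refine Finset.sum_eq_zero fun i _ => ?_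
    rw [← neg_eq_zero, ← Finset.sum_neg_distrib,
      ← hG.contraction_covDeriv_weylL hn hp e (e i) u (dualFrame (G p) e i)]
    exact Finset.sum_congr rfl fun j _ => (hG.covDeriv_weylL_skew hp _ _ _ _ _).symm
  have s0 : ∑ i, G p (e i) (dualFrame (G p) e i) = Module.finrank 𝕜 E := by
    rw [← IsDualFrame.card_eq e, ← hs.sum_self]
    exact Finset.sum_congr rfl fun i _ => hb.symm _ _
  have s1 : ∑ j, cotton G p u (e j) (dualFrame (G p) e j) =
      - ∑ i, cotton G p (e i) u (dualFrame (G p) e i) := by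
    rw [← Finset.sum_neg_distrib]
    exact Finset.sum_congr rfl fun i _ => cotton_antisymm _ _ _
  have s2 : ∑ j, (∑ i, cotton G p (e i) (e j) (dualFrame (G p) e i)) * G p u (dualFrame (G p) e j) =
      ∑ i, cotton G p (e i) u (dualFrame (G p) e i) := by
    let l : E →ₗ[𝕜] 𝕜 := ∑ i, ((cottonL G p (e i)).flip (dualFrame (G p) e i)).toLinearMap
    have hl : ∀ w, l w = ∑ i, cotton G p (e i) w (dualFrame (G p) e i) := fun w => by
      simp only [l, ← hG.cottonL_apply hp]
      simp
    simp only [← hl]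
    refine (Finset.sum_congr rfl fun i _ => ?_).trans (hs.contraction_right l u)
    rw [hb.symm u, mul_comm]
    rfl
  simp only [Finset.sum_add_distrib, Finset.sum_sub_distrib, ← Finset.mul_sum,
    Finset.sum_const_zero, t1, s0, s1, s2] at h0
  obtain ⟨m, hm⟩ := Nat.exists_eq_add_of_le hn
  have h2 : (m : 𝕜) + 1 ≠ 0 := by exact_mod_cast Nat.succ_ne_zero m
  rw [hm] at h0
  push_cast at h0
  have h3 : ((m : 𝕜) + 1) * ∑ i, cotton G p (e i) u (dualFrame (G p) e i) = 0 := by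
    linear_combination -h0 / 2
  exact (mul_eq_zero.1 h3).resolve_left h2

/-- The Cotton-York tensor is the divergence of the Weyl tensor. -/
theorem divergence_weylL (hG : IsCoordMetric G Ω) (hn : 3 ≤ Module.finrank 𝕜 E) (hp : p ∈ Ω)
    (e : Module.Basis κ 𝕜 E) (u w a : E) :
    (Module.finrank 𝕜 E - 3) * cotton G p u w a =
      ∑ i, covDeriv₄ G (weylL G) p (e i) u w a (dualFrame (G p) e i) := by
  have h := hG.divergence_weylL_aux hn hp e w u a
  rw [hG.contraction_cotton hn hp e, hG.contraction_cotton hn hp e, cotton_antisymm] at h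
  linear_combination -h

end Contraction

/-- If the Weyl tensor of a metric in dimension `4` is self-dual, so is the Cotton-York tensor. -/
theorem cotton_selfDual (hG : IsCoordMetric G Ω)
    (hE : Module.finrank 𝕜 E = 4) (hp : p ∈ Ω) {vol : E → E [⋀^Fin 4]→L[𝕜] 𝕜}
    (hvol : DifferentiableAt 𝕜 vol p)
    (hsq : ∀ q ∈ Ω, ∀ e : Fin 4 → E, vol q e ^ 2 = (Matrix.of fun i j => G q (e i) (e j)).det)
    (hsd : ∀ q ∈ Ω, ∀ u v w z,
      hodge (G q) (vol q) (fun u v => weyl G q u v w z) u v = weyl G q u v w z) (u v w : E) :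
    hodge (G p) (vol p) (fun u v => cotton G p u v w) u v = cotton G p u v w := by
  have h := fun u v => hG.divergence_weylL (by omega) hp (Module.finBasis 𝕜 E) u v w
  -- In dimension 4 the factor `n - 3` is `1` and `C = div W`. What remains is to interchange the
  -- contraction of the divergence with the sums of the Hodge operator.
  have h4 : (Module.finrank 𝕜 E : 𝕜) - 3 = 1 := by rw [hE]; norm_num
  simp only [h4, one_mul] at h
  rw [hodge]
  simp only [h]
  have h5 := fun x z => hG.covDeriv_weylL_selfDual hE hp hvol hsq hsd (Module.finBasis 𝕜 E) x u v
    w z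
  conv_rhs => enter [2, i]; rw [h5]
  simp only [Finset.mul_sum]
  symm
  rw [Finset.sum_comm]
  exact Finset.sum_congr rfl fun i _ => Finset.sum_comm

end IsCoordMetric

end SelfDual

/-! ### Conformal umbilic hypersurfaces: Codazzi, Gauss, and restriction of `C`. -/

section Umbilic

variable {𝕜 : Type*} [RCLike 𝕜]
variable {E : Type*} [NormedAddCommGroup E] [NormedSpace 𝕜 E] [FiniteDimensional 𝕜 E]
variable {F : Type*} [NormedAddCommGroup F] [NormedSpace 𝕜 F] [FiniteDimensional 𝕜 F]

/-- A conformal umbilic immersion `f` with conformal factor `φ`, where `α = dφ / 2φ`. -/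
structure IsConformalUmbilic (G : E → E →L[𝕜] E →L[𝕜] 𝕜) (Ω : Set E)
    (K : F → F →L[𝕜] F →L[𝕜] 𝕜) (Ω' : Set F) (f : F → E) (φ : F → 𝕜) (α : F → F →L[𝕜] 𝕜)
    (N : F → E) : Prop
    extends IsUmbilicMap G Ω K Ω' f α N where
  smooth_factor : ContDiffOn 𝕜 ∞ φ Ω'
  factor_ne_zero : ∀ q ∈ Ω', φ q ≠ 0
  fderiv_factor : ∀ q ∈ Ω', ∀ x, fderiv 𝕜 φ q x = 2 * φ q * α q x
  conformal : ∀ q ∈ Ω', ∀ x y, G (f q) (fderiv 𝕜 f q x) (fderiv 𝕜 f q y) = φ q * K q x y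

variable {G : E → E →L[𝕜] E →L[𝕜] 𝕜} {Ω : Set E} {K : F → F →L[𝕜] F →L[𝕜] 𝕜} {Ω' : Set F}
  {f : F → E} {φ : F → 𝕜} {α : F → F →L[𝕜] 𝕜} {N : F → E} {q : F}

namespace IsConformalUmbilic

/-- `N` is not normal unless `α = 0`: as the second fundamental form is taken relative to the
connection of `K`, not of `φ K`, the Koszul formula gives `N` the tangential part `-df(α^♯)`. -/
theorem normal_eq (h : IsConformalUmbilic G Ω K Ω' f φ α N) (hq : q ∈ Ω') (z : F) :
    G (f q) (N q) (fderiv 𝕜 f q z) = - (φ q * α q z) := by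
  have key : ∀ x y, K q x y * (G (f q) (N q) (fderiv 𝕜 f q z) + φ q * α q z) = 0 := by
    intro x y
    have hk := h.koszul h.source h.smooth_factor h.conformal hq x y z
    rw [h.covAlong_eq q hq] at hk
    simp only [h.fderiv_factor q hq, map_add, map_sub, map_smul, add_apply, sub_apply,
      FunLike.coe_smul, Pi.smul_apply, smul_eq_mul, h.conformal q hq] at hk
    linear_combination hk / 2
  by_cases h0 : ∃ x, x ≠ (0 : F)
  · obtain ⟨x, hx⟩ := h0
    by_contra hne
    refine hx ((h.source.scalar q hq).nondegenerate x fun y => ?_)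
    refine (mul_eq_zero.1 (key x y)).resolve_right fun h1 => hne ?_
    linear_combination h1
  · push Not at h0
    simp [h0 z]

/-- Formally `α = d(log φ) / 2`. Symmetry of the second derivative of `φ` replaces the logarithm. -/
theorem form_closed (h : IsConformalUmbilic G Ω K Ω' f φ α N) (hq : q ∈ Ω') (x y : F) :
    fderiv 𝕜 α q x y = fderiv 𝕜 α q y x := by
  have hα : DifferentiableAt 𝕜 α q := h.smooth_form.differentiableAt_of_isOpen h.isOpen hq
  have hφ : DifferentiableAt 𝕜 φ q := h.smooth_factor.differentiableAt_of_isOpen h.isOpen hq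
  have hφ2 : DifferentiableAt 𝕜 (fderiv 𝕜 φ) q :=
    ContDiffOn.differentiableAt_of_isOpen
      (h.smooth_factor.fderiv_of_isOpen h.isOpen (m := ∞) (by simp)) h.isOpen hq
  have key : ∀ x y, fderiv 𝕜 (fderiv 𝕜 φ) q x y =
      2 * (2 * φ q * α q x * α q y + φ q * fderiv 𝕜 α q x y) := by
    intro x y
    have e : (fun q => fderiv 𝕜 φ q y) =ᶠ[nhds q] fun q => (2 * φ q) * α q y :=
      (h.source.eventually_mem hq).mono fun q' hq' => h.fderiv_factor q' hq' y
    have e1 := congrArg (fun l => l x) (e.fderiv_eq (𝕜 := 𝕜))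
    rw [fderiv_clm_apply₁ hφ2 (differentiableAt_const y),
      fderiv_fun_mul (by fun_prop) (by fun_prop), fderiv_const_mul hφ] at e1
    simp only [add_apply, FunLike.coe_smul, Pi.smul_apply, smul_eq_mul,
      fderiv_clm_apply₁ hα (differentiableAt_const y), h.fderiv_factor q hq] at e1
    simp at e1
    rw [e1]
    ring
  have h1 := key x y
  rw [h.smooth_factor.fderiv_fderiv_symm h.isOpen hq, key] at h1
  refine mul_left_cancel₀ (h.factor_ne_zero q hq) ?_
  linear_combination -h1 / 2

/-- The tangential part of the derivative of the normal field. -/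
theorem covAlong_normal (h : IsConformalUmbilic G Ω K Ω' f φ α N) (hq : q ∈ Ω') (x w : F) :
    G (f q) (covAlong G f N q x - α q x • N q) (fderiv 𝕜 f q w) =
      - (φ q * formHessian K α q x w) - K q x w * G (f q) (N q) (N q) := by
  have hα : DifferentiableAt 𝕜 α q := h.smooth_form.differentiableAt_of_isOpen h.isOpen hq
  have hφ : DifferentiableAt 𝕜 φ q := h.smooth_factor.differentiableAt_of_isOpen h.isOpen hq
  have hN : DifferentiableAt 𝕜 N q := h.smooth_normal.differentiableAt_of_isOpen h.isOpen hq
  have hfd := h.differentiableAt_fderiv hq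
  -- The relation `normal_eq` is differentiated; the derivative of `df` is known from umbilicity.
  have e : (fun q => G (f q) (N q) (fderiv 𝕜 f q w)) =ᶠ[nhds q] fun q => - (φ q * α q w) :=
    (h.source.eventually_mem hq).mono fun q' hq' => h.normal_eq hq' w
  have e1 := congrArg (fun l => l x) (e.fderiv_eq (𝕜 := 𝕜))
  rw [h.fderiv_metric hq hN (W := fun q => fderiv 𝕜 f q w) (by fun_prop), fderiv_fun_neg,
    fderiv_fun_mul (by fun_prop) (by fun_prop), h.covAlong_eq q hq] at e1
  simp only [add_apply, neg_apply, FunLike.coe_smul, Pi.smul_apply, smul_eq_mul,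
    fderiv_clm_apply₁ hα (differentiableAt_const w), h.fderiv_factor q hq, map_add, map_smul,
    h.normal_eq hq] at e1
  simp at e1
  simp only [map_sub, map_smul, sub_apply, FunLike.coe_smul, Pi.smul_apply, smul_eq_mul,
    h.normal_eq hq, formHessian]
  linear_combination e1

section Hypersurface

variable {κ : Type*} [Fintype κ] [DecidableEq κ]

/-- A frame adapted to a hypersurface. -/
theorem exists_adapted_frame (h : IsConformalUmbilic G Ω K Ω' f φ α N) (hq : q ∈ Ω')
    (hEF : Module.finrank 𝕜 E = Module.finrank 𝕜 F + 1) (e : Module.Basis κ 𝕜 F) :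
    ∃ (ν : E) (e' : Module.Basis (Option κ) 𝕜 E), (∀ x, G (f q) (fderiv 𝕜 f q x) ν = 0) ∧
      e' none = ν ∧ (∀ i, e' (some i) = fderiv 𝕜 f q (e i)) ∧
      ∃ c : 𝕜, IsDualFrame (G (f q)) e' (fun i => i.elim (c • ν)
        fun i => (φ q)⁻¹ • fderiv 𝕜 f q (dualFrame (K q) e i)) := by
  have hφ := h.factor_ne_zero q hq
  have hK := h.source.scalar q hq
  have hGs := h.metric.scalar _ (h.mapsTo hq)
  have hs := hK.isDualFrame_dualFrame e
  let A : E →ₗ[𝕜] (F →ₗ[𝕜] 𝕜) :=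
    (LinearMap.mk₂ 𝕜 (fun v x => G (f q) v (fderiv 𝕜 f q x)) (fun u u' v => by simp)
      (fun a u v => by simp) (fun u u' v => by simp) (fun a u v => by simp))
  -- The tangent space has codimension one, so a nonzero normal vector exists. It cannot be null
  -- (`hνν` below), else it would be orthogonal to everything.
  have hker : LinearMap.ker A ≠ ⊥ := by
    apply LinearMap.ker_ne_bot_of_finrank_lt
    have : Module.finrank 𝕜 (F →ₗ[𝕜] 𝕜) = Module.finrank 𝕜 F := Subspace.dual_finrank_eq
    rw [this, hEF]
    omega
  obtain ⟨ν, hν, hν0⟩ := Submodule.exists_mem_ne_zero_of_ne_bot hker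
  have hν1 : ∀ x, G (f q) (fderiv 𝕜 f q x) ν = 0 := fun x => by
    rw [hGs.symm]; exact congrArg (fun l => l x) (LinearMap.mem_ker.1 hν)
  let b : Option κ → E := fun i => i.elim ν fun i => fderiv 𝕜 f q (e i)
  have hli : LinearIndependent 𝕜 b := by
    rw [Fintype.linearIndependent_iff]
    intro c hc
    rw [Fintype.sum_option] at hc
    have hsome : ∀ j, c (some j) = 0 := by
      intro j
      have := congrArg (G (f q) (fderiv 𝕜 f q (dualFrame (K q) e j))) hc
      simpa [b, hν1, h.conformal q hq, hs j _, hφ] using this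
    rintro (_ | j)
    · simpa [hsome, b, hν0] using hc
    · exact hsome j
  have hcard : Fintype.card (Option κ) = Module.finrank 𝕜 E := by
    rw [hEF, Fintype.card_option, Module.finrank_eq_card_basis e]
  have : Nonempty (Option κ) := ⟨none⟩
  let e' := basisOfLinearIndependentOfCardEqFinrank hli hcard
  have he' : ∀ i, e' i = b i := fun i => by simp [e']
  have hνν : G (f q) ν ν ≠ 0 := by
    intro h0
    refine hν0 (hGs.nondegenerate ν fun v => ?_)
    rw [← e'.sum_repr v, map_sum]
    refine Finset.sum_eq_zero fun i _ => ?_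
    rw [map_smul, he']
    rcases i with _ | i
    · simp [b, h0]
    · simp [b, hGs.symm ν, hν1]
  refine ⟨ν, e', hν1, he' none, fun i => he' (some i), (G (f q) ν ν)⁻¹, ?_⟩
  rintro (_ | i) (_ | j)
  · simp [he', b, hνν]
  · simp [he', b, hGs.symm ν, hν1]
  · simp [he', b, hν1]
  · simp [he', b, h.conformal q hq, hs i j, hφ]

/-- The Codazzi equation. -/
theorem codazzi (h : IsConformalUmbilic G Ω K Ω' f φ α N) (hq : q ∈ Ω')
    (hEF : Module.finrank 𝕜 E = Module.finrank 𝕜 F + 1) (hF : 3 ≤ Module.finrank 𝕜 F)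
    {ν : E} (hν : ∀ x, G (f q) (fderiv 𝕜 f q x) ν = 0) :
    (∀ x y z, weyl G (f q) (fderiv 𝕜 f q x) (fderiv 𝕜 f q y) (fderiv 𝕜 f q z) ν = 0) ∧
      ∀ x, G (f q) (covAlong G f N q x - α q x • N q) ν =
        φ q * normRicci G (f q) (fderiv 𝕜 f q x) ν := by
  have hφ := h.factor_ne_zero q hq
  have hK := h.source.scalar q hq
  have hGs := h.metric.scalar _ (h.mapsTo hq)
  -- The failure of the second claim. By the Gauss equation paired with `ν`, it also governs the
  -- first one.
  let θ : F →ₗ[𝕜] 𝕜 := IsLinearMap.mk' (fun x => G (f q) (covAlong G f N q x - α q x • N q) ν -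
        φ q * normRicci G (f q) (fderiv 𝕜 f q x) ν)
    ⟨fun x y => by simp [covAlong, ← normRicciL_apply]; ring,
      fun a x => by simp [covAlong, ← normRicciL_apply]; ring⟩
  have hW : ∀ x y z, weyl G (f q) (fderiv 𝕜 f q x) (fderiv 𝕜 f q y) (fderiv 𝕜 f q z) ν =
      K q y z * θ x - K q x z * θ y := by
    intro x y z
    rw [weyl, h.gauss hq]
    simp only [map_add, map_sub, map_smul, add_apply, sub_apply, FunLike.coe_smul, Pi.smul_apply,
      smul_eq_mul, hν, h.conformal q hq, θ, IsLinearMap.mk'_apply]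
    ring
  have hθ : θ = 0 := by
    ext y
    obtain ⟨ν', e', h1, h2, h3, c, h4⟩ := h.exists_adapted_frame hq hEF (Module.finBasis 𝕜 F)
    have hs := hK.isDualFrame_dualFrame (Module.finBasis 𝕜 F)
    -- The trace of `W` over an adapted frame: the normal summand vanishes by skewness, the tangent
    -- ones add up to a multiple of `(dim F - 1) θ y`.
    have t := h4.contraction_weyl (by omega) hGs (fderiv 𝕜 f q y) ν
    have hskew := h.metric.weyl_skew (h.mapsTo hq)
    have hν' : ν = G (f q) (c • ν') ν • ν' := by
      have := h4.sum_left ν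
      simp only [Fintype.sum_option, h2, h3, Option.elim, map_smul, FunLike.coe_smul, Pi.smul_apply,
        hν] at this
      simpa using this.symm
    have t0 : weyl G (f q) ν' (fderiv 𝕜 f q y) ν (c • ν') = 0 := by
      have h5 : weylL G (f q) ν' (fderiv 𝕜 f q y) ν' ν' = 0 := by
        have := hskew ν' (fderiv 𝕜 f q y) ν' ν'
        rw [weylL_apply]
        linear_combination this / 2
      rw [← weylL_apply, hν']
      simp [h5]
    have t1 : ∀ i, weyl G (f q) (fderiv 𝕜 f q (Module.finBasis 𝕜 F i)) (fderiv 𝕜 f q y) ν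
        ((φ q)⁻¹ • fderiv 𝕜 f q (dualFrame (K q) (Module.finBasis 𝕜 F) i)) =
        - ((φ q)⁻¹ * (K q (dualFrame (K q) (Module.finBasis 𝕜 F) i) y * θ (Module.finBasis 𝕜 F i)
          - K q (dualFrame (K q) (Module.finBasis 𝕜 F) i) (Module.finBasis 𝕜 F i) * θ y)) := by
      intro i
      rw [← weylL_apply, map_smul, weylL_apply, hskew, hW, hK.symm y, hK.symm (Module.finBasis 𝕜 F i)]
      rw [smul_eq_mul]
      ring
    have t2 := hs.contraction_right θ y
    have t3 := hs.sum_self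
    rw [IsDualFrame.card_eq (Module.finBasis 𝕜 F)] at t3
    simp only [Fintype.sum_option, h2, h3, Option.elim, t0, t1] at t
    rw [Finset.sum_neg_distrib, ← Finset.mul_sum, Finset.sum_sub_distrib, ← Finset.sum_mul, t3] at t
    simp only [smul_eq_mul] at t2
    rw [t2, zero_add, neg_eq_zero] at t
    have t4 := (mul_eq_zero.1 t).resolve_left (inv_ne_zero hφ)
    obtain ⟨m, hm⟩ := Nat.exists_eq_add_of_le hF
    rw [hm] at t4
    push_cast at t4
    have t5 : ((m : 𝕜) + 2) * θ y = 0 := by linear_combination -t4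
    have h2 : (m : 𝕜) + 2 ≠ 0 := by exact_mod_cast Nat.succ_ne_zero (m + 1)
    exact (mul_eq_zero.1 t5).resolve_left h2
  refine ⟨fun x y z => by simp [hW, hθ], fun x => ?_⟩
  rw [← sub_eq_zero]
  exact congrArg (fun l => l x) hθ

/-- The Weyl tensor of a self-dual metric vanishes on the tangent vectors of an umbilic
hypersurface. -/
theorem weyl_tangent (h : IsConformalUmbilic G Ω K Ω' f φ α N) (hq : q ∈ Ω')
    (hE : Module.finrank 𝕜 E = 4) (hF : Module.finrank 𝕜 F = 3)
    {vol : E [⋀^Fin 4]→L[𝕜] 𝕜}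
    (hsd : ∀ u v w z, hodge (G (f q)) vol (fun u v => weyl G (f q) u v w z) u v =
      weyl G (f q) u v w z) (x y z w : F) :
    weyl G (f q) (fderiv 𝕜 f q x) (fderiv 𝕜 f q y) (fderiv 𝕜 f q z) (fderiv 𝕜 f q w) = 0 := by
  have hGs := h.metric.scalar _ (h.mapsTo hq)
  obtain ⟨ν, e', h1, h2, h3, c, h4⟩ := h.exists_adapted_frame hq (by omega) (Module.finBasis 𝕜 F)
  have hsym := h.metric.weyl_pair_symm (h.mapsTo hq)
  have hc := (h.codazzi hq (by omega) (by omega) h1).1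
  -- Four vectors from a 3-dimensional space are dependent, so in `W = *W` only summands with a
  -- normal index could survive.
  have hvol : ∀ a b, vol ![fderiv 𝕜 f q x, fderiv 𝕜 f q y, fderiv 𝕜 f q a, fderiv 𝕜 f q b] = 0 := by
    intro a b
    have hdep : ¬ LinearIndependent 𝕜 ![x, y, a, b] := fun hli => by
      have := hli.fintype_card_le_finrank
      rw [hF] at this
      simp at this
    have := (vol.toAlternatingMap.compLinearMap (fderiv 𝕜 f q).toLinearMap).map_linearDependent
      _ hdep
    rw [← this]
    refine congrArg vol (funext fun k => ?_)
    fin_cases k <;> rfl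
  rw [← hsd, hodge_eq hGs h4 vol
    (α := fun u v => weyl G (f q) u v (fderiv 𝕜 f q z) (fderiv 𝕜 f q w)) (weylForm G (f q) (fderiv 𝕜 f q z) (fderiv 𝕜 f q w))
    (fun u v => rfl)]
  have hl : ∀ a b, weyl G (f q) a b (fderiv 𝕜 f q z) (fderiv 𝕜 f q w) =
    weylForm G (f q) (fderiv 𝕜 f q z) (fderiv 𝕜 f q w) a b := fun a b => rfl
  -- Pair symmetry moves `ν` to the last slot, where Codazzi applies.
  have h5 : ∀ a, weylForm G (f q) (fderiv 𝕜 f q z) (fderiv 𝕜 f q w) (fderiv 𝕜 f q a) ν = 0 :=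
    fun a => by rw [← hl, hsym, hc]
  have h6 : ∀ a, weylForm G (f q) (fderiv 𝕜 f q z) (fderiv 𝕜 f q w) ν (fderiv 𝕜 f q a) = 0 :=
    fun a => by rw [← hl, weyl_antisymm, hl, h5, neg_zero]
  have h7 : weylForm G (f q) (fderiv 𝕜 f q z) (fderiv 𝕜 f q w) ν ν = 0 := by
    have := weyl_antisymm (G := G) (p := f q) ν ν (fderiv 𝕜 f q z) (fderiv 𝕜 f q w)
    rw [hl] at this
    linear_combination this / 2
  refine mul_eq_zero_of_right _ (Finset.sum_eq_zero fun i _ => Finset.sum_eq_zero fun j _ => ?_)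
  rw [hl]
  rcases i with _ | i <;> rcases j with _ | j
  · simp [h7]
  · simp [h6]
  · simp [h5]
  · rw [h3, h3, hvol, zero_mul]

end Hypersurface

/-- The normalized Ricci tensor of the source. -/
theorem normRicci_eq (h : IsConformalUmbilic G Ω K Ω' f φ α N) (hq : q ∈ Ω')
    (hF : 3 ≤ Module.finrank 𝕜 F)
    (hW : ∀ x y z w, weyl G (f q) (fderiv 𝕜 f q x) (fderiv 𝕜 f q y) (fderiv 𝕜 f q z)
      (fderiv 𝕜 f q w) = 0) :
    (∀ y z, normRicci K q y z = normRicci G (f q) (fderiv 𝕜 f q y) (fderiv 𝕜 f q z)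
      + formHessian K α q y z + G (f q) (N q) (N q) / (2 * φ q) * K q y z) ∧
    ∀ x y z w, K q (curvature K q x y z) w =
      ricciPart (fun u v => K q u v) (normRicci K q) x y z w := by
  have hφ := h.factor_ne_zero q hq
  have hK := h.source.scalar q hq
  have hs := hK.isDualFrame_dualFrame (Module.finBasis 𝕜 F)
  -- Read off from the tangential Gauss equation divided by `φ`. The factor `2` in the last
  -- denominator appears because `K` put for `P` in `ricciPart` counts twice.
  let P : F →ₗ[𝕜] F →ₗ[𝕜] 𝕜 := LinearMap.mk₂ 𝕜
    (fun y z => normRicciL G (f q) (fderiv 𝕜 f q y) (fderiv 𝕜 f q z)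
      + formHessian K α q y z + G (f q) (N q) (N q) / (2 * φ q) * K q y z)
    (fun x y z => by simp [formHessian]; ring) (fun a y z => by simp [formHessian]; ring)
    (fun x y z => by simp [formHessian]; ring) (fun a y z => by simp [formHessian]; ring)
  have hR : ∀ x y z w, K q (curvature K q x y z) w =
      0 + ricciPart (fun u v => K q u v) (fun u v => P u v) x y z w := by
    intro x y z w
    have hg := congrArg (fun v => G (f q) v (fderiv 𝕜 f q w)) (h.gauss hq x y z)
    have hw := hW x y z w
    have hn := h.covAlong_normal hq
    simp only [map_sub, map_smul, sub_apply, FunLike.coe_smul, Pi.smul_apply, smul_eq_mul] at hn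
    rw [weyl] at hw
    simp only [map_add, map_sub, map_smul, add_apply, sub_apply, FunLike.coe_smul, Pi.smul_apply,
      smul_eq_mul, h.conformal q hq, hn, h.form_closed hq x y] at hg hw
    refine mul_left_cancel₀ hφ ?_
    simp only [ricciPart, P, LinearMap.mk₂_apply, normRicciL_apply]
    field_simp
    linear_combination 2 * (hw - hg)
  have hP := fun y z => hs.normRicci_eq hF hK P (T := fun _ _ _ _ => 0) hR (by simp) y z
  refine ⟨hP, fun x y z w => ?_⟩
  rw [hR, zero_add]
  simp only [ricciPart, ← hP]

/-- The normal part of the derivative of the normal field. -/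
theorem covAlong_normal_normal (h : IsConformalUmbilic G Ω K Ω' f φ α N) (hq : q ∈ Ω')
    (hEF : Module.finrank 𝕜 E = Module.finrank 𝕜 F + 1) (hF : 3 ≤ Module.finrank 𝕜 F)
    (hW : ∀ x y z w, weyl G (f q) (fderiv 𝕜 f q x) (fderiv 𝕜 f q y) (fderiv 𝕜 f q z)
      (fderiv 𝕜 f q w) = 0) (x : F) :
    G (f q) (covAlong G f N q x - α q x • N q) (N q) =
      φ q * (normRicci G (f q) (fderiv 𝕜 f q x) (N q) + normRicci K q x (sharp (K q) (α q)))
        + G (f q) (N q) (N q) / 2 * α q x := by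
  have hφ := h.factor_ne_zero q hq
  have hK := h.source.scalar q hq
  have hGs := h.metric.scalar _ (h.mapsTo hq)
  have ha := hK.sharp_apply (α q)
  set a := sharp (K q) (α q)
  -- The true normal part of `N`. Codazzi applies to it, and `covAlong_normal` takes care of the
  -- tangential part that was added.
  have hν : ∀ x, G (f q) (fderiv 𝕜 f q x) (N q + fderiv 𝕜 f q a) = 0 := fun x => by
    rw [map_add, hGs.symm, h.normal_eq hq, h.conformal q hq, hK.symm, ha]
    ring
  have h1 := (h.codazzi hq hEF hF hν).2 x
  have h2 := h.covAlong_normal hq x a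
  rw [map_add, h2, ← normRicciL_apply, map_add, normRicciL_apply, normRicciL_apply, hK.symm x,
    ha] at h1
  rw [(h.normRicci_eq hq hF hW).1, hK.symm x, ha]
  field_simp
  linear_combination 2 * h1

/-- The covariant derivative of the normalized Ricci tensor of the source. -/
theorem covDerivNormRicci_eq (h : IsConformalUmbilic G Ω K Ω' f φ α N) (hq : q ∈ Ω')
    (hEF : Module.finrank 𝕜 E = Module.finrank 𝕜 F + 1) (hF : 3 ≤ Module.finrank 𝕜 F)
    (hW : ∀ q ∈ Ω', ∀ x y z w, weyl G (f q) (fderiv 𝕜 f q x) (fderiv 𝕜 f q y) (fderiv 𝕜 f q z)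
      (fderiv 𝕜 f q w) = 0) (x y z : F) :
    covDerivNormRicci K q x y z =
      covDerivNormRicci G (f q) (fderiv 𝕜 f q x) (fderiv 𝕜 f q y) (fderiv 𝕜 f q z)
      + normRicciL G (f q) (α q x • fderiv 𝕜 f q y + α q y • fderiv 𝕜 f q x + K q x y • N q)
        (fderiv 𝕜 f q z)
      + normRicciL G (f q) (fderiv 𝕜 f q y)
        (α q x • fderiv 𝕜 f q z + α q z • fderiv 𝕜 f q x + K q x z • N q)
      + (fderiv 𝕜 (fderiv 𝕜 α) q x y z - fderiv 𝕜 α q x (christoffel K q y z)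
        - α q (fderiv 𝕜 (christoffel K) q x y z)
        - fderiv 𝕜 α q x y * α q z - α q y * fderiv 𝕜 α q x z)
      - formHessian K α q (christoffel K q x y) z - formHessian K α q y (christoffel K q x z)
      + (normRicci G (f q) (fderiv 𝕜 f q x) (N q) + normRicci K q x (sharp (K q) (α q))
        + G (f q) (N q) (N q) / (2 * φ q) * α q x) * K q y z := by
  have hφ := h.factor_ne_zero q hq
  have hα : DifferentiableAt 𝕜 α q := h.smooth_form.differentiableAt_of_isOpen h.isOpen hq
  have hα2 : DifferentiableAt 𝕜 (fderiv 𝕜 α) q :=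
    ContDiffOn.differentiableAt_of_isOpen
      (h.smooth_form.fderiv_of_isOpen h.isOpen (m := ∞) (by simp)) h.isOpen hq
  have hφd : DifferentiableAt 𝕜 φ q := h.smooth_factor.differentiableAt_of_isOpen h.isOpen hq
  have hN : DifferentiableAt 𝕜 N q := h.smooth_normal.differentiableAt_of_isOpen h.isOpen hq
  have hf := h.differentiableAt hq
  have hfd := h.differentiableAt_fderiv hq
  have hH := h.metric.differentiableAt_normRicciL (h.mapsTo hq)
  have hGd := h.metric.differentiableAt (h.mapsTo hq)
  have hc := h.source.differentiableAt_christoffel hq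
  have hKd := h.source.differentiableAt hq
  -- The formula for `h^K` on a neighbourhood, whose three summands are differentiated separately.
  have e : (fun q => normRicci K q y z) =ᶠ[nhds q] fun q =>
      normRicciL G (f q) (fderiv 𝕜 f q y) (fderiv 𝕜 f q z) + formHessian K α q y z
        + (2 * φ q)⁻¹ * G (f q) (N q) (N q) * K q y z :=
    (h.source.eventually_mem hq).mono fun q' hq' => by
      dsimp only
      rw [(h.normRicci_eq hq' hF (hW q' hq')).1, normRicciL_apply]
      ring
  have d1 : fderiv 𝕜 (fun q => normRicciL G (f q) (fderiv 𝕜 f q y) (fderiv 𝕜 f q z)) q x =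
      covDerivNormRicci G (f q) (fderiv 𝕜 f q x) (fderiv 𝕜 f q y) (fderiv 𝕜 f q z)
      + normRicciL G (f q) (covAlong G f (fun q => fderiv 𝕜 f q y) q x) (fderiv 𝕜 f q z)
      + normRicciL G (f q) (fderiv 𝕜 f q y) (covAlong G f (fun q => fderiv 𝕜 f q z) q x) := by
    rw [fderiv_clm_apply₂ (B := fun q => normRicciL G (f q)) (hH.comp q hf) (by fun_prop)
      (by fun_prop), fderiv_fun_comp q hH hf, covDerivNormRicci,
      h.metric.fderiv_normRicci (h.mapsTo hq), covAlong, covAlong]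
    simp [← normRicciL_apply]
    ring
  have hcyz : DifferentiableAt 𝕜 (fun q => christoffel K q y z) q := by fun_prop
  have d2 : fderiv 𝕜 (fun q => formHessian K α q y z) q x =
      fderiv 𝕜 (fderiv 𝕜 α) q x y z - fderiv 𝕜 α q x (christoffel K q y z)
        - α q (fderiv 𝕜 (christoffel K) q x y z)
        - fderiv 𝕜 α q x y * α q z - α q y * fderiv 𝕜 α q x z := by
    simp only [formHessian]
    rw [fderiv_fun_sub (by fun_prop) (by fun_prop), fderiv_fun_sub (by fun_prop) (by fun_prop),
      fderiv_fun_mul (by fun_prop) (by fun_prop)]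
    simp only [add_apply, sub_apply, FunLike.coe_smul, Pi.smul_apply, smul_eq_mul]
    rw [fderiv_clm_apply₂ hα2 (differentiableAt_const y) (differentiableAt_const z),
      fderiv_clm_apply₁ hα hcyz, fderiv_clm_apply₁ hα (differentiableAt_const y),
      fderiv_clm_apply₁ hα (differentiableAt_const z),
      fderiv_clm_apply₂ hc (differentiableAt_const y) (differentiableAt_const z)]
    simp
    ring
  have hGN : DifferentiableAt 𝕜 (fun q => G (f q) (N q) (N q)) q := by
    have : DifferentiableAt 𝕜 (fun q => G (f q)) q := hGd.comp q hf
    fun_prop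
  have d3 : fderiv 𝕜 (fun q => (2 * φ q)⁻¹ * G (f q) (N q) (N q)) q x =
      normRicci G (f q) (fderiv 𝕜 f q x) (N q) + normRicci K q x (sharp (K q) (α q))
        + G (f q) (N q) (N q) / (2 * φ q) * α q x := by
    have h2φ : (2 * φ q) ≠ 0 := mul_ne_zero two_ne_zero hφ
    have hinv : DifferentiableAt 𝕜 (fun q => (2 * φ q)⁻¹) q := by fun_prop (disch := assumption)
    -- Clearing the denominator before differentiating avoids the derivative of an inverse.
    have h1 : (fun q => (2 * φ q) * ((2 * φ q)⁻¹ * G (f q) (N q) (N q))) =ᶠ[nhds q]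
        fun q => G (f q) (N q) (N q) :=
      (h.source.eventually_mem hq).mono fun q' hq' => by
        have := h.factor_ne_zero q' hq'
        field_simp
    have h2 := congrArg (fun l => l x) (h1.fderiv_eq (𝕜 := 𝕜))
    have hm : DifferentiableAt 𝕜 (fun q => (2 * φ q)⁻¹ * G (f q) (N q) (N q)) q := hinv.mul hGN
    rw [fderiv_fun_mul (by fun_prop) hm, fderiv_const_mul hφd,
      h.fderiv_metric hq hN hN] at h2
    have h3 := h.covAlong_normal_normal hq hEF hF (hW q hq) x
    simp only [add_apply, FunLike.coe_smul, Pi.smul_apply, smul_eq_mul,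
      h.fderiv_factor q hq] at h2
    rw [(h.metric.scalar _ (h.mapsTo hq)).symm (N q) (covAlong G f N q x)] at h2
    simp only [map_sub, map_smul, sub_apply, FunLike.coe_smul, Pi.smul_apply, smul_eq_mul] at h3
    refine mul_left_cancel₀ h2φ ?_
    field_simp at h2 h3 ⊢
    linear_combination h2 + h3
  have d4 : fderiv 𝕜 (fun q => K q y z) q x =
      K q (christoffel K q x y) z + K q y (christoffel K q x z) := by
    rw [← h.source.fderiv_eq hq,
      fderiv_clm_apply₂ hKd (differentiableAt_const y) (differentiableAt_const z)]
    simp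
  have hm : DifferentiableAt 𝕜 (fun q => (2 * φ q)⁻¹ * G (f q) (N q) (N q)) q := by
    have h2φ : (2 * φ q) ≠ 0 := mul_ne_zero two_ne_zero hφ
    have hinv : DifferentiableAt 𝕜 (fun q => (2 * φ q)⁻¹) q := by fun_prop (disch := assumption)
    exact hinv.mul hGN
  have hHf : DifferentiableAt 𝕜 (fun q => normRicciL G (f q)) q := hH.comp q hf
  have hS : DifferentiableAt 𝕜 (fun q => formHessian K α q y z) q := by
    unfold formHessian
    fun_prop
  conv_lhs => rw [covDerivNormRicci]
  rw [e.fderiv_eq, fderiv_fun_add (by fun_prop) (by fun_prop),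
    fderiv_fun_add (by fun_prop) (by fun_prop), fderiv_fun_mul hm (by fun_prop)]
  simp only [add_apply, FunLike.coe_smul, Pi.smul_apply, smul_eq_mul]
  rw [d1, d2, d3, d4, h.covAlong_eq q hq, h.covAlong_eq q hq,
    (h.normRicci_eq hq hF (hW q hq)).1 (christoffel K q x y) z,
    (h.normRicci_eq hq hF (hW q hq)).1 y (christoffel K q x z)]
  simp only [map_add, add_apply, normRicciL_apply]
  field_simp
  ring

/-- The Cotton-York tensor of a self-dual metric restricts to the one of an umbilic hypersurface. -/
theorem cotton_eq (h : IsConformalUmbilic G Ω K Ω' f φ α N) (hq : q ∈ Ω')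
    (hEF : Module.finrank 𝕜 E = Module.finrank 𝕜 F + 1) (hF : 3 ≤ Module.finrank 𝕜 F)
    (hW : ∀ q ∈ Ω', ∀ x y z w, weyl G (f q) (fderiv 𝕜 f q x) (fderiv 𝕜 f q y) (fderiv 𝕜 f q z)
      (fderiv 𝕜 f q w) = 0) (x y z : F) :
    cotton G (f q) (fderiv 𝕜 f q x) (fderiv 𝕜 f q y) (fderiv 𝕜 f q z) = cotton K q x y z := by
  have hφ := h.factor_ne_zero q hq
  have hK := h.source.scalar q hq
  have ha := hK.sharp_apply (α q)
  -- Pairing with `α^♯` expresses `α(R(x,y)z)` through `h^K`; this is what cancels the commutator of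
  -- derivatives of `α` in the antisymmetrized formula.
  have hR := (h.normRicci_eq hq hF (hW q hq)).2 x y z (sharp (K q) (α q))
  have hr := (h.normRicci_eq hq hF (hW q hq)).1
  rw [hK.symm, ha, curvature] at hR
  simp only [ricciPart, hK.symm x (sharp (K q) (α q)), hK.symm y (sharp (K q) (α q)), ha, map_add,
    map_sub, hr y z, hr x z] at hR
  rw [cotton, cotton, h.covDerivNormRicci_eq hq hEF hF hW, h.covDerivNormRicci_eq hq hEF hF hW,
    h.smooth_form.fderiv_fderiv_symm h.isOpen hq y x, h.source.christoffel_symm hq y x,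
    hK.symm y x]
  simp only [map_add, map_smul, add_apply, FunLike.coe_smul, Pi.smul_apply, smul_eq_mul,
    normRicciL_apply]
  have hsy := h.metric.normRicci_symm (h.mapsTo hq) (fderiv 𝕜 f q y) (fderiv 𝕜 f q x)
  simp only [formHessian] at hR ⊢
  rw [hsy, h.form_closed hq y x]
  linear_combination hR

end IsConformalUmbilic

end Umbilic

/-! ### From pointwise umbilicity to smooth data `φ`, `α`, `N`; change of coordinates. -/

section LocalUmbilic

variable {𝕜 : Type*} [RCLike 𝕜]
variable {E : Type*} [NormedAddCommGroup E] [NormedSpace 𝕜 E] [FiniteDimensional 𝕜 E]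
variable {F : Type*} [NormedAddCommGroup F] [NormedSpace 𝕜 F] [FiniteDimensional 𝕜 F]
variable {G : E → E →L[𝕜] E →L[𝕜] 𝕜} {Ω : Set E} {K : F → F →L[𝕜] F →L[𝕜] 𝕜} {Ω' : Set F}
  {f : F → E} {q : F}

theorem IsCoordMetric.mono (hG : IsCoordMetric G Ω) {Ω₁ : Set E} (ho : IsOpen Ω₁) (hs : Ω₁ ⊆ Ω) :
    IsCoordMetric G Ω₁ :=
  ⟨ho, fun p hp => hG.scalar p (hs hp), hG.smooth.mono hs⟩

theorem IsSmoothInto.mono (hf : IsSmoothInto G Ω f Ω') {Ω₁ : Set F} (ho : IsOpen Ω₁)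
    (hs : Ω₁ ⊆ Ω') : IsSmoothInto G Ω f Ω₁ :=
  ⟨hf.metric, ho, hf.mapsTo.mono_left hs, hf.smooth.mono hs⟩

/-- A conformal immersion whose second fundamental form is, pointwise, a multiple of the metric,
is a conformal umbilic immersion. -/
theorem IsSmoothInto.exists_isConformalUmbilic [Nontrivial F] (hf : IsSmoothInto G Ω f Ω')
    (hK : IsCoordMetric K Ω')
    (hconf : ∀ q ∈ Ω', ∃ t : 𝕜, t ≠ 0 ∧ ∀ x y,
      G (f q) (fderiv 𝕜 f q x) (fderiv 𝕜 f q y) = t * K q x y)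
    (humb : ∀ q ∈ Ω', ∀ ν, (∀ z, G (f q) (fderiv 𝕜 f q z) ν = 0) → ∃ μ : 𝕜, ∀ x y,
      G (f q) (covAlong G f (fun q => fderiv 𝕜 f q y) q x) ν =
        μ * G (f q) (fderiv 𝕜 f q x) (fderiv 𝕜 f q y))
    (hq : q ∈ Ω') :
    ∃ Ω₁ ⊆ Ω', q ∈ Ω₁ ∧ ∃ φ α N, IsConformalUmbilic G Ω K Ω₁ f φ α N := by
  obtain ⟨x₀, hx₀⟩ := exists_ne (0 : F)
  -- The factors `t` and `μ` are given only pointwise. Dividing by `K(x₀, y₀)`, nonzero near `q`,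
  -- gives explicit formulas for `φ` and `N`, which show their smoothness.
  obtain ⟨y₀, hy₀⟩ : ∃ y₀, K q x₀ y₀ ≠ 0 := by
    by_contra! hc
    exact hx₀ ((hK.scalar q hq).nondegenerate x₀ hc)
  let k : F → 𝕜 := fun q => K q x₀ y₀
  have hk : ContDiffOn 𝕜 ∞ k Ω' :=
    (hK.smooth.clm_apply contDiffOn_const).clm_apply contDiffOn_const
  let Ω₁ : Set F := Ω' ∩ k ⁻¹' {0}ᶜ
  have ho : IsOpen Ω₁ := hk.continuousOn.isOpen_inter_preimage hf.isOpen isOpen_compl_singleton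
  have hsub : Ω₁ ⊆ Ω' := Set.inter_subset_left
  have hf₁ := hf.mono ho hsub
  have hK₁ := hK.mono ho hsub
  have hk0 : ∀ q ∈ Ω₁, k q ≠ 0 := fun q hq => hq.2
  have hdf := hf₁.contDiffOn_fderiv
  have hGf : ContDiffOn 𝕜 ∞ (fun q => G (f q)) Ω₁ :=
    hf₁.metric.smooth.comp hf₁.smooth hf₁.mapsTo
  let φ : F → 𝕜 := fun q => G (f q) (fderiv 𝕜 f q x₀) (fderiv 𝕜 f q y₀) / k q
  have hφ : ContDiffOn 𝕜 ∞ φ Ω₁ := by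
    refine ContDiffOn.div ?_ (hk.mono hsub) hk0
    exact (hGf.clm_apply (hdf.clm_apply contDiffOn_const)).clm_apply
      (hdf.clm_apply contDiffOn_const)
  have hφc : ∀ q ∈ Ω₁, φ q ≠ 0 ∧ ∀ x y,
      G (f q) (fderiv 𝕜 f q x) (fderiv 𝕜 f q y) = φ q * K q x y := by
    intro q hq
    obtain ⟨t, ht, htc⟩ := hconf q hq.1
    have : φ q = t := by
      simp only [φ, htc]
      exact mul_div_cancel_right₀ t (hk0 q hq)
    rw [this]
    exact ⟨ht, htc⟩
  let α : F → F →L[𝕜] 𝕜 := fun q => (2 * φ q)⁻¹ • fderiv 𝕜 φ q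
  have hα : ContDiffOn 𝕜 ∞ α Ω₁ := by
    refine ContDiffOn.smul ((contDiffOn_const.mul hφ).inv fun q hq =>
      mul_ne_zero two_ne_zero (hφc q hq).1) (hφ.fderiv_of_isOpen ho (by simp))
  have hφα : ∀ q ∈ Ω₁, ∀ x, fderiv 𝕜 φ q x = 2 * φ q * α q x := by
    intro q hq x
    have := (hφc q hq).1
    simp only [α, FunLike.coe_smul, Pi.smul_apply, smul_eq_mul]
    field_simp
  let B : F → F → F → E := fun x y q =>
    covAlong G f (fun q => fderiv 𝕜 f q y) q x - fderiv 𝕜 f q (christoffel K q x y)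
      - α q x • fderiv 𝕜 f q y - α q y • fderiv 𝕜 f q x
  have hB : ∀ x y, ContDiffOn 𝕜 ∞ (B x y) Ω₁ := by
    intro x y
    have h1 := hf₁.contDiffOn_covAlong (V := fun q => fderiv 𝕜 f q y)
      (hdf.clm_apply contDiffOn_const) x
    have h2 := hK₁.contDiffOn_christoffel
    have h3 : ContDiffOn 𝕜 ∞ (fun q => fderiv 𝕜 f q (christoffel K q x y)) Ω₁ :=
      hdf.clm_apply (by fun_prop)
    simp only [B]
    fun_prop
  refine ⟨Ω₁, hsub, ⟨hq, hy₀⟩, φ, α, fun q => (k q)⁻¹ • B x₀ y₀ q, ?_⟩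
  have hcov : ∀ q ∈ Ω₁, ∀ x y, B x y q = K q x y • (k q)⁻¹ • B x₀ y₀ q := by
    intro q hq x y
    have hGs := hf.metric.scalar _ (hf.mapsTo hq.1)
    have hKs := hK.scalar q hq.1
    have hk1 := hk0 q hq
    obtain ⟨hφ0, hc⟩ := hφc q hq
    have ht : ∀ x y z, G (f q) (B x y q) (fderiv 𝕜 f q z) = - (φ q * α q z * K q x y) := by
      intro x y z
      have := hf₁.koszul hK₁ hφ (fun q hq => (hφc q hq).2) hq x y z
      simp only [hφα q hq] at this
      simp only [B, map_sub, map_smul, sub_apply, FunLike.coe_smul, Pi.smul_apply, smul_eq_mul,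
        hc] at this ⊢
      linear_combination this / 2
    refine hGs.ext fun v => ?_
    -- Orthogonal projection of `v` to the tangent space, nondegenerate since `φ ≠ 0`. The
    -- tangential part is tested by the Koszul formula, the normal part by umbilicity.
    obtain ⟨z, hz⟩ : ∃ z : F, ∀ x, G (f q) (fderiv 𝕜 f q x) (v - fderiv 𝕜 f q z) = 0 := by
      refine ⟨sharp (K q) ((φ q)⁻¹ • (G (f q) v).comp (fderiv 𝕜 f q)), fun x => ?_⟩
      rw [map_sub, hc, hKs.symm x, hKs.sharp_apply]
      simp [hGs.symm v, hφ0]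
    obtain ⟨μ, hμ⟩ := humb q hq.1 _ hz
    have hn : ∀ x y, G (f q) (B x y q) (v - fderiv 𝕜 f q z) = μ * (φ q * K q x y) := by
      intro x y
      simp only [B]
      rw [← hc, ← hμ]
      simp only [map_sub (G (f q)), map_smul (G (f q)), sub_apply, FunLike.coe_smul,
        Pi.smul_apply, hz, smul_zero, sub_zero]
    have hv : ∀ x y, G (f q) (B x y q) v = μ * (φ q * K q x y) - φ q * α q z * K q x y := by
      intro x y
      have h1 := hn x y
      rw [map_sub, ht] at h1
      linear_combination h1
    simp only [map_smul, FunLike.coe_smul, Pi.smul_apply, smul_eq_mul, hv]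
    simp only [k] at hk1 ⊢
    field_simp
  exact
    { toIsSmoothInto := hf₁
      source := hK₁
      smooth_form := hα
      smooth_normal := ((hk.mono hsub).inv hk0).smul (hB x₀ y₀)
      covAlong_eq := fun q hq x y => by
        rw [← hcov q hq]
        simp only [B]
        abel
      smooth_factor := hφ
      factor_ne_zero := fun q hq => (hφc q hq).1
      fderiv_factor := hφα
      conformal := fun q hq => (hφc q hq).2 }

/-- The second fundamental form in new coordinates of source and target. -/
theorem IsIsometric.covAlong_change {G₁ : E → E →L[𝕜] E →L[𝕜] 𝕜} {Ω₁ : Set E} {T : E → E}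
    (hT : IsIsometric G₁ Ω₁ G Ω T) (hf : IsSmoothInto G Ω f Ω') {S : F → F} {Ω₂ : Set F}
    (hS : ContDiffOn 𝕜 ∞ S Ω₂) (ho : IsOpen Ω₂) (hm : Set.MapsTo S Ω₂ Ω') {r : F} (hr : r ∈ Ω₂)
    {f₁ : F → E} (hf₁ : f₁ =ᶠ[nhds r] T ∘ f ∘ S) (x y : F) :
    fderiv 𝕜 f₁ r x = fderiv 𝕜 T (f (S r)) (fderiv 𝕜 f (S r) (fderiv 𝕜 S r x)) ∧
    fderiv 𝕜 (fderiv 𝕜 f₁) r x y + christoffel G₁ (f₁ r) (fderiv 𝕜 f₁ r x) (fderiv 𝕜 f₁ r y) =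
      fderiv 𝕜 T (f (S r)) (covAlong G f (fun q => fderiv 𝕜 f q (fderiv 𝕜 S r y)) (S r)
        (fderiv 𝕜 S r x) + fderiv 𝕜 f (S r) (fderiv 𝕜 (fderiv 𝕜 S) r x y)) := by
  have h1 : ∀ r ∈ Ω₂, ∀ x, fderiv 𝕜 (f ∘ S) r x = fderiv 𝕜 f (S r) (fderiv 𝕜 S r x) := by
    intro r hr x
    rw [fderiv_comp r (hf.differentiableAt (hm hr)) (hS.differentiableAt_of_isOpen ho hr)]
    rfl
  have hfS : IsSmoothInto G Ω (f ∘ S) Ω₂ :=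
    ⟨hf.metric, ho, hf.mapsTo.comp hm, hf.smooth.comp hS hm⟩
  have hTfS : IsSmoothInto G₁ Ω₁ (T ∘ f ∘ S) Ω₂ :=
    ⟨hT.metric, ho, hT.mapsTo.comp hfS.mapsTo, hT.smooth.comp hfS.smooth hfS.mapsTo⟩
  have h2 : ∀ r ∈ Ω₂, ∀ x, fderiv 𝕜 (T ∘ f ∘ S) r x =
      fderiv 𝕜 T (f (S r)) (fderiv 𝕜 (f ∘ S) r x) := by
    intro r hr x
    rw [fderiv_comp r (hT.differentiableAt (hfS.mapsTo hr)) (hfS.differentiableAt hr)]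
    rfl
  have hev : fderiv 𝕜 f₁ =ᶠ[nhds r] fderiv 𝕜 (T ∘ f ∘ S) := hf₁.fderiv
  rw [hev.eq_of_nhds, hev.fderiv_eq, hf₁.eq_of_nhds, ← hTfS.covAlong_fderiv hr]
  refine ⟨by rw [h2 r hr, h1 r hr], ?_⟩
  have hSd := hS.differentiableAt_of_isOpen ho hr
  have hSdd : DifferentiableAt 𝕜 (fderiv 𝕜 S) r :=
    ContDiffOn.differentiableAt_of_isOpen (hS.fderiv_of_isOpen ho (m := ∞) (by simp)) ho hr
  have hd := hfS.differentiableAt_fderiv hr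
  have e1 : (fun r => fderiv 𝕜 (T ∘ f ∘ S) r y) =ᶠ[nhds r]
      fun r => fderiv 𝕜 T ((f ∘ S) r) (fderiv 𝕜 (f ∘ S) r y) :=
    Filter.mem_of_superset (ho.mem_nhds hr) fun r hr => h2 r hr y
  rw [covAlong_congr e1, hT.covAlong_comp (hfS.mapsTo hr) (hfS.differentiableAt hr)
    (V := fun r => fderiv 𝕜 (f ∘ S) r y) (by fun_prop)]
  congr 1
  have e2 : (fun r => fderiv 𝕜 (f ∘ S) r y) =ᶠ[nhds r]
      fun r => fderiv 𝕜 f (S r) (fderiv 𝕜 S r y) :=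
    Filter.mem_of_superset (ho.mem_nhds hr) fun r hr => h1 r hr y
  have hdd := hf.differentiableAt_fderiv (hm hr)
  rw [covAlong_congr e2, covAlong, hf.covAlong_fderiv (hm hr),
    fderiv_clm_apply₁ (B := fun r => fderiv 𝕜 f (S r)) (hdd.comp r hSd) (by fun_prop),
    fderiv_fun_comp r hdd hSd, fderiv_clm_apply₁ hSdd (differentiableAt_const y), h1 r hr]
  simp
  abel

end LocalUmbilic

/-! ### Transition maps between preferred charts. -/

section Charts

variable {𝕜 : Type*} [RCLike 𝕜]
variable {E : Type*} [NormedAddCommGroup E] [NormedSpace 𝕜 E]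
variable {M : Type*} [TopologicalSpace M] [ChartedSpace E M]

/-- The transition map between the preferred charts at `x₀` and `x₁`. -/
def transition (E : Type*) [NormedAddCommGroup E] {M : Type*} [TopologicalSpace M]
    [ChartedSpace E M] (x₀ x₁ : M) : E → E :=
  chartAt E x₁ ∘ (chartAt E x₀).symm

/-- The expression of a set in the preferred chart at `x₀`. -/
def coordSet (E : Type*) [NormedAddCommGroup E] {M : Type*} [TopologicalSpace M]
    [ChartedSpace E M] (x₀ : M) (U : Set M) : Set E :=
  (chartAt E x₀).target ∩ (chartAt E x₀).symm ⁻¹' U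

theorem isOpen_coordSet (x₀ : M) {U : Set M} (hU : IsOpen U) : IsOpen (coordSet E x₀ U) :=
  (chartAt E x₀).isOpen_inter_preimage_symm hU

theorem chartAt_mem_coordSet {x₀ x : M} {U : Set M} (hx : x ∈ (chartAt E x₀).source) (hU : x ∈ U) :
    chartAt E x₀ x ∈ coordSet E x₀ U :=
  ⟨(chartAt E x₀).map_source hx, by rwa [Set.mem_preimage, (chartAt E x₀).left_inv hx]⟩

theorem chartAt_symm_transition {x₀ x₁ : M} {p : E}
    (hp : p ∈ coordSet E x₀ (chartAt E x₁).source) :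
    (chartAt E x₁).symm (transition E x₀ x₁ p) = (chartAt E x₀).symm p :=
  (chartAt E x₁).left_inv hp.2

theorem mapsTo_transition (x₀ x₁ : M) (U : Set M) :
    Set.MapsTo (transition E x₀ x₁) (coordSet E x₀ ((chartAt E x₁).source ∩ U))
      (coordSet E x₁ U) :=
  fun _ hp => chartAt_mem_coordSet hp.2.1 hp.2.2

variable [IsManifold 𝓘(𝕜, E) ∞ M]

theorem contDiffOn_transition (x₀ x₁ : M) :
    ContDiffOn 𝕜 ∞ (transition E x₀ x₁) (coordSet E x₀ (chartAt E x₁).source) := by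
  rw [← contMDiffOn_iff_contDiffOn]
  exact (contMDiffOn_chart (I := 𝓘(𝕜, E)) (x := x₁)).comp
    ((contMDiffOn_chart_symm (I := 𝓘(𝕜, E)) (x := x₀)).mono Set.inter_subset_left) fun _ hp => hp.2

theorem mdifferentiableAt_chartAt_symm (x₀ : M) {p : E} (hp : p ∈ (chartAt E x₀).target) :
    MDifferentiableAt 𝓘(𝕜, E) 𝓘(𝕜, E) (chartAt E x₀).symm p :=
  ((contMDiffOn_chart_symm (I := 𝓘(𝕜, E)) (n := ∞) (x := x₀)).contMDiffAt
    ((chartAt E x₀).open_target.mem_nhds hp)).mdifferentiableAt (by simp)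

theorem transition_differentiableAt {x₀ x₁ : M} {p : E}
    (hp : p ∈ coordSet E x₀ (chartAt E x₁).source) :
    DifferentiableAt 𝕜 (transition E x₀ x₁) p :=
  (contDiffOn_transition x₀ x₁).differentiableAt_of_isOpen
    (isOpen_coordSet _ (chartAt E x₁).open_source) hp

theorem transition_mem {x₀ x₁ : M} {p : E} (hp : p ∈ coordSet E x₀ (chartAt E x₁).source) :
    transition E x₀ x₁ p ∈ coordSet E x₁ (chartAt E x₀).source :=
  mapsTo_transition x₀ x₁ _ ⟨hp.1, hp.2, (chartAt E x₀).map_target hp.1⟩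

theorem transition_transition {x₀ x₁ : M} {p : E} (hp : p ∈ coordSet E x₀ (chartAt E x₁).source) :
    transition E x₁ x₀ (transition E x₀ x₁ p) = p := by
  rw [transition, Function.comp_apply, chartAt_symm_transition hp, (chartAt E x₀).right_inv hp.1]

theorem fderiv_transition_comp {x₀ x₁ : M} {p : E}
    (hp : p ∈ coordSet E x₀ (chartAt E x₁).source) :
    (fderiv 𝕜 (transition E x₁ x₀) (transition E x₀ x₁ p)).comp
      (fderiv 𝕜 (transition E x₀ x₁) p) = ContinuousLinearMap.id 𝕜 E := by
  rw [← fderiv_comp p (transition_differentiableAt (transition_mem hp))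
    (transition_differentiableAt hp), ← fderiv_id (𝕜 := 𝕜) (x := p)]
  refine Filter.EventuallyEq.fderiv_eq ?_
  filter_upwards [(isOpen_coordSet x₀ (chartAt E x₁).open_source).mem_nhds hp] with q hq
  exact transition_transition hq

theorem isInvertible_fderiv_transition {x₀ x₁ : M} {p : E}
    (hp : p ∈ coordSet E x₀ (chartAt E x₁).source) :
    (fderiv 𝕜 (transition E x₀ x₁) p).IsInvertible := by
  refine ContinuousLinearMap.IsInvertible.of_inverse
    (g := fderiv 𝕜 (transition E x₁ x₀) (transition E x₀ x₁ p)) ?_ (fderiv_transition_comp hp)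
  have := fderiv_transition_comp (𝕜 := 𝕜) (transition_mem hp)
  rwa [transition_transition hp] at this

/-- The tangent space at a point is read in the preferred chart of that same point, so the
differential of an inverse chart is that of a transition map whose target chart varies with `p`. -/
theorem dChartSymm_eq_fderiv {x₀ : M} {p : E} (hp : p ∈ (chartAt E x₀).target) :
    dChartSymm 𝕜 x₀ p = fderiv 𝕜 (transition E x₀ ((chartAt E x₀).symm p)) p := by
  have h := (mdifferentiableAt_chartAt_symm (𝕜 := 𝕜) x₀ hp).mfderiv
  simp only [writtenInExtChartAt, mfld_simps, fderivWithin_univ] at h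
  exact h

theorem dChartSymm_self (x₀ : M) :
    dChartSymm 𝕜 x₀ (chartAt E x₀ x₀) = ContinuousLinearMap.id 𝕜 E := by
  rw [dChartSymm_eq_fderiv (mem_chart_target E x₀),
    (chartAt E x₀).left_inv (mem_chart_source E x₀), ← fderiv_id (𝕜 := 𝕜) (x := chartAt E x₀ x₀)]
  refine Filter.EventuallyEq.fderiv_eq ?_
  filter_upwards [(chartAt E x₀).open_target.mem_nhds (mem_chart_target E x₀)] with q hq
  exact (chartAt E x₀).right_inv hq

theorem isInvertible_dChartSymm {x₀ : M} {p : E} (hp : p ∈ (chartAt E x₀).target) :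
    (dChartSymm 𝕜 x₀ p).IsInvertible := by
  rw [dChartSymm_eq_fderiv hp]
  exact isInvertible_fderiv_transition ⟨hp, mem_chart_source E _⟩

theorem dChartSymm_transition {x₀ x₁ : M} {p : E}
    (hp : p ∈ coordSet E x₀ (chartAt E x₁).source) (x : E) :
    dChartSymm 𝕜 x₁ (transition E x₀ x₁ p) (fderiv 𝕜 (transition E x₀ x₁) p x) =
      dChartSymm 𝕜 x₀ p x := by
  have h : (chartAt E x₀).symm =ᶠ[nhds p] (chartAt E x₁).symm ∘ transition E x₀ x₁ := by
    filter_upwards [(isOpen_coordSet x₀ (chartAt E x₁).open_source).mem_nhds hp] with q hq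
    exact (chartAt_symm_transition hq).symm
  have h1 := mfderiv_comp p (mdifferentiableAt_chartAt_symm (𝕜 := 𝕜) x₁ (transition_mem hp).1)
    (transition_differentiableAt hp).mdifferentiableAt
  rw [mfderiv_eq_fderiv] at h1
  have h2 : dChartSymm 𝕜 x₀ p = mfderiv 𝓘(𝕜, E) 𝓘(𝕜, E)
    ((chartAt E x₁).symm ∘ transition E x₀ x₁) p := h.mfderiv_eq
  rw [h2, h1]
  rfl

end Charts

/-! ### Metrics, Weyl tensor and volume form in a fixed chart. -/

section MetricsInCharts

variable {𝕜 : Type*} [RCLike 𝕜]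
variable {E : Type*} [NormedAddCommGroup E] [NormedSpace 𝕜 E] [FiniteDimensional 𝕜 E]
variable {M : Type*} [TopologicalSpace M] [ChartedSpace E M] [IsManifold 𝓘(𝕜, E) ∞ M]
variable {g : M → E →L[𝕜] E →L[𝕜] 𝕜} {U : Set M}

theorem coordForm_apply (g : M → E →L[𝕜] E →L[𝕜] 𝕜) (x₀ : M) (p u v : E) :
    coordForm g x₀ p u v =
      g ((chartAt E x₀).symm p) (dChartSymm 𝕜 x₀ p u) (dChartSymm 𝕜 x₀ p v) := rfl

theorem coordForm_self (g : M → E →L[𝕜] E →L[𝕜] 𝕜) (x : M) :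
    coordForm g x (chartAt E x x) = g x := by
  ext u v
  rw [coordForm_apply, dChartSymm_self, (chartAt E x).left_inv (mem_chart_source E x)]
  rfl

namespace IsMetricOn

theorem isScalarProduct (hg : IsMetricOn g U) {x : M} (hx : x ∈ U) : IsScalarProduct (g x) :=
  ⟨hg.symm x hx, hg.nondegenerate x hx⟩

theorem isCoordMetric (hg : IsMetricOn g U) (x₀ : M) :
    IsCoordMetric (coordForm g x₀) (coordSet E x₀ U) where
  isOpen := isOpen_coordSet x₀ hg.isOpen
  scalar p hp := by
    obtain ⟨L, hL⟩ := isInvertible_dChartSymm (𝕜 := 𝕜) hp.1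
    exact (hg.isScalarProduct hp.2).pullback _ (hL ▸ L.bijective)
  smooth := hg.smooth x₀

theorem isIsometric_transition (hg : IsMetricOn g U) (x₀ x₁ : M) :
    IsIsometric (coordForm g x₁) (coordSet E x₁ U) (coordForm g x₀)
      (coordSet E x₀ ((chartAt E x₁).source ∩ U)) (transition E x₀ x₁) where
  metric := hg.isCoordMetric x₁
  isOpen := isOpen_coordSet x₀ ((chartAt E x₁).open_source.inter hg.isOpen)
  mapsTo := mapsTo_transition x₀ x₁ U
  smooth := (contDiffOn_transition x₀ x₁).mono fun _ hp => ⟨hp.1, hp.2.1⟩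
  source := (hg.isCoordMetric x₀).mono
    (isOpen_coordSet x₀ ((chartAt E x₁).open_source.inter hg.isOpen)) fun _ hp => ⟨hp.1, hp.2.2⟩
  invertible _ hp := isInvertible_fderiv_transition ⟨hp.1, hp.2.1⟩
  isometric p hp x y := by
    have hp' : p ∈ coordSet E x₀ (chartAt E x₁).source := ⟨hp.1, hp.2.1⟩
    rw [coordForm_apply, coordForm_apply, chartAt_symm_transition hp', dChartSymm_transition hp',
      dChartSymm_transition hp']

/-- `weylAt` uses a different chart at each point; naturality under the isometric transition brings
it back to the chart at `x₀`. -/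
theorem weylAt_dChartSymm (hg : IsMetricOn g U) (hn : 3 ≤ Module.finrank 𝕜 E) {x₀ : M} {p : E}
    (hp : p ∈ coordSet E x₀ U) (u v w z : E) :
    weylAt g ((chartAt E x₀).symm p) (dChartSymm 𝕜 x₀ p u) (dChartSymm 𝕜 x₀ p v)
      (dChartSymm 𝕜 x₀ p w) (dChartSymm 𝕜 x₀ p z) = weyl (coordForm g x₀) p u v w z := by
  rw [dChartSymm_eq_fderiv hp.1]
  exact (hg.isIsometric_transition x₀ ((chartAt E x₀).symm p)).weyl_eq hn
    ⟨hp.1, mem_chart_source E _, hp.2⟩ u v w z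

end IsMetricOn

namespace Orientation

variable {c : ConformalStructure 𝕜 E M}

/-- The volume form of a local metric in the preferred chart at `x₀`. -/
def coordVol (o : Orientation c) (g : M → E →L[𝕜] E →L[𝕜] 𝕜) (x₀ : M) (p : E) :
    E [⋀^Fin 4]→L[𝕜] 𝕜 :=
  (o.vol ((chartAt E x₀).symm p) (g ((chartAt E x₀).symm p))).compContinuousLinearMap
    (dChartSymm 𝕜 x₀ p)

theorem coordVol_apply (o : Orientation c) (x₀ : M) (p : E) (e : Fin 4 → E) :
    o.coordVol g x₀ p e = o.vol ((chartAt E x₀).symm p) (g ((chartAt E x₀).symm p))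
      (fun i => dChartSymm 𝕜 x₀ p (e i)) := rfl

theorem coordVol_self (o : Orientation c) (g : M → E →L[𝕜] E →L[𝕜] 𝕜) (x : M) :
    o.coordVol g x (chartAt E x x) = o.vol x (g x) := by
  ext e
  rw [coordVol_apply, dChartSymm_self, (chartAt E x).left_inv (mem_chart_source E x)]
  rfl

theorem coordVol_sq (o : Orientation c) (hg : c.IsLocalMetric g U) {x₀ : M} {p : E}
    (hp : p ∈ coordSet E x₀ U) (e : Fin 4 → E) :
    o.coordVol g x₀ p e ^ 2 = (Matrix.of fun i j => coordForm g x₀ p (e i) (e j)).det := by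
  rw [coordVol_apply, o.vol_sq _ _ (hg.mem_line _ hp.2)]
  rfl

theorem differentiableAt_coordVol (o : Orientation c) (hg : c.IsLocalMetric g U) {x₀ : M} {p : E}
    (hp : p ∈ coordSet E x₀ U) : DifferentiableAt 𝕜 (o.coordVol g x₀) p :=
  ContDiffOn.differentiableAt_of_isOpen (o.smooth g U hg x₀)
    (isOpen_coordSet x₀ hg.isMetricOn.isOpen) hp

/-- Puts self-duality into one chart on an open set, the form in which it can be differentiated. -/
theorem IsSelfDual.hodge_weyl {o : Orientation c} (ho : o.IsSelfDual) (hg : c.IsLocalMetric g U)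
    (hn : 3 ≤ Module.finrank 𝕜 E) {x₀ : M} {p : E} (hp : p ∈ coordSet E x₀ U) (u v w z : E) :
    hodge (coordForm g x₀ p) (o.coordVol g x₀ p)
      (fun u v => weyl (coordForm g x₀) p u v w z) u v = weyl (coordForm g x₀) p u v w z := by
  obtain ⟨L, hL⟩ := isInvertible_dChartSymm (𝕜 := 𝕜) hp.1
  have hL' : ∀ u, L u = dChartSymm 𝕜 x₀ p u := fun u => by rw [← hL]; rfl
  let x := (chartAt E x₀).symm p
  have h : 2⁻¹ * (weylAt g x (L u) (L v) (L w) (L z) - hodge (g x) (o.vol x (g x))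
      (fun u v => weylAt g x u v (L w) (L z)) (L u) (L v)) = 0 :=
    ho g U hg x hp.2 (L u) (L v) (L w) (L z)
  have hW : ∀ u v w z, weylAt g x (L u) (L v) (L w) (L z) = weyl (coordForm g x₀) p u v w z := by
    intro u v w z
    rw [hL', hL', hL', hL']
    exact hg.isMetricOn.weylAt_dChartSymm hn hp u v w z
  rw [hodge_map (α := fun u v => weylAt g x u v (L w) (L z)) L
    ((hg.isMetricOn.isCoordMetric x₀).scalar p hp) (hg.isMetricOn.isScalarProduct hp.2)
    (vol := o.coordVol g x₀ p) (fun u v => by rw [hL', hL']; rfl)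
    (fun e => by simp only [hL']; rfl)
    (weylForm (coordForm g x) (chartAt E x x) (L w) (L z)) (fun _ _ => rfl)] at h
  simp only [hW] at h
  have := (mul_eq_zero.mp h).resolve_left (by norm_num)
  exact (sub_eq_zero.mp this).symm

/-- Since `*C = C`, the average of `C` and `*C` is `C`. -/
theorem IsSelfDual.cottonPlusAt_eq {o : Orientation c} (ho : o.IsSelfDual)
    (hg : c.IsLocalMetric g U) (hE : Module.finrank 𝕜 E = 4) {x : M} (hx : x ∈ U) (u v w : E) :
    o.cottonPlusAt g x u v w = cottonAt g x u v w := by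
  have hp := chartAt_mem_coordSet (mem_chart_source E x) hx
  have h := (hg.isMetricOn.isCoordMetric x).cotton_selfDual hE hp
    (o.differentiableAt_coordVol hg hp) (fun q hq e => o.coordVol_sq hg hq e)
    (fun q hq u v w z => ho.hodge_weyl hg (by omega) hq u v w z) u v w
  rw [coordForm_self, coordVol_self] at h
  have h' : hodge (g x) (o.vol x (g x)) (fun u' v' => cottonAt g x u' v' w) u v =
    cottonAt g x u v w := h
  change 2⁻¹ * (cottonAt g x u v w + hodge (g x) (o.vol x (g x))
    (fun u' v' => cottonAt g x u' v' w) u v) = cottonAt g x u v w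
  rw [h']
  ring

end Orientation

end MetricsInCharts

/-! ### The immersion in charts. -/

section ImmersionsInCharts

variable {𝕜 : Type*} [RCLike 𝕜]
variable {E : Type*} [NormedAddCommGroup E] [NormedSpace 𝕜 E] [FiniteDimensional 𝕜 E]
variable {M : Type*} [TopologicalSpace M] [ChartedSpace E M] [IsManifold 𝓘(𝕜, E) ∞ M]
variable {F : Type*} [NormedAddCommGroup F] [NormedSpace 𝕜 F] [FiniteDimensional 𝕜 F]
variable {Q : Type*} [TopologicalSpace Q] [ChartedSpace F Q] [IsManifold 𝓘(𝕜, F) ∞ Q]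
variable {g : M → E →L[𝕜] E →L[𝕜] 𝕜} {U : Set M} {ι : Q → M} {y : Q} {q : F}

theorem mfderiv_eq_fderiv_inCharts (hι : ContMDiff 𝓘(𝕜, F) 𝓘(𝕜, E) ∞ ι) (y : Q) (x : F) :
    (mfderiv 𝓘(𝕜, F) 𝓘(𝕜, E) ι y : F →L[𝕜] E) x =
      fderiv 𝕜 (inCharts E ι y) (chartAt F y y) x := by
  have h := ((hι y).mdifferentiableAt (by simp)).mfderiv
  simp only [writtenInExtChartAt, mfld_simps, fderivWithin_univ] at h
  exact congrArg (fun A : F →L[𝕜] E => A x) h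

/-- The part of the preferred chart at `y` that `ι` maps to `U` and to the preferred chart at
`ι y`. -/
def immersionDomain (E : Type*) [NormedAddCommGroup E] {M : Type*} [TopologicalSpace M]
    [ChartedSpace E M] {F : Type*} [NormedAddCommGroup F] {Q : Type*} [TopologicalSpace Q]
    [ChartedSpace F Q] (ι : Q → M) (U : Set M) (y : Q) : Set F :=
  coordSet F y (ι ⁻¹' ((chartAt E (ι y)).source ∩ U))

theorem isOpen_immersionDomain (hι : ContMDiff 𝓘(𝕜, F) 𝓘(𝕜, E) ∞ ι) (hU : IsOpen U) (y : Q) :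
    IsOpen (immersionDomain E (F := F) ι U y) :=
  isOpen_coordSet y (((chartAt E (ι y)).open_source.inter hU).preimage hι.continuous)

theorem chartAt_symm_inCharts (hq : q ∈ immersionDomain E ι U y) :
    (chartAt E (ι y)).symm (inCharts E ι y q) = ι ((chartAt F y).symm q) :=
  (chartAt E (ι y)).left_inv hq.2.1

theorem mapsTo_inCharts : Set.MapsTo (inCharts E (F := F) ι y) (immersionDomain E ι U y)
    (coordSet E (ι y) U) :=
  fun _ hq => chartAt_mem_coordSet hq.2.1 hq.2.2

theorem contDiffOn_inCharts (hι : ContMDiff 𝓘(𝕜, F) 𝓘(𝕜, E) ∞ ι) :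
    ContDiffOn 𝕜 ∞ (inCharts E (F := F) ι y) (immersionDomain E ι U y) := by
  rw [← contMDiffOn_iff_contDiffOn]
  exact (contMDiffOn_chart (I := 𝓘(𝕜, E)) (x := ι y)).comp (hι.comp_contMDiffOn
    ((contMDiffOn_chart_symm (I := 𝓘(𝕜, F)) (x := y)).mono Set.inter_subset_left))
    fun _ hq => hq.2.1

theorem IsMetricOn.isSmoothInto (hg : IsMetricOn g U) (hι : ContMDiff 𝓘(𝕜, F) 𝓘(𝕜, E) ∞ ι)
    (y : Q) : IsSmoothInto (coordForm g (ι y)) (coordSet E (ι y) U) (inCharts E (F := F) ι y)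
      (immersionDomain E ι U y) where
  metric := hg.isCoordMetric _
  isOpen := isOpen_immersionDomain hι hg.isOpen y
  mapsTo := mapsTo_inCharts
  smooth := contDiffOn_inCharts hι

/-- The chain rule on both sides of the commuting square formed by `ι`, its coordinate expression
and the two inverse charts. -/
theorem dChartSymm_inCharts (hι : ContMDiff 𝓘(𝕜, F) 𝓘(𝕜, E) ∞ ι) (hU : IsOpen U)
    (hq : q ∈ immersionDomain E ι U y) (x : F) :
    dChartSymm 𝕜 (ι y) (inCharts E ι y q) (fderiv 𝕜 (inCharts E ι y) q x) =
      (mfderiv 𝓘(𝕜, F) 𝓘(𝕜, E) ι ((chartAt F y).symm q) : F →L[𝕜] E) (dChartSymm 𝕜 y q x) := by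
  have ho := isOpen_immersionDomain (𝕜 := 𝕜) (E := E) (F := F) hι hU y
  have h : (chartAt E (ι y)).symm ∘ inCharts E ι y =ᶠ[nhds q] ι ∘ (chartAt F y).symm := by
    filter_upwards [ho.mem_nhds hq] with p hp
    exact chartAt_symm_inCharts hp
  have h1 := mfderiv_comp q (mdifferentiableAt_chartAt_symm (𝕜 := 𝕜) (ι y) (mapsTo_inCharts hq).1)
    ((contDiffOn_inCharts (𝕜 := 𝕜) hι).differentiableAt_of_isOpen ho hq).mdifferentiableAt
  have h2 := mfderiv_comp q ((hι ((chartAt F y).symm q)).mdifferentiableAt (by simp))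
    (mdifferentiableAt_chartAt_symm (𝕜 := 𝕜) y hq.1)
  rw [mfderiv_eq_fderiv] at h1
  have h3 : (mfderiv 𝓘(𝕜, F) 𝓘(𝕜, E) ((chartAt E (ι y)).symm ∘ inCharts E ι y) q : F →L[𝕜] E) =
    mfderiv 𝓘(𝕜, F) 𝓘(𝕜, E) (ι ∘ (chartAt F y).symm) q := h.mfderiv_eq
  exact congrArg (fun A : F →L[𝕜] E => A x) (h1.symm.trans (h3.trans h2))

/-- The restriction of a metric to the immersed manifold, in charts. -/
theorem coordForm_inCharts (hι : ContMDiff 𝓘(𝕜, F) 𝓘(𝕜, E) ∞ ι) (hU : IsOpen U)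
    (hq : q ∈ immersionDomain E ι U y) (x z : F) :
    coordForm g (ι y) (inCharts E ι y q) (fderiv 𝕜 (inCharts E ι y) q x)
      (fderiv 𝕜 (inCharts E ι y) q z) =
    restrictForm ι ((chartAt F y).symm q) (g (ι ((chartAt F y).symm q))) (dChartSymm 𝕜 y q x)
      (dChartSymm 𝕜 y q z) := by
  rw [coordForm_apply, dChartSymm_inCharts hι hU hq, dChartSymm_inCharts hι hU hq,
    chartAt_symm_inCharts hq]
  rfl

theorem IsMetricOn.mono (hg : IsMetricOn g U) {U' : Set M} (ho : IsOpen U') (h : U' ⊆ U) :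
    IsMetricOn g U' where
  isOpen := ho
  symm x hx := hg.symm x (h hx)
  nondegenerate x hx := hg.nondegenerate x (h hx)
  smooth x₀ := (hg.smooth x₀).mono fun _ hp => ⟨hp.1, h hp.2⟩

/-- The covariant derivative along `ι`, in a chart at a nearby point. -/
theorem covDerivAlong_eq (hι : ContMDiff 𝓘(𝕜, F) 𝓘(𝕜, E) ∞ ι) (hg : IsMetricOn g U)
    (hq : q ∈ immersionDomain E ι U y) (x z : F) : ∃ v : F,
    covDerivAlong g ι ((chartAt F y).symm q) (dChartSymm 𝕜 y q x) (dChartSymm 𝕜 y q z) =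
      dChartSymm 𝕜 (ι y) (inCharts E ι y q)
        (covAlong (coordForm g (ι y)) (inCharts E ι y)
          (fun q => fderiv 𝕜 (inCharts E ι y) q z) q x + fderiv 𝕜 (inCharts E ι y) q v) := by
  set y' := (chartAt F y).symm q with hy'
  have hy'_mem : y' ∈ (chartAt F y).source := (chartAt F y).map_target hq.1
  let U' := (chartAt E (ι y')).source ∩ U
  have hg' : IsMetricOn g U' :=
    hg.mono ((chartAt E (ι y')).open_source.inter hg.isOpen) Set.inter_subset_right
  have hf := hg'.isSmoothInto (F := F) hι y
  have hq' : q ∈ immersionDomain E ι U' y := ⟨hq.1, hq.2.1, mem_chart_source E (ι y'), hq.2.2⟩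
  let B := (chartAt F y).source ∩ ι ⁻¹' ((chartAt E (ι y)).source ∩ U')
  have hB : IsOpen B := (chartAt F y).open_source.inter
    (((chartAt E (ι y)).open_source.inter hg'.isOpen).preimage hι.continuous)
  let r := chartAt F y' y'
  have hr : r ∈ coordSet F y' B :=
    chartAt_mem_coordSet (mem_chart_source F y') ⟨hy'_mem, hq'.2⟩
  have hSr : transition F y' y r = q := by
    simp only [transition, Function.comp_apply, r, (chartAt F y').left_inv (mem_chart_source F y')]
    exact (chartAt F y).right_inv hq.1
  have hf₁ : inCharts E ι y' =ᶠ[nhds r]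
      transition E (ι y) (ι y') ∘ inCharts E ι y ∘ transition F y' y := by
    filter_upwards [(isOpen_coordSet y' hB).mem_nhds hr] with p hp
    simp only [transition, inCharts, Function.comp_apply]
    rw [(chartAt F y).left_inv hp.2.1, (chartAt E (ι y)).left_inv hp.2.2.1]
  have h := ((hg.isIsometric_transition (ι y) (ι y')).covAlong_change hf
    ((contDiffOn_transition (𝕜 := 𝕜) y' y).mono fun _ hp => ⟨hp.1, hp.2.1⟩)
    (isOpen_coordSet y' hB) (mapsTo_transition y' y _) hr hf₁
    (dChartSymm 𝕜 y q x) (dChartSymm 𝕜 y q z)).2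
  have hS : ∀ x, fderiv 𝕜 (transition F y' y) r (dChartSymm 𝕜 y q x) = x := by
    intro x
    have hqt : q ∈ coordSet F y (chartAt F y').source := ⟨hq.1, mem_chart_source F y'⟩
    have := fderiv_transition_comp (𝕜 := 𝕜) hqt
    rw [dChartSymm_eq_fderiv hq.1]
    exact congrArg (fun A : F →L[𝕜] F => A x) this
  have hT : dChartSymm 𝕜 (ι y) (inCharts E ι y q) =
      fderiv 𝕜 (transition E (ι y) (ι y')) (inCharts E ι y q) := by
    rw [dChartSymm_eq_fderiv (mapsTo_inCharts hq).1, chartAt_symm_inCharts hq]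
  rw [hS, hS, hSr, ← hT] at h
  -- The witness is the second derivative of the change of chart on `Q`: fields constant in one
  -- chart are not constant in the other. The resulting error is tangent to `Q`.
  exact ⟨_, h⟩

end ImmersionsInCharts

/-! ### Umbilic hypersurfaces of self-dual manifolds. -/

section Umbilic

variable {𝕜 : Type*} [RCLike 𝕜]
variable {E : Type*} [NormedAddCommGroup E] [NormedSpace 𝕜 E] [FiniteDimensional 𝕜 E]
variable {M : Type*} [TopologicalSpace M] [ChartedSpace E M] [IsManifold 𝓘(𝕜, E) ∞ M]
variable {F : Type*} [NormedAddCommGroup F] [NormedSpace 𝕜 F] [FiniteDimensional 𝕜 F]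
variable {Q : Type*} [TopologicalSpace Q] [ChartedSpace F Q] [IsManifold 𝓘(𝕜, F) ∞ Q]
variable {c : ConformalStructure 𝕜 E M} {g : M → E →L[𝕜] E →L[𝕜] 𝕜} {U : Set M} {ι : Q → M}
  {k : Q → F →L[𝕜] F →L[𝕜] 𝕜} {V : Set Q} {y : Q} {q : F}

theorem ConformalStructure.IsLocalMetric.line_eq [Nontrivial E] (hg : c.IsLocalMetric g U) {x : M}
    (hx : x ∈ U) : c.line x = Submodule.span 𝕜 {g x} := by
  obtain ⟨U', g', hx', -, h⟩ := c.exists_metric x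
  have hgx := hg.mem_line x hx
  rw [h x hx', Submodule.mem_span_singleton] at hgx
  obtain ⟨a, ha⟩ := hgx
  have ha0 : a ≠ 0 := by
    rintro rfl
    obtain ⟨u, hu⟩ := exists_ne (0 : E)
    exact hu (hg.isMetricOn.nondegenerate x hx u fun v => by simp [← ha])
  rw [h x hx', ← ha, Submodule.span_singleton_smul_eq (IsUnit.mk0 a ha0)]

/-- Supplies the pointwise conformal factor between the induced metric and an arbitrary metric of
the class on `Q`. -/
theorem ConformalStructure.IsInducedLocalMetric.exists_eq_smul [Nontrivial E] [Nontrivial F]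
    (hk : c.IsInducedLocalMetric ι k V) (hg : c.IsLocalMetric g U) (hy : y ∈ V) (hyU : ι y ∈ U) :
    ∃ t : 𝕜, t ≠ 0 ∧ restrictForm ι y (g (ι y)) = t • k y := by
  obtain ⟨b, hb, hkb⟩ := hk.mem_restrict y hy
  rw [hg.line_eq hyU, Submodule.mem_span_singleton] at hb
  obtain ⟨a, rfl⟩ := hb
  have h : k y = a • restrictForm ι y (g (ι y)) := by
    rw [hkb]
    rfl
  have ha : a ≠ 0 := by
    rintro rfl
    obtain ⟨u, hu⟩ := exists_ne (0 : F)
    exact hu (hk.isMetricOn.nondegenerate y hy u fun v => by simp [h])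
  exact ⟨a⁻¹, inv_ne_zero ha, by rw [h, smul_smul, inv_mul_cancel₀ ha, one_smul]⟩

/-- Umbilicity, in charts. -/
theorem ConformalStructure.IsUmbilic.exists_covAlong_eq (humb : c.IsUmbilic (F := F) ι)
    (hι : ContMDiff 𝓘(𝕜, F) 𝓘(𝕜, E) ∞ ι) (hg : c.IsLocalMetric g U)
    (hq : q ∈ immersionDomain E ι U y) {ν : E}
    (hν : ∀ z, coordForm g (ι y) (inCharts E ι y q) (fderiv 𝕜 (inCharts E ι y) q z) ν = 0) :
    ∃ μ : 𝕜, ∀ x z, coordForm g (ι y) (inCharts E ι y q)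
      (covAlong (coordForm g (ι y)) (inCharts E ι y)
        (fun q => fderiv 𝕜 (inCharts E ι y) q z) q x) ν =
      μ * coordForm g (ι y) (inCharts E ι y q) (fderiv 𝕜 (inCharts E ι y) q x)
        (fderiv 𝕜 (inCharts E ι y) q z) := by
  have hU := hg.isMetricOn.isOpen
  have hgν : ∀ v, g (ι ((chartAt F y).symm q)) (dChartSymm 𝕜 (ι y) (inCharts E ι y q) v)
      (dChartSymm 𝕜 (ι y) (inCharts E ι y q) ν) =
      coordForm g (ι y) (inCharts E ι y q) v ν := fun v => by
    rw [coordForm_apply, chartAt_symm_inCharts hq]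
  obtain ⟨L, hL⟩ := isInvertible_dChartSymm (𝕜 := 𝕜) hq.1
  obtain ⟨μ, hμ⟩ := humb g U hg ((chartAt F y).symm q) hq.2.2
    (dChartSymm 𝕜 (ι y) (inCharts E ι y q) ν) fun Z => by
      obtain ⟨z, rfl⟩ := L.surjective Z
      have h := (hgν _).trans (hν z)
      rw [dChartSymm_inCharts hι hU hq, ← hL] at h
      exact h
  refine ⟨μ, fun x z => ?_⟩
  obtain ⟨v, hv⟩ := covDerivAlong_eq hι hg.isMetricOn hq x z
  have h := hμ (dChartSymm 𝕜 y q x) (dChartSymm 𝕜 y q z)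
  -- The tangential error `df(v)` is orthogonal to `ν`.
  rw [hv, hgν, ← coordForm_inCharts hι hU hq, map_add, add_apply, hν, add_zero] at h
  exact h

/-- The Cotton-York tensor of a self-dual conformal `4`-manifold restricts to the one of an umbilic
hypersurface. -/
theorem Orientation.IsSelfDual.cottonAt_umbilic {o : Orientation c} (hsd : o.IsSelfDual)
    (hE : Module.finrank 𝕜 E = 4) (hF : Module.finrank 𝕜 F = 3)
    (hs : ContMDiff 𝓘(𝕜, F) 𝓘(𝕜, E) ∞ ι) (humb : c.IsUmbilic (F := F) ι)
    (hg : c.IsLocalMetric g U) (hk : c.IsInducedLocalMetric ι k V) (hyU : ι y ∈ U) (hyV : y ∈ V)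
    (x z w : F) :
    cottonAt g (ι y) ((mfderiv 𝓘(𝕜, F) 𝓘(𝕜, E) ι y : F →L[𝕜] E) x)
      ((mfderiv 𝓘(𝕜, F) 𝓘(𝕜, E) ι y : F →L[𝕜] E) z)
      ((mfderiv 𝓘(𝕜, F) 𝓘(𝕜, E) ι y : F →L[𝕜] E) w) = cottonAt k y x z w := by
  have : Nontrivial E := Module.nontrivial_of_finrank_pos (R := 𝕜) (by omega)
  have : Nontrivial F := Module.nontrivial_of_finrank_pos (R := 𝕜) (by omega)
  have hU := hg.isMetricOn.isOpen
  let Ω' : Set F := immersionDomain E ι U y ∩ coordSet F y V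
  have hΩ : IsOpen Ω' :=
    (isOpen_immersionDomain hs hU y).inter (isOpen_coordSet y hk.isMetricOn.isOpen)
  have hq : chartAt F y y ∈ Ω' :=
    ⟨chartAt_mem_coordSet (mem_chart_source F y) ⟨mem_chart_source E (ι y), hyU⟩,
      chartAt_mem_coordSet (mem_chart_source F y) hyV⟩
  obtain ⟨Ω₁, hsub, hq₁, φ, α, N, h⟩ :=
    ((hg.isMetricOn.isSmoothInto hs y).mono hΩ Set.inter_subset_left).exists_isConformalUmbilic
      ((hk.isMetricOn.isCoordMetric y).mono hΩ Set.inter_subset_right)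
      (fun q hq => by
        obtain ⟨t, ht, h⟩ := hk.exists_eq_smul hg hq.2.2 hq.1.2.2
        refine ⟨t, ht, fun x z => ?_⟩
        rw [coordForm_inCharts hs hU hq.1, h]
        rfl)
      (fun q hq ν hν => humb.exists_covAlong_eq hs hg hq.1 hν) hq
  -- The vanishing of `W` on tangent vectors is needed on all of `Ω₁`, because the formula for `h^K`
  -- gets differentiated.
  have hC := h.cotton_eq hq₁ (by omega) (by omega) (fun q hq => h.weyl_tangent hq hE hF
    fun u v w z => hsd.hodge_weyl hg (by omega) (h.mapsTo hq) u v w z) x z w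
  have hf : inCharts E ι y (chartAt F y y) = chartAt E (ι y) (ι y) := by
    rw [inCharts, Function.comp_apply, Function.comp_apply,
      (chartAt F y).left_inv (mem_chart_source F y)]
  rw [hf] at hC
  rw [mfderiv_eq_fderiv_inCharts hs, mfderiv_eq_fderiv_inCharts hs,
    mfderiv_eq_fderiv_inCharts hs]
  exact hC

end Umbilic

end ConformalGeometry

end

theorem corollary4 {𝕜 : Type*} [RCLike 𝕜]
    {E : Type*} [NormedAddCommGroup E] [NormedSpace 𝕜 E] [FiniteDimensional 𝕜 E]
    (hE : Module.finrank 𝕜 E = 4)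
    {F : Type*} [NormedAddCommGroup F] [NormedSpace 𝕜 F] [FiniteDimensional 𝕜 F]
    (hF : Module.finrank 𝕜 F = 3)
    {M : Type*} [TopologicalSpace M] [ChartedSpace E M] [IsManifold 𝓘(𝕜, E) ∞ M]
    {Q : Type*} [TopologicalSpace Q] [ChartedSpace F Q] [IsManifold 𝓘(𝕜, F) ∞ Q]
    (c : ConformalGeometry.ConformalStructure 𝕜 E M)
    (o : ConformalGeometry.Orientation c) (hsd : o.IsSelfDual)
    (ι : Q → M) (hι : c.IsNondegenerateImmersion (F := F) ι) (humb : c.IsUmbilic (F := F) ι)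
    (g : M → E →L[𝕜] E →L[𝕜] 𝕜) (U : Set M) (hg : c.IsLocalMetric g U)
    (k : Q → F →L[𝕜] F →L[𝕜] 𝕜) (V : Set Q) (hk : c.IsInducedLocalMetric ι k V)
    (y : Q) (hyU : ι y ∈ U) (hyV : y ∈ V) (X Y Z : TangentSpace 𝓘(𝕜, F) y) :
    o.cottonPlusAt g (ι y) (mfderiv 𝓘(𝕜, F) 𝓘(𝕜, E) ι y X) (mfderiv 𝓘(𝕜, F) 𝓘(𝕜, E) ι y Y)
        (mfderiv 𝓘(𝕜, F) 𝓘(𝕜, E) ι y Z)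
      = ConformalGeometry.cottonAt k y X Y Z := by
  exact (hsd.cottonPlusAt_eq hg hE hyU _ _ _).trans
    (hsd.cottonAt_umbilic hE hF hι.contMDiff humb hg hk hyU hyV X Y Z)
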